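/- **Setting.** $V\ge 2$ nodes jointly minimize $f(x)=\frac1D\sum_{v}\sum_{i\in\mathcal D_v} f_i(x)=\sum_v \frac{D_v}{D}f^v(x)$ on $\mathbb R^d$, where node $v$ holds $D_v=|\mathcal D_v|\ge 1$ samples, $D=\sum_v D_v$, $f^v=\frac1{D_v}\sum_{i\in\mathcal D_v}f_i$, and every $f_i$ is differentiable. In each slot $t=0,\dots,T-1$ (with $T\ge1$) every node draws a sample $i_t^v$ uniformly from $\mathcal D_v$, independently of everything else, and starts the gradient $\nabla f_{i_t^v}(x_t^v)$ at its local model $x_t^v$; the gradient is applied, with constant learning rate $\eta$, at some slot in $\{t,\dots,t+E\}$. The nodes are organized in streams $m$ with node sets $\mathcal V_m$ that form a tree with root $r$ (one stream containing all nodes, in single-stream DIGEST). Each stream carries a global model $\tilde x[m]$ that is at one node at most in each slot. When stream $m$ is at node $v$, DIGEST sets $$\tilde x[m]\leftarrow \tilde x[m]+\tfrac{D_v}{D}(x^v-x^v_{-1})+(x^v_{-1}-\tilde x^v_{-1}[m]),\qquad x^v,\ x^v_{-1},\ \tilde x^v_{-1}[m]\leftarrow\tilde x[m],$$ where $x^v_{-1}$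 is the local model right after the last global update at $v$, and $\tilde x^v_{-1}[m]$ is the model of stream $m$ right after its last update at $v$; all models start at $x_0$. Each node of $\mathcal V_m$ is visited by stream $m$ in any $H_m$ consecutive slots of $1,\dots,T$. Put $H'=\max_v\sum_{m\in P_v^r}H_m$, where $P^r_v$ is the set of streams between $v$ and $r$ (so $H'=H$ for a single stream), $A=H'+E$ and $\rho=\sum_v(D_v/D)^2$. The gaps between visits, the lags and the order of visits are otherwise arbitrary, and do not depend on the drawn samples. **Assumptions.** Each $\nabla f^v$ is $L$-Lipschitz ($L>0$); along the local models produced by the algorithm, $\frac1{D_v}\sum_{i\in\mathcal D_v}\|\nabla f_i(x_t^v)-\nabla f^v(x_t^v)\|^2\le\sigma^2$ and $\|\nabla f^v(x_t^v)-\nabla f(x_t^v)\|^2\le\zeta^2$. The iid case is $\zeta=0$. "$f$ is $\mu$-strongly convex" means $f(y)\ge f(x)+\langle\nabla f(x),y-x\rangle+\frac\mu2\|y-x\|^2$ for all $x,y$ (convex: $\mu=0$). Put $\bar x_t=x_0-\sum_v\sum_{z<t}\frac{D_v}{D}\eta\nabla f_{i_z^v}(x_z^v)$, $\ \hat x_t^{\rm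 avg}=\sum_v\frac{D_v}{D}x_t^v$ and $\ell_T=1+\ln T$. In the (strongly) convex cases $x^*$ is a minimizer of $f$, $f^*=f(x^*)$ and $\|x_0-x^*\|^2\le R$. In the non-convex cases $f$ is bounded below, $f^*=\inf f$ and $f(x_0)-f^*\le F$. **Claim.** $\frac1V\le\rho<1$. Moreover, in each case below, for every $\kappa>0$ (and every $j\in\mathbb N$, in the strongly convex cases) there are a constant $C$ (and $k\in\mathbb N$, in the strongly convex cases), depending only on $L,\sigma,\zeta,\kappa$, on $R$ or $F$, and on $\mu, j$ in the strongly convex cases, and a learning rate $0<\eta\le\frac1{30LA}$, chosen from these constants and $T,A,\rho$ only, such that the following holds, uniformly in the network, the data, $d$, $T$ and the schedule. 1. *Strongly convex* ($f$ is $\mu$-strongly convex, $\mu>0$), with $\hat x_T=\frac1{W_T}\sum_{t<T}\omega_t\hat x_t^{\rm avg}$, $\omega_t=(1-\mu\eta)^{-(t+1)}$, $W_T=\sum_{t<T}\omega_t$. * iid: there is $c>0$ depending only on $L,\mu$ such that, if $A\le\kappa\,\rho T\,\ell_T^{\,j}$ and $A\,\ell_T\le cT$ (both hold for suitable constants when $A=\tilde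 O(\rho T)$ is read as $A\le c\rho T/\ell_T$), then $\mathbb E f(\hat x_T)-f^*\le C\,\ell_T^{\,k}\,\rho/T$. * non-iid ($\zeta\ge 0$): if $A\le\kappa\sqrt{\rho T}\,\ell_T^{\,j}$, then $\mathbb E f(\hat x_T)-f^*\le C\,\ell_T^{\,k}\,\rho/T$, and also $\mathbb E f(\hat x_T)-f^*\le C\sqrt{\rho/T}$. 2. *Convex*, with $\hat x_T=\frac1T\sum_{t<T}\hat x_t^{\rm avg}$: $\mathbb E f(\hat x_T)-f^*\le C\sqrt{\rho/T}$ holds * in the iid case if $f$ is convex and $A\le\kappa\,\rho^{3/2}T^{1/2}$; * in the non-iid case if every $f^v$ is convex and $A\le\kappa\,\rho^{3/4}T^{1/4}$. 3. *Non-convex*: $\frac1T\sum_{t<T}\mathbb E\|\nabla f(\bar x_t)\|^2\le C\sqrt{\rho/T}$ and $\frac1T\sum_{t<T}\mathbb E\|\nabla f(\hat x_t^{\rm avg})\|^2\le C\sqrt{\rho/T}$ hold * in the iid case if $A\le\kappa\,\rho^{3/2}T^{1/2}$; * in the non-iid case if $A\le\kappa\,\rho^{3/4}T^{1/4}$. 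-/

import Mathlib

open Finset
open scoped BigOperators

universe u

namespace Digest

/-- The model space `ℝ^d` with its Euclidean norm. -/
abbrev Model (d : ℕ) : Type := EuclideanSpace ℝ (Fin d)

/-! ### The optimization problem -/

/-- Data spread over the nodes `V`: node `v` holds `D v ≥ 1` samples, `loss v i` is the loss of its
`i`-th sample, and `x0` is the common initial model. -/
structure Problem (V : Type u) (d : ℕ) where
  D : V → ℕ
  D_pos : ∀ v, 0 < D v
  loss : (v : V) → Fin (D v) → Model d → ℝ
  loss_diff : ∀ v i, Differentiable ℝ (loss v i)
  x0 : Model d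

namespace Problem

variable {V : Type u} [Fintype V] {d : ℕ} (P : Problem V d)

/-- The total number `D` of samples. -/
def total : ℕ := ∑ v, P.D v

/-- The weight `D_v / D` of node `v`. -/
noncomputable def weight (v : V) : ℝ := (P.D v : ℝ) / (P.total : ℝ)

/-- The data concentration coefficient `ρ = ∑ v, (D_v / D)²`. -/
noncomputable def rho : ℝ := ∑ v, P.weight v ^ 2

/-- The local loss `f^v`. -/
noncomputable def localLoss (v : V) (x : Model d) : ℝ :=
  (1 / (P.D v : ℝ)) * ∑ i, P.loss v i x

/-- The global loss `f`, the average of the losses of all samples. -/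
noncomputable def globalLoss (x : Model d) : ℝ :=
  (1 / (P.total : ℝ)) * ∑ v, ∑ i, P.loss v i x

end Problem

/-- `f` is `μ`-strongly convex (first order form); for `μ = 0` this is convexity. -/
def StronglyConvex {d : ℕ} (μ : ℝ) (f : Model d → ℝ) : Prop :=
  ∀ x y, f x + inner ℝ (gradient f x) (y - x) + μ / 2 * ‖y - x‖ ^ 2 ≤ f y

/-! ### Streams, visits and delays -/

/-- The timing of an execution of DIGEST.

The `M` streams hang together as a tree with root node `root`. Every node `v ≠ root` belongs to
exactly one stream `up v` that leads from it towards the root; a stream `m` consists of its top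
node `top m` and of all `v ≠ root` with `up v = m`, so that two streams meet in at most one node;
`depth` witnesses that climbing from stream to stream ends at the root. Streams cut out of a
rooted spanning tree at its branching nodes are of this form. Single-stream DIGEST is the case
`M = 1`, where the only stream contains all nodes.

`token m t` is the node that receives the global model of stream `m` at slot `t`
(that is, `s_t^v[m] = 1` iff `token m t = some v`); it is `none` while the model is in transit or
its exchange is paused. The order of the visits is arbitrary (depth-first traversal of a connected
graph with arbitrary link delays is an instance).

`done v t` is the slot `l_t^v` at which the gradient started by `v` at slot `t` is applied. `H m` is
the synchronization bound of stream `m`, and `lag` is the bound `E` on the gradient delays. -/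
structure Protocol (V : Type u) where
  M : ℕ
  root : V
  up : V → Fin M
  top : Fin M → V
  depth : V → ℕ
  depth_lt : ∀ v, v ≠ root → depth (top (up v)) < depth v
  token : Fin M → ℕ → Option V
  done : V → ℕ → ℕ
  H : Fin M → ℕ
  lag : ℕ

namespace Protocol

variable {V : Type u} (S : Protocol V)

/-- The node set `V_m` of stream `m`. -/
def nodes (m : Fin S.M) : Set V := {v | v = S.top m ∨ (v ≠ S.root ∧ S.up v = m)}

/-- The set `P_v^r` of the streams between the node `v` and the root. -/
def pathStreams [DecidableEq V] (v : V) : Finset (Fin S.M) :=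
  if h : v = S.root then ∅ else insert (S.up v) (pathStreams (S.top (S.up v)))
termination_by S.depth v
decreasing_by exact S.depth_lt v h

/-- `H' = max_v ∑_{m ∈ P_v^r} H_m`; for a single stream this is `H`. -/
def Hprime [Fintype V] [DecidableEq V] : ℕ :=
  Finset.univ.sup fun v => ∑ m ∈ S.pathStreams v, S.H m

/-- `A = H' + E`. -/
def A [Fintype V] [DecidableEq V] : ℕ := S.Hprime + S.lag

/-- Visits of a stream take place at its nodes. -/
def VisitsOwnNodes : Prop := ∀ m t v, S.token m t = some v → v ∈ S.nodes m

/-- Bounded lag: a gradient is applied no earlier than it is started and at most `E` slots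
later. -/
def BoundedLag (T : ℕ) : Prop := ∀ v t, t < T → t ≤ S.done v t ∧ S.done v t ≤ t + S.lag

/-- Bounded synchronization interval: every node of stream `m` is visited by it in any `H m`
consecutive slots of `1, …, T`. -/
def BoundedSync (T : ℕ) : Prop :=
  ∀ m, ∀ v ∈ S.nodes m, ∀ t, t + S.H m ≤ T →
    ∃ τ, t < τ ∧ τ ≤ t + S.H m ∧ S.token m τ = some v

end Protocol

/-! ### The algorithm -/

/-- The variables of DIGEST with `M` streams: the local models `x v`; the copies `last v` of the
local models at their latest global update (`x_{-1}^v`); the global models `glob m` of the streams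
(`x̃[m]`); the global model `lastGlob v m` of stream `m` at its latest update at node `v`
(`x̃_{-1}[m]` at `v`); and the stochastic gradients `grad t v` computed so far. -/
structure State (V : Type u) (d M : ℕ) where
  x : V → Model d
  last : V → Model d
  glob : Fin M → Model d
  lastGlob : V → Fin M → Model d
  grad : ℕ → V → Model d

section Run

variable {V : Type u} [Fintype V] [DecidableEq V] {d : ℕ} (P : Problem V d) (S : Protocol V)

/-- All models are initialized with `x0`. -/
def initState : State V d S.M where
  x := fun _ => P.x0
  last := fun _ => P.x0
  glob := fun _ => P.x0
  lastGlob := fun _ _ => P.x0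
  grad := fun _ _ => 0

/-- Slot `t`: every node `v` computes the gradient of its sample `i t v` at its local model, and
then applies all its gradients that are due at slot `t`. -/
noncomputable def localStep (η : ℝ) (i : ℕ → ∀ v, Fin (P.D v)) (t : ℕ) (s : State V d S.M) :
    State V d S.M :=
  let g := Function.update s.grad t fun v => gradient (P.loss v (i t v)) (s.x v)
  { s with
    grad := g
    x := fun v => s.x v - ∑ z ∈ (range (t + 1)).filter (fun z => S.done v z = t), η • g z v }

/-- The global update when the global model of stream `m` is at node `v`. With a single stream
`last v = lastGlob v m`, and the last term of `g` vanishes. -/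
noncomputable def visit (m : Fin S.M) (v : V) (s : State V d S.M) : State V d S.M :=
  let g := s.glob m + P.weight v • (s.x v - s.last v) + (s.last v - s.lastGlob v m)
  { s with
    x := Function.update s.x v g
    last := Function.update s.last v g
    glob := Function.update s.glob m g
    lastGlob := Function.update s.lastGlob v (Function.update (s.lastGlob v) m g) }

/-- From slot `t` to slot `t + 1`: the local updates, followed by the global updates of all streams
that are at some node, one stream after the other. -/
noncomputable def step (η : ℝ) (i : ℕ → ∀ v, Fin (P.D v)) (t : ℕ) (s : State V d S.M) :
    State V d S.M :=
  (List.finRange S.M).foldl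
    (fun s' m => match S.token m (t + 1) with
      | some v => visit P S m v s'
      | none => s')
    (localStep P S η i t s)

/-- The state of DIGEST at slot `t`, with learning rate `η` and drawn samples `i`. -/
noncomputable def run (η : ℝ) (i : ℕ → ∀ v, Fin (P.D v)) : ℕ → State V d S.M
  | 0 => initState P S
  | t + 1 => step P S η i t (run η i t)

/-- The local model `x_t^v`. -/
noncomputable def localModel (η : ℝ) (i : ℕ → ∀ v, Fin (P.D v)) (t : ℕ) (v : V) : Model d :=
  (run P S η i t).x v

/-- The weighted average `∑ v, (D_v / D) x_t^v` of the local models. -/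
noncomputable def averageModel (η : ℝ) (i : ℕ → ∀ v, Fin (P.D v)) (t : ℕ) : Model d :=
  ∑ v, P.weight v • localModel P S η i t v

/-- The virtual sequence `x̄_t = x_0 - ∑ v, ∑ z < t, (D_v / D) η ∇f_{i_z^v}(x_z^v)`. -/
noncomputable def virtualModel (η : ℝ) (i : ℕ → ∀ v, Fin (P.D v)) (t : ℕ) : Model d :=
  P.x0 - ∑ v, ∑ z ∈ range t,
    (P.weight v * η) • gradient (P.loss v (i z v)) (localModel P S η i z v)

/-- The output in the convex case, `x̂_T = (1/T) ∑ t < T, ∑ v, (D_v / D) x_t^v`. -/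
noncomputable def uniformOutput (η : ℝ) (T : ℕ) (i : ℕ → ∀ v, Fin (P.D v)) : Model d :=
  (1 / (T : ℝ)) • ∑ t ∈ range T, averageModel P S η i t

/-- The output in the strongly convex case, `x̂_T = (1 / W_T) ∑ t < T, ω_t ∑ v, (D_v / D) x_t^v`
with `ω_t = (1 - μ η)^{-(t+1)}` and `W_T = ∑ t < T, ω_t`. -/
noncomputable def weightedOutput (μ η : ℝ) (T : ℕ) (i : ℕ → ∀ v, Fin (P.D v)) : Model d :=
  (1 / ∑ t ∈ range T, ((1 - μ * η) ^ (t + 1))⁻¹) •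
    ∑ t ∈ range T, ((1 - μ * η) ^ (t + 1))⁻¹ • averageModel P S η i t

/-- A sample sequence of length `T`, prolonged in an irrelevant way. -/
def extend (T : ℕ) (ω : Fin T → ∀ v, Fin (P.D v)) : ℕ → ∀ v, Fin (P.D v) :=
  fun t => if h : t < T then ω ⟨t, h⟩ else fun v => ⟨0, P.D_pos v⟩

/-- Expectation over the samples of the slots `0, …, T - 1`, all drawn independently, `i_t^v`
uniformly from the data of `v`: the average over all sample sequences. -/
noncomputable def expectation (T : ℕ) (g : (ℕ → ∀ v, Fin (P.D v)) → ℝ) : ℝ :=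
  Finset.univ.expect fun ω : Fin T → ∀ v, Fin (P.D v) => g (extend P T ω)

/-- The standing assumptions on an execution of length `T ≥ 1` with learning rate `η`. The variance
and the diversity are bounded along the local models that the algorithm produces. -/
structure Admissible (T : ℕ) (η L σ ζ : ℝ) : Prop where
  one_le : 1 ≤ T
  visits : S.VisitsOwnNodes
  smooth : ∀ v x y, ‖gradient (P.localLoss v) y - gradient (P.localLoss v) x‖ ≤ L * ‖y - x‖
  variance : ∀ i, ∀ t < T, ∀ v,
    (1 / (P.D v : ℝ)) * ∑ j, ‖gradient (P.loss v j) (localModel P S η i t v)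
      - gradient (P.localLoss v) (localModel P S η i t v)‖ ^ 2 ≤ σ ^ 2
  diversity : ∀ i, ∀ t < T, ∀ v,
    ‖gradient (P.localLoss v) (localModel P S η i t v)
      - gradient P.globalLoss (localModel P S η i t v)‖ ^ 2 ≤ ζ ^ 2
  lag : S.BoundedLag T
  sync : S.BoundedSync T

end Run

/-- A rule that fixes the learning rate from `T`, `A = H' + E` and `ρ`, with
`0 < η ≤ 1 / (30 L A)`. -/
def IsLearningRate (L : ℝ) (η : ℕ → ℕ → ℝ → ℝ) : Prop :=
  ∀ (T A : ℕ) (ρ : ℝ), 1 ≤ T → 1 ≤ A → 0 < ρ → 0 < η T A ρ ∧ η T A ρ ≤ 1 / (30 * L * A)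

/-- The mean squared gradient norm `(1/T) ∑ t < T, E ‖∇f(x_t)‖²` along a random sequence `x`. -/
noncomputable def meanSqGrad {V : Type u} [Fintype V] [DecidableEq V] {d : ℕ} (P : Problem V d)
    (T : ℕ) (x : (ℕ → ∀ v, Fin (P.D v)) → ℕ → Model d) : ℝ :=
  (1 / (T : ℝ)) * ∑ t ∈ range T, expectation P T fun i => ‖gradient P.globalLoss (x i t)‖ ^ 2

end Digest

/-! All local models are compared with the virtual sequence `virtualModel`. It moves like SGD on
`globalLoss`, except that the gradients are taken at the local models. The noises of different nodes
are independent, so the noise of one virtual step has variance at most `σ² ρ`; this is how `ρ`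
enters.

Combinatorial half. Every model kept by DIGEST at its updates equals `x0` minus, for each node `u`,
the weighted gradients of `u` applied before some slot, the stamp of `u`. A visit takes the maximum
of two stamps: `last v - lastGlob v m` adds what `v` knows and removes what the stream already had,
because `lastGlob v m` carries the minimum of the two stamps. The tree structure keeps this true:
news of a given node cross between `v` and stream `m` in one direction only, so which stamp is
smaller is known beforehand (`Describes.visit`). News cross stream `m` with delay at most `2 * H m`,
hence travel to the root and down again with delay at most `4 * H'`. So a local model differs from
the virtual one by `η` times a combination of gradients started in the last `4 * A` slots, with
coefficients that depend on the schedule only and have total mass at most 2 per slot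
(`localModel_sub_virtualModel`).

Analytic half. In this combination the noises are pairwise orthogonal and contribute order `η² A
σ²`. The mean gradients are bounded by Cauchy–Schwarz and contribute order `η² A²` times `ζ²`, the
squared gradients and `L²` times the deviations; the deviations, and in the convergence argument the
gradients, are absorbed when `L η A` is small (`sum_expectation_deviation_le`). The usual one-step
inequalities for the virtual sequence then give an error of order `R / (η W) + η² (A σ² + A² ζ²) + η
σ² ρ`, with `W` the sum of the weights (`W = T` and `F` for `R` without convexity). The convex cases
share one argument (`expectation_weightedOutput_le`) and differ only in how the mean update is shown
to point towards the minimizer.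

Rates. With `η = 1 / √(ρT)`, or `η = 3ℓ / (μT)` under strong convexity, capped at order `1 / A`, the
last term has the claimed size. The thresholds on `A` bring the drift term to this size and make the
cap harmless. In the iid case the drift is linear in `A`, otherwise quadratic, so the non-iid
thresholds are of square-root type. -/

namespace Digest

/-! ### The tree of streams -/

namespace Protocol

variable {V : Type u} (S : Protocol V)

/-- `S.Above v w`: the node `v` is met when climbing from `w` to the root. -/
inductive Above : V → V → Prop
  | refl (w : V) : Above w w
  | climb {v w : V} : w ≠ S.root → Above v (S.top (S.up w)) → Above v w

/-- The stream `m` is used when climbing from `w` to the root. -/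
def Through (m : Fin S.M) (w : V) : Prop := ∃ v, S.Above v w ∧ v ≠ S.root ∧ S.up v = m

/-- When stream `m` is cut off from its node `v`, the node `w` stays connected with `v`. -/
def OnSide (v : V) (m : Fin S.M) (w : V) : Prop :=
  (v = S.top m ∧ ¬ S.Through m w) ∨ (v ≠ S.top m ∧ S.Above v w)

variable {S}

theorem Above.depth_le {v w : V} (h : S.Above v w) : S.depth v ≤ S.depth w := by
  induction h with
  | refl => exact le_rfl
  | climb hw _ ih => exact ih.trans (S.depth_lt _ hw).le

theorem Above.top_up {v w : V} (h : S.Above v w) (hv : v ≠ S.root) :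
    S.Above (S.top (S.up v)) w := by
  induction h with
  | refl => exact .climb hv (.refl _)
  | climb hw _ ih => exact .climb hw ih

theorem not_above_top_up {v : V} (hv : v ≠ S.root) : ¬ S.Above v (S.top (S.up v)) :=
  fun h => absurd h.depth_le (not_le.2 (S.depth_lt v hv))

/-- The nodes met while climbing from `w` form a chain. If the two differ, the lower one leaves by
its own stream and meets the other at the top of that stream or later. -/
theorem Above.total {v v' w : V} (h : S.Above v w) (h' : S.Above v' w) :
    v = v' ∨ S.Above v (S.top (S.up v')) ∨ S.Above v' (S.top (S.up v)) := by
  induction h with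
  | refl =>
    cases h' with
    | refl => exact .inl rfl
    | climb _ h => exact .inr (.inr h)
  | climb hw h ih =>
    cases h' with
    | refl => exact .inr (.inl h)
    | climb _ h' => exact ih h'

/-- If they differed, the higher one would be met when climbing from the top of the lower one's
stream. That top is also the top of its own stream, which lies strictly closer to the root. -/
theorem Above.eq_of_top_eq {v v' w : V} (h : S.Above v w) (h' : S.Above v' w)
    (hv : v ≠ S.root) (hv' : v' ≠ S.root) (e : S.top (S.up v) = S.top (S.up v')) : v = v' := by
  rcases h.total h' with h | h | h
  · exact h
  · exact absurd (e ▸ h) (not_above_top_up hv)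
  · exact absurd (e ▸ h) (not_above_top_up hv')

theorem Through.above_top {m : Fin S.M} {w : V} (h : S.Through m w) : S.Above (S.top m) w := by
  obtain ⟨v, hv, hr, rfl⟩ := h
  exact hv.top_up hr

theorem onSide_self (v : V) (m : Fin S.M) : S.OnSide v m v := by
  by_cases h : v = S.top m
  · refine .inl ⟨h, ?_⟩
    rintro ⟨w, hw, hr, rfl⟩
    exact not_above_top_up hr (h ▸ hw)
  · exact .inr ⟨h, .refl v⟩

theorem eq_top_or {v : V} {m : Fin S.M} (h : v ∈ S.nodes m) :
    v = S.top m ∨ (v ≠ S.top m ∧ v ≠ S.root ∧ S.up v = m) := by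
  by_cases e : v = S.top m
  · exact .inl e
  · exact .inr ⟨e, h.resolve_left e⟩

/-- The path from `w` enters `v` through at most one stream, so at most one of the two cuts can
separate them. -/
theorem onSide_of_ne_stream {v w : V} {m m' : Fin S.M} (hm : v ∈ S.nodes m) (hm' : v ∈ S.nodes m')
    (hne : m ≠ m') (h : ¬ S.OnSide v m' w) : S.OnSide v m w := by
  rcases eq_top_or hm with e | ⟨e, hr, e'⟩ <;> rcases eq_top_or hm' with f | ⟨f, hr', f'⟩
  · refine .inl ⟨e, fun ht => h (.inl ⟨f, fun ht' => ?_⟩)⟩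
    obtain ⟨a, ha, har, rfl⟩ := ht
    obtain ⟨b, hb, hbr, rfl⟩ := ht'
    exact hne (by rw [ha.eq_of_top_eq hb har hbr (e ▸ f)])
  · exact .inl ⟨e, fun ht => h (.inr ⟨f, e ▸ ht.above_top⟩)⟩
  · refine .inr ⟨e, ?_⟩
    by_contra hn
    exact h (.inl ⟨f, fun ht => hn (f ▸ ht.above_top)⟩)
  · exact absurd (e'.symm.trans f') hne

/-- In a tree, removing stream `m` leaves its nodes in different components. -/
theorem not_onSide_of_ne_node {v v' w : V} {m : Fin S.M} (hv : v ∈ S.nodes m)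
    (hv' : v' ∈ S.nodes m) (hne : v ≠ v') (h : S.OnSide v' m w) : ¬ S.OnSide v m w := by
  rcases eq_top_or hv with e | ⟨e, hr, e'⟩ <;> rcases eq_top_or hv' with f | ⟨f, hr', f'⟩
  · exact absurd (e.trans f.symm) hne
  · have ha := (h.resolve_left fun q => f q.1).2
    exact fun q => (q.resolve_right fun q => q.1 e).2 ⟨v', ha, hr', f'⟩
  · have ha := (h.resolve_right fun q => q.1 f).2
    exact fun q => ha ⟨v, (q.resolve_left fun q => e q.1).2, hr, e'⟩
  · have ha := (h.resolve_left fun q => f q.1).2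
    exact fun q => hne ((q.resolve_left fun q => e q.1).2.eq_of_top_eq ha hr hr' (by rw [e', f']))

theorem through_of_mem_pathStreams [DecidableEq V] {m : Fin S.M} (w : V)
    (h : m ∈ S.pathStreams w) : S.Through m w := by
  rw [pathStreams] at h
  split_ifs at h with hw
  · simp at h
  · rcases mem_insert.1 h with rfl | h
    · exact ⟨w, .refl w, hw, rfl⟩
    · obtain ⟨v, hv, hr, e⟩ := through_of_mem_pathStreams (S.top (S.up w)) h
      exact ⟨v, .climb hw hv, hr, e⟩
termination_by S.depth w
decreasing_by exact S.depth_lt w hw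

theorem sum_pathStreams [DecidableEq V] {w : V} (hw : w ≠ S.root) :
    ∑ m ∈ S.pathStreams w, S.H m
      = S.H (S.up w) + ∑ m ∈ S.pathStreams (S.top (S.up w)), S.H m := by
  rw [pathStreams, dif_neg hw, sum_insert]
  intro h
  obtain ⟨v, hv, hr, e⟩ := through_of_mem_pathStreams _ h
  exact not_above_top_up hr (e ▸ hv)

theorem exists_child_of_root (w : V) (hw : w ≠ S.root) :
    ∃ v, v ≠ S.root ∧ S.top (S.up v) = S.root := by
  by_cases h : S.top (S.up w) = S.root
  · exact ⟨w, hw, h⟩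
  · exact exists_child_of_root _ h
termination_by S.depth w
decreasing_by exact S.depth_lt w hw

variable [Fintype V] [DecidableEq V]

theorem sum_pathStreams_le_Hprime (w : V) : ∑ m ∈ S.pathStreams w, S.H m ≤ S.Hprime :=
  Finset.le_sup (f := fun v => ∑ m ∈ S.pathStreams v, S.H m) (mem_univ w)

theorem H_up_le_Hprime {w : V} (hw : w ≠ S.root) : S.H (S.up w) ≤ S.Hprime := by
  have := S.sum_pathStreams_le_Hprime w
  rw [sum_pathStreams hw] at this
  omega

/-- The root has no stream of its own to climb; it is served by the stream of a node just below it,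
whose `H` is counted in `Hprime` through that node. -/
theorem exists_stream [Nontrivial V] (v : V) : ∃ m, v ∈ S.nodes m ∧ S.H m ≤ S.Hprime := by
  by_cases h : v = S.root
  · obtain ⟨w, hw⟩ := exists_ne S.root
    obtain ⟨a, ha, e⟩ := exists_child_of_root w hw
    exact ⟨S.up a, .inl (h.trans e.symm), H_up_le_Hprime ha⟩
  · exact ⟨S.up v, .inr ⟨h, rfl⟩, H_up_le_Hprime h⟩

theorem one_le_A [Nontrivial V] {T : ℕ} (h : S.BoundedSync T) : 1 ≤ S.A := by
  obtain ⟨w, hw⟩ := exists_ne S.root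
  have h1 : S.H (S.up w) ≠ 0 := by
    intro h0
    -- With `H = 0` a visit would have to occur at a slot `τ` with `0 < τ ≤ 0`.
    obtain ⟨τ, h1, h2, -⟩ := h (S.up w) w (.inr ⟨hw, rfl⟩) 0 (by omega)
    omega
  have := H_up_le_Hprime hw
  unfold A
  omega

end Protocol

/-! ### Stamps: which gradients a model contains -/

/-- For each node `u`, a stamp records that exactly the gradients of `u` applied before it have
entered the model in question: `last v` concerns the model at `v` after its latest global update,
and `glob m` the global model of stream `m`. -/
structure Stamps (V : Type u) (M : ℕ) where
  last : V → V → ℕ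
  glob : Fin M → V → ℕ

namespace Stamps

variable {V : Type u} {M : ℕ}

/-- The stamps only grow. -/
def Le (s s' : Stamps V M) : Prop := s.last ≤ s'.last ∧ s.glob ≤ s'.glob

theorem Le.refl (s : Stamps V M) : s.Le s := ⟨le_rfl, le_rfl⟩

theorem Le.trans {s s' s'' : Stamps V M} (h : s.Le s') (h' : s'.Le s'') : s.Le s'' :=
  ⟨h.1.trans h'.1, h.2.trans h'.2⟩

variable [DecidableEq V]

/-- The stamps after stream `m` visits `v` at slot `τ`. -/
def visit (τ : ℕ) (m : Fin M) (v : V) (s : Stamps V M) : Stamps V M :=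
  let g := s.glob m ⊔ s.last v ⊔ Pi.single v τ
  { last := Function.update s.last v g
    glob := Function.update s.glob m g }

theorem le_visit (τ : ℕ) (m : Fin M) (v : V) (s : Stamps V M) : s.Le (s.visit τ m v) := by
  refine ⟨fun w => ?_, fun n => ?_⟩
  · by_cases h : w = v
    · subst h
      simpa [visit] using le_sup_of_le_left le_sup_right
    · simp [visit, h]
  · by_cases h : n = m
    · subst h
      simpa [visit] using le_sup_of_le_left le_sup_left
    · simp [visit, h]

/-- The visit of stream `m` to the node with its token, if there is one. -/
def pass (τ : ℕ) (m : Fin M) (o : Option V) (s : Stamps V M) : Stamps V M :=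
  match o with
  | some v => s.visit τ m v
  | none => s

theorem le_pass (τ : ℕ) (m : Fin M) (o : Option V) (s : Stamps V M) : s.Le (s.pass τ m o) := by
  rcases o with _ | v
  · exact .refl s
  · exact s.le_visit τ m v

/-- The visits of the streams in the list `l`, with tokens `tok`. -/
def visits (τ : ℕ) (tok : Fin M → Option V) (l : List (Fin M)) (s : Stamps V M) : Stamps V M :=
  l.foldl (fun s' m => s'.pass τ m (tok m)) s

theorem le_visits (τ : ℕ) (tok : Fin M → Option V) (l : List (Fin M)) (s : Stamps V M) :
    s.Le (visits τ tok l s) := by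
  induction l generalizing s with
  | nil => exact .refl s
  | cons m l ih =>
    exact (s.le_pass τ m (tok m)).trans (ih _)

/-- Streams earlier in the list may already have raised the stamps, and later ones may raise them
again. By monotonicity the stamps from before the slot still give a lower bound, whatever the order
within the slot. -/
theorem sup_le_visits (τ : ℕ) (tok : Fin M → Option V) {l : List (Fin M)} (s : Stamps V M)
    {m : Fin M} (hm : m ∈ l) {v : V} (hv : tok m = some v) :
    s.glob m ⊔ s.last v ⊔ Pi.single v τ ≤ (visits τ tok l s).last v ∧
      s.glob m ⊔ s.last v ⊔ Pi.single v τ ≤ (visits τ tok l s).glob m := by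
  induction l generalizing s with
  | nil => simp at hm
  | cons n l ih =>
    by_cases h : m = n
    · subst h
      have e : visits τ tok (m :: l) s = visits τ tok l (s.visit τ m v) := by
        simp [visits, pass, hv]
      rw [e]
      obtain ⟨h1, h2⟩ := le_visits τ tok l (s.visit τ m v)
      exact ⟨le_trans (by simp [visit]) (h1 v), le_trans (by simp [visit]) (h2 m)⟩
    · have hm' : m ∈ l := by simpa [h] using hm
      have key : ∀ s' : Stamps V M, s.Le s' → _ := fun s' hs' =>
        let ⟨h1, h2⟩ := ih s' hm'
        have := sup_le_sup_right (sup_le_sup (hs'.2 m) (hs'.1 v)) (Pi.single v τ)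
        And.intro (this.trans h1) (this.trans h2)
      exact key _ (s.le_pass τ n (tok n))

end Stamps

/-! ### How far the stamps lag behind -/

section Fresh

variable {V : Type u} [DecidableEq V] (S : Protocol V)

/-- The stamps at slot `t`. -/
def stamps : ℕ → Stamps V S.M
  | 0 => ⟨fun _ _ => 0, fun _ _ => 0⟩
  | t + 1 => Stamps.visits (t + 1) (fun m => S.token m (t + 1)) (List.finRange S.M) (stamps t)

theorem stamps_mono {t t' : ℕ} (h : t ≤ t') : (stamps S t).Le (stamps S t') := by
  induction t', h using Nat.le_induction with
  | base => exact .refl _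
  | succ n _ ih => exact ih.trans (Stamps.le_visits _ _ _ _)

variable {S}

theorem le_last_self {τ : ℕ} {m : Fin S.M} {v : V} (h : S.token m τ = some v) (t : ℕ)
    (ht : τ ≤ t) : τ ≤ (stamps S t).last v v := by
  rcases τ with _ | τ
  · exact Nat.zero_le _
  · have := (Stamps.sup_le_visits (τ + 1) (S.token · (τ + 1)) (stamps S τ) (List.mem_finRange m) h).1 v
    refine le_trans ?_ (this.trans ((stamps_mono S ht).1 v v))
    simp

theorem le_glob_self {τ : ℕ} {m : Fin S.M} {v : V} (h : S.token m τ = some v) (t : ℕ)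
    (ht : τ ≤ t) : τ ≤ (stamps S t).glob m v := by
  rcases τ with _ | τ
  · exact Nat.zero_le _
  · have := (Stamps.sup_le_visits (τ + 1) (S.token · (τ + 1)) (stamps S τ) (List.mem_finRange m) h).2 v
    refine le_trans ?_ (this.trans ((stamps_mono S ht).2 m v))
    simp

theorem glob_le_last {τ : ℕ} {m : Fin S.M} {v : V} (h : S.token m (τ + 1) = some v) (t : ℕ)
    (ht : τ + 1 ≤ t) (w : V) : (stamps S τ).glob m w ≤ (stamps S t).last v w := by
  have := (Stamps.sup_le_visits (τ + 1) (S.token · (τ + 1)) (stamps S τ) (List.mem_finRange m) h).1 w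
  refine le_trans ?_ (this.trans ((stamps_mono S ht).1 v w))
  simp

theorem last_le_glob {τ : ℕ} {m : Fin S.M} {v : V} (h : S.token m (τ + 1) = some v) (t : ℕ)
    (ht : τ + 1 ≤ t) (w : V) : (stamps S τ).last v w ≤ (stamps S t).glob m w := by
  have := (Stamps.sup_le_visits (τ + 1) (S.token · (τ + 1)) (stamps S τ) (List.mem_finRange m) h).2 w
  refine le_trans ?_ (this.trans ((stamps_mono S ht).2 m w))
  simp

variable (S) in
/-- Up to slot `T`, the node `v` knows the gradients of `w` with a delay of at most `b`. -/
def Fresh (T : ℕ) (w : V) (b : ℕ) (v : V) : Prop :=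
  ∀ t ≤ T, v = w ∨ t ≤ (stamps S t).last v w + b

/-- The stream visited `v'` during the last `H m` slots, and during the `H m` slots before that
visit it collected what `v` knew. The strict lower bound on visit times in `BoundedSync` absorbs the
shift by one slot in `glob_le_last` and `last_le_glob`. -/
theorem Fresh.hop {T : ℕ} (hS : S.BoundedSync T) {w v v' : V} {b : ℕ} {m : Fin S.M}
    (h : Fresh S T w b v) (hv : v ∈ S.nodes m) (hv' : v' ∈ S.nodes m) :
    Fresh S T w (b + 2 * S.H m) v' := by
  intro t ht
  right
  -- In the initial phase the allowed delay covers the whole past.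
  by_cases ht2 : t ≤ 2 * S.H m
  · omega
  obtain ⟨τ, h1, h2, h3⟩ := hS m v' hv' (t - S.H m) (by omega)
  obtain ⟨τ, rfl⟩ : ∃ a, τ = a + 1 := ⟨τ - 1, by omega⟩
  obtain ⟨τ', h1', h2', h3'⟩ := hS m v hv (τ - S.H m) (by omega)
  obtain ⟨τ', rfl⟩ : ∃ a, τ' = a + 1 := ⟨τ' - 1, by omega⟩
  have e1 := glob_le_last h3 t (by omega) w
  rcases h τ' (by omega) with rfl | h4
  · have := le_glob_self h3' τ (by omega)
    omega
  · have := last_le_glob h3' τ (by omega) w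
    omega

theorem Fresh.to_root {T : ℕ} (hS : S.BoundedSync T) {w : V} (v : V) (b : ℕ)
    (h : Fresh S T w b v) : Fresh S T w (b + 2 * ∑ m ∈ S.pathStreams v, S.H m) S.root := by
  by_cases hv : v = S.root
  · intro t ht
    have := h t ht
    rw [hv] at this
    exact this.imp_right (by omega)
  · have := Fresh.to_root hS (S.top (S.up v)) _
      (h.hop (v' := S.top (S.up v)) hS (m := S.up v) (.inr ⟨hv, rfl⟩) (.inl rfl))
    rw [Protocol.sum_pathStreams hv]
    convert this using 1
    ring
termination_by S.depth v
decreasing_by exact S.depth_lt v hv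

theorem Fresh.of_root {T : ℕ} (hS : S.BoundedSync T) {w : V} (v : V) (b : ℕ)
    (h : Fresh S T w b S.root) : Fresh S T w (b + 2 * ∑ m ∈ S.pathStreams v, S.H m) v := by
  by_cases hv : v = S.root
  · intro t ht
    rw [hv]
    exact (h t ht).imp_right (by omega)
  · have := (Fresh.of_root hS (S.top (S.up v)) b h).hop (v' := v) hS (m := S.up v)
      (.inl rfl) (.inr ⟨hv, rfl⟩)
    rw [Protocol.sum_pathStreams hv]
    convert this using 1
    ring
termination_by S.depth v
decreasing_by exact S.depth_lt v hv

variable [Fintype V]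

/-- Climbing from `w` to the root and descending from there to `v` cost at most `2 * H'` each. -/
theorem le_last_add {T : ℕ} (hS : S.BoundedSync T) {v w : V} (hne : v ≠ w) {t : ℕ} (ht : t ≤ T) :
    t ≤ (stamps S t).last v w + 4 * S.Hprime := by
  have h0 : Fresh S T w 0 w := fun t _ => .inl rfl
  have := (((h0.to_root hS w 0).of_root hS v _) t ht).resolve_left hne
  have h1 := S.sum_pathStreams_le_Hprime v
  have h2 := S.sum_pathStreams_le_Hprime w
  omega

theorem le_last_self_add [Nontrivial V] {T : ℕ} (hS : S.BoundedSync T) (v : V) {t : ℕ}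
    (ht : t ≤ T) : t ≤ (stamps S t).last v v + S.Hprime := by
  obtain ⟨m, hm, hH⟩ := S.exists_stream v
  by_cases h : t < S.H m
  · omega
  obtain ⟨τ, h1, h2, h3⟩ := hS m v hm (t - S.H m) (by omega)
  have := le_last_self h3 t (by omega)
  omega

end Fresh

/-! ### The models of a run in terms of stamps, and their deviation from the virtual sequence -/

section Structure

variable {V : Type u} [Fintype V] [DecidableEq V] {d : ℕ} (P : Problem V d) (S : Protocol V)

/-- The stochastic gradient that `v` starts at slot `t`. -/
noncomputable def stochGrad (η : ℝ) (i : ℕ → ∀ v, Fin (P.D v)) (t : ℕ) (v : V) : Model d :=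
  gradient (P.loss v (i t v)) (localModel P S η i t v)

/-- The effect of the gradients of `w` applied before slot `k` on a model that contains them. -/
noncomputable def contribution (η : ℝ) (i : ℕ → ∀ v, Fin (P.D v)) (T : ℕ) (w : V) (k : ℕ) :
    Model d :=
  (P.weight w * η) • ∑ z ∈ range T with S.done w z < k, stochGrad P S η i z w

/-- The model that contains the gradients described by the stamp `κ`. -/
noncomputable def stamped (η : ℝ) (i : ℕ → ∀ v, Fin (P.D v)) (T : ℕ) (κ : V → ℕ) : Model d :=
  P.x0 - ∑ w, contribution P S η i T w (κ w)

variable {P S}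

theorem contribution_zero (η : ℝ) (i : ℕ → ∀ v, Fin (P.D v)) (T : ℕ) (w : V) :
    contribution P S η i T w 0 = 0 := by
  simp [contribution]

/-- Inclusion–exclusion, trivial because the two stamps are comparable; this identity is what makes
the update rule merge two models. -/
theorem contribution_sup (η : ℝ) (i : ℕ → ∀ v, Fin (P.D v)) (T : ℕ) (w : V) (a b : ℕ) :
    contribution P S η i T w (a ⊔ b) = contribution P S η i T w a + contribution P S η i T w b
      - contribution P S η i T w (a ⊓ b) := by
  rcases le_total a b with h | h <;> simp [h]

theorem sum_filter_lt_add (η : ℝ) (i : ℕ → ∀ v, Fin (P.D v)) (T : ℕ) (w : V) {a b : ℕ}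
    (h : a ≤ b) :
    ∑ z ∈ range T with S.done w z < b, stochGrad P S η i z w
      = ∑ z ∈ range T with S.done w z < a, stochGrad P S η i z w
        + ∑ z ∈ range T with a ≤ S.done w z ∧ S.done w z < b, stochGrad P S η i z w := by
  rw [← sum_union]
  · congr 1
    ext z
    simp only [mem_filter, mem_union, mem_range]
    omega
  · rw [disjoint_left]
    intro z
    simp only [mem_filter, mem_range]
    omega

/-- The state `s` is described by the stamps `k`, after the local updates of the slots before
`τ`. -/
structure Describes (η : ℝ) (i : ℕ → ∀ v, Fin (P.D v)) (T τ : ℕ) (s : State V d S.M)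
    (k : Stamps V S.M) : Prop where
  glob : ∀ m, s.glob m = stamped P S η i T (k.glob m)
  last : ∀ v, s.last v = stamped P S η i T (k.last v)
  lastGlob : ∀ m, ∀ v ∈ S.nodes m, s.lastGlob v m = stamped P S η i T (k.glob m ⊓ k.last v)
  x : ∀ v, s.x v = s.last v
    - η • ∑ z ∈ range T with k.last v v ≤ S.done v z ∧ S.done v z < τ, stochGrad P S η i z v
  side : ∀ m, ∀ v ∈ S.nodes m, ∀ w, S.OnSide v m w → k.glob m w ≤ k.last v w
  notSide : ∀ m, ∀ v ∈ S.nodes m, ∀ w, ¬ S.OnSide v m w → k.last v w ≤ k.glob m w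
  glob_le : ∀ m w, k.glob m w ≤ τ
  last_le : ∀ v w, k.last v w ≤ τ

/-- Since `lastGlob v m` carries the minimum of the stamps of `glob m` and `last v`, the sum `glob m
+ last v - lastGlob v m` carries their maximum. The gradients applied at `v` since its last global
update enter with its weight and lift its own stamp to `τ`. -/
theorem Describes.stamped_visit {η : ℝ} {i : ℕ → ∀ v, Fin (P.D v)} {T τ : ℕ} {s : State V d S.M}
    {k : Stamps V S.M} (h : Describes η i T τ s k) {m : Fin S.M} {v : V} (hv : v ∈ S.nodes m) :
    s.glob m + P.weight v • (s.x v - s.last v) + (s.last v - s.lastGlob v m)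
      = stamped P S η i T (k.glob m ⊔ k.last v ⊔ Pi.single v τ) := by
  have key : ∑ w, contribution P S η i T w ((k.glob m ⊔ k.last v ⊔ Pi.single v τ) w)
      = ∑ w, (contribution P S η i T w (k.glob m w) + contribution P S η i T w (k.last v w)
          - contribution P S η i T w ((k.glob m ⊓ k.last v) w)
          + if w = v then (P.weight v * η) •
            ∑ z ∈ range T with k.last v v ≤ S.done v z ∧ S.done v z < τ, stochGrad P S η i z v
            else 0) := by
    refine sum_congr rfl fun w _ => ?_
    by_cases hw : w = v
    · subst hw
      -- A node lies on its own side, so `last` dominates `glob m` at the own stamp: the infimum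
      -- cancels the contribution of `glob m`, and only the step from `last` to `τ` remains.
      have h1 := h.side m w hv w (Protocol.onSide_self w m)
      have h2 := h.last_le w w
      have e1 : (k.glob m ⊔ k.last w ⊔ Pi.single w τ) w = τ := by
        simp only [Pi.sup_apply, Pi.single_eq_same]
        omega
      have e2 : (k.glob m ⊓ k.last w) w = k.glob m w := by
        simp only [Pi.inf_apply]
        omega
      rw [e1, e2, if_pos rfl, add_sub_cancel_left, contribution, contribution,
        sum_filter_lt_add η i T w h2, smul_add]
    · rw [if_neg hw, add_zero]
      simp only [Pi.sup_apply, Pi.inf_apply, Pi.single_eq_of_ne hw, Nat.max_zero]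
      exact contribution_sup ..
  rw [h.glob, h.lastGlob m v hv, h.x, h.last, stamped, stamped, stamped, stamped, key,
    sum_add_distrib, sum_sub_distrib, sum_add_distrib, sum_ite_eq' univ v, if_pos (mem_univ v),
    mul_smul]
  rw [sub_sub_cancel_left, smul_neg]
  abel

/-- The fields `side` and `notSide` carry the induction: stream `m` hears of nodes on `v`'s side
only through `v`, and `v` hears of the others only through `m`. Apart from the own stamp of `v`, the
visit thus changes `last v` only off the side and `glob m` only on it. For every other pair of a
node and a stream, the smaller stamp, recorded by `lastGlob`, stays what it was. -/
theorem Describes.visit {η : ℝ} {i : ℕ → ∀ v, Fin (P.D v)} {T τ : ℕ} {s : State V d S.M}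
    {k : Stamps V S.M} (h : Describes η i T τ s k) {m : Fin S.M} {v : V} (hv : v ∈ S.nodes m) :
    Describes η i T τ (Digest.visit P S m v s) (k.visit τ m v) := by
  have hg := h.stamped_visit hv
  have hle : ∀ w, (k.glob m ⊔ k.last v ⊔ Pi.single v τ) w ≤ τ := by
    intro w
    have h1 := h.glob_le m w
    have h2 := h.last_le v w
    have h3 : (Pi.single v τ : V → ℕ) w ≤ τ := by
      by_cases hw : w = v
      · subst hw
        simp
      · simp [hw]
    simp only [Pi.sup_apply]
    omega
  have hown : (k.glob m ⊔ k.last v ⊔ Pi.single v τ) v = τ := le_antisymm (hle v) (by simp)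
  have hside : ∀ w, w ≠ v → S.OnSide v m w →
      (k.glob m ⊔ k.last v ⊔ Pi.single v τ) w = k.last v w := by
    intro w hw hs
    have := h.side m v hv w hs
    simp only [Pi.sup_apply, Pi.single_eq_of_ne hw]
    omega
  have hnot : ∀ w, ¬ S.OnSide v m w →
      (k.glob m ⊔ k.last v ⊔ Pi.single v τ) w = k.glob m w := by
    intro w hs
    have hw : w ≠ v := fun e => hs (e ▸ Protocol.onSide_self v m)
    have := h.notSide m v hv w hs
    simp only [Pi.sup_apply, Pi.single_eq_of_ne hw]
    omega
  have hlast : k.last v ≤ k.glob m ⊔ k.last v ⊔ Pi.single v τ := le_sup_of_le_left le_sup_right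
  have hglob : k.glob m ≤ k.glob m ⊔ k.last v ⊔ Pi.single v τ := le_sup_of_le_left le_sup_left
  have hown_not : ∀ n, n ≠ m → v ∈ S.nodes n → ∀ w, ¬ S.OnSide v n w →
      (k.glob m ⊔ k.last v ⊔ Pi.single v τ) w = k.last v w := by
    intro n hn hvn w hw
    exact hside w (fun e => hw (e ▸ Protocol.onSide_self v n))
      (Protocol.onSide_of_ne_stream hv hvn hn.symm hw)
  have hother : ∀ v', v' ≠ v → v' ∈ S.nodes m → ∀ w, S.OnSide v' m w →
      (k.glob m ⊔ k.last v ⊔ Pi.single v τ) w = k.glob m w := by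
    intro v' hne hv' w hw
    exact hnot w (Protocol.not_onSide_of_ne_node hv hv' hne.symm hw)
  refine ⟨fun n => ?_, fun v' => ?_, fun n v' hv' => ?_, fun v' => ?_, fun n v' hv' w hw => ?_,
    fun n v' hv' w hw => ?_, fun n w => ?_, fun v' w => ?_⟩
  · by_cases hn : n = m
    · subst hn
      simp [Digest.visit, Stamps.visit, hg]
    · simp [Digest.visit, Stamps.visit, hn, h.glob]
  · by_cases hn : v' = v
    · subst hn
      simp [Digest.visit, Stamps.visit, hg]
    · simp [Digest.visit, Stamps.visit, hn, h.last]
  · by_cases hn : n = m <;> by_cases hn' : v' = v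
    · subst hn hn'
      simp [Digest.visit, Stamps.visit, hg]
    · subst hn
      simp only [Digest.visit, Stamps.visit, Function.update_of_ne hn', Function.update_self,
        h.lastGlob n v' hv']
      congr 1
      ext w
      -- Another node of the visiting stream: `glob n` may have grown, but only where `last v'` is
      -- the minimum.
      by_cases hw : S.OnSide v' n w
      · simp only [Pi.inf_apply, hother v' hn' hv' w hw]
      · have h1 := h.notSide n v' hv' w hw
        exact (inf_of_le_right h1).trans (inf_of_le_right (h1.trans (hglob w))).symm
    · subst hn'
      simp only [Digest.visit, Stamps.visit, Function.update_of_ne hn, Function.update_self,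
        h.lastGlob n v' hv']
      congr 1
      ext w
      -- Another stream at the visited node: `last` may have grown, but only where `glob n` is the
      -- minimum.
      by_cases hw : S.OnSide v' n w
      · have h1 := h.side n v' hv' w hw
        exact (inf_of_le_left h1).trans (inf_of_le_left (h1.trans (hlast w))).symm
      · simp only [Pi.inf_apply, hown_not n hn hv' w hw]
    · simp [Digest.visit, Stamps.visit, hn, hn', h.lastGlob n v' hv']
  · by_cases hn : v' = v
    · subst hn
      simp only [Digest.visit, Stamps.visit, Function.update_self, hown]
      rw [filter_false_of_mem fun z _ => by omega]
      simp
    · simp [Digest.visit, Stamps.visit, hn, h.x]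
  · by_cases hn : n = m <;> by_cases hn' : v' = v
    · subst hn hn'
      simp [Stamps.visit]
    · subst hn
      simp only [Stamps.visit, Function.update_of_ne hn', Function.update_self,
        hother v' hn' hv' w hw]
      exact h.side n v' hv' w hw
    · subst hn'
      simp only [Stamps.visit, Function.update_of_ne hn, Function.update_self]
      exact (h.side n v' hv' w hw).trans (hlast w)
    · simpa [Stamps.visit, hn, hn'] using h.side n v' hv' w hw
  · by_cases hn : n = m <;> by_cases hn' : v' = v
    · subst hn hn'
      simp [Stamps.visit]
    · subst hn
      simp only [Stamps.visit, Function.update_of_ne hn', Function.update_self]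
      exact (h.notSide n v' hv' w hw).trans (hglob w)
    · subst hn'
      simp only [Stamps.visit, Function.update_of_ne hn, Function.update_self,
        hown_not n hn hv' w hw]
      exact h.notSide n v' hv' w hw
    · simpa [Stamps.visit, hn, hn'] using h.notSide n v' hv' w hw
  · by_cases hn : n = m
    · subst hn
      simpa only [Stamps.visit, Function.update_self] using hle w
    · simpa only [Stamps.visit, Function.update_of_ne hn] using h.glob_le n w
  · by_cases hn : v' = v
    · subst hn
      simpa only [Stamps.visit, Function.update_self] using hle w
    · simpa only [Stamps.visit, Function.update_of_ne hn] using h.last_le v' w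

theorem foldl_grad (tok : Fin S.M → Option V) (l : List (Fin S.M)) (s : State V d S.M) :
    (l.foldl (fun s' m => match tok m with
      | some v => visit P S m v s'
      | none => s') s).grad = s.grad := by
  induction l generalizing s with
  | nil => rfl
  | cons m l ih =>
    rw [List.foldl_cons, ih]
    rcases tok m with _ | v <;> rfl

theorem run_grad (η : ℝ) (i : ℕ → ∀ v, Fin (P.D v)) {z t : ℕ} (h : z < t) (v : V) :
    (run P S η i t).grad z v = stochGrad P S η i z v := by
  induction t with
  | zero => omega
  | succ t ih =>
    have e : (run P S η i (t + 1)).grad = (localStep P S η i t (run P S η i t)).grad :=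
      foldl_grad (S.token · (t + 1)) _ _
    rw [e]
    rcases Nat.lt_succ_iff_lt_or_eq.1 h with h | rfl
    · simpa [localStep, h.ne] using ih h
    · simp [localStep, stochGrad, localModel]

theorem Describes.localStep {η : ℝ} {i : ℕ → ∀ v, Fin (P.D v)} {T t : ℕ} (ht : t < T)
    (hlag : S.BoundedLag T) {k : Stamps V S.M} (h : Describes η i T t (run P S η i t) k) :
    Describes η i T (t + 1) (localStep P S η i t (run P S η i t)) k where
  glob := h.glob
  last := h.last
  lastGlob := h.lastGlob
  side := h.side
  notSide := h.notSide
  glob_le m w := (h.glob_le m w).trans t.le_succ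
  last_le v w := (h.last_le v w).trans t.le_succ
  x v := by
    have hk := h.last_le v v
    have e : ∑ z ∈ (range (t + 1)).filter (fun z => S.done v z = t), η •
          (Function.update (run P S η i t).grad t fun v =>
            gradient (P.loss v (i t v)) ((run P S η i t).x v)) z v
        = η • ∑ z ∈ range T with S.done v z = t, stochGrad P S η i z v := by
      rw [smul_sum]
      refine sum_congr ?_ fun z hz => ?_
      · ext z
        simp only [mem_filter, mem_range]
        constructor
        · rintro ⟨h1, h2⟩
          exact ⟨by omega, h2⟩
        · rintro ⟨h1, h2⟩
          have := (hlag v z h1).1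
          exact ⟨by omega, h2⟩
      · congr 1
        simp only [mem_filter, mem_range] at hz
        by_cases hzt : z = t
        · subst hzt
          simp [stochGrad, localModel]
        · rw [Function.update_of_ne hzt]
          have := (hlag v z hz.1).1
          exact run_grad η i (by omega) v
    have e2 : ∑ z ∈ range T with k.last v v ≤ S.done v z ∧ S.done v z < t + 1,
          stochGrad P S η i z v
        = ∑ z ∈ range T with k.last v v ≤ S.done v z ∧ S.done v z < t, stochGrad P S η i z v
          + ∑ z ∈ range T with S.done v z = t, stochGrad P S η i z v := by
      rw [← sum_union]
      · congr 1
        ext z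
        simp only [mem_filter, mem_union, mem_range]
        omega
      · rw [disjoint_left]
        intro z
        simp only [mem_filter, mem_range]
        omega
    rw [e2]
    simp only [Digest.localStep]
    rw [e, h.x v, smul_add]
    abel

theorem Describes.visits {η : ℝ} {i : ℕ → ∀ v, Fin (P.D v)} {T τ : ℕ}
    (hS : S.VisitsOwnNodes) (l : List (Fin S.M)) {s : State V d S.M}
    {k : Stamps V S.M} (h : Describes η i T τ s k) :
    Describes η i T τ (l.foldl (fun s' m => match S.token m τ with
      | some v => Digest.visit P S m v s'
      | none => s') s) (k.visits τ (S.token · τ) l) := by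
  induction l generalizing s k with
  | nil => exact h
  | cons m l ih =>
    rw [List.foldl_cons]
    refine ih (k := k.pass τ m (S.token m τ)) ?_
    rcases e : S.token m τ with _ | v
    · exact h
    · exact h.visit (hS m τ v e)

theorem describes_run {T : ℕ} (hlag : S.BoundedLag T) (hS : S.VisitsOwnNodes) (η : ℝ)
    (i : ℕ → ∀ v, Fin (P.D v)) {t : ℕ} (ht : t ≤ T) :
    Describes η i T t (run P S η i t) (stamps S t) := by
  induction t with
  | zero =>
    have e : stamped P S η i T (fun _ => 0) = P.x0 := by simp [stamped, contribution_zero]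
    refine ⟨fun m => ?_, fun v => ?_, fun m v _ => ?_, fun v => ?_, ?_, ?_, ?_, ?_⟩
    · simpa [run, initState, stamps] using e.symm
    · simpa [run, initState, stamps] using e.symm
    · have e' : (fun _ : V => 0) ⊓ (fun _ => 0) = (fun _ => 0 : V → ℕ) := inf_idem _
      simp only [run, initState, stamps]
      rw [e', e]
    · simp [run, initState]
    all_goals intros; simp [stamps]
  | succ t ih =>
    exact Describes.visits hS _ ((ih (by omega)).localStep (by omega) hlag)

/-- The coefficient of the gradient that `w` starts at slot `z` in the deviation of the local model
of `v` from the virtual sequence at slot `t`. -/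
noncomputable def devCoeff (P : Problem V d) (S : Protocol V) (t : ℕ) (v w : V) (z : ℕ) : ℝ :=
  (if (stamps S t).last v w ≤ S.done w z then P.weight w else 0)
    - if w = v ∧ (stamps S t).last v v ≤ S.done v z ∧ S.done v z < t then 1 else 0

theorem abs_devCoeff_le (t : ℕ) (v w : V) (z : ℕ) :
    |devCoeff P S t v w z| ≤ P.weight w + if w = v then 1 else 0 := by
  have hw : 0 ≤ P.weight w := by unfold Problem.weight; positivity
  unfold devCoeff
  by_cases h : w = v
  · subst h
    simp only [true_and, if_true]
    split_ifs <;> rw [abs_le] <;> constructor <;> linarith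
  · simp only [h, false_and, if_false]
    split_ifs <;> rw [abs_le] <;> constructor <;> linarith

/-- Gradients of `w` applied before the stamp `last v w` occur in both models with the same
coefficient and cancel. The stamp is at least `t - 4 * H'` and the lag at most `E`, so all gradients
started before `t - 4 * A` are of this kind. What remains are gradients missing in the local model
and those that `v` has so far applied with full instead of weighted step. -/
theorem localModel_sub_virtualModel [Nontrivial V] {T : ℕ} (hlag : S.BoundedLag T)
    (hS : S.VisitsOwnNodes) (hsync : S.BoundedSync T) (η : ℝ) (i : ℕ → ∀ v, Fin (P.D v)) {t : ℕ}
    (ht : t ≤ T) (v : V) :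
    localModel P S η i t v - virtualModel P S η i t
      = η • ∑ w, ∑ z ∈ Ico (t - 4 * S.A) t, devCoeff P S t v w z • stochGrad P S η i z w := by
  have h := describes_run hlag hS η i ht
  set k := (stamps S t).last v with hk
  have e1 : localModel P S η i t v - virtualModel P S η i t
      = ∑ w, (∑ z ∈ range t, (P.weight w * η) • stochGrad P S η i z w
          - contribution P S η i T w (k w)
          - if w = v then η • ∑ z ∈ range T with k v ≤ S.done v z ∧ S.done v z < t,
              stochGrad P S η i z v else 0) := by
    rw [sum_sub_distrib, sum_sub_distrib, sum_ite_eq' univ v, if_pos (mem_univ v), localModel,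
      virtualModel, h.x, h.last, stamped]
    simp only [← hk, stochGrad]
    abel
  rw [e1, smul_sum (s := (univ : Finset V))]
  refine sum_congr rfl fun w _ => ?_
  have hkt : k w ≤ t := h.last_le v w
  have hA : S.A = S.Hprime + S.lag := rfl
  have e2 : ∑ z ∈ range t, (P.weight w * η) • stochGrad P S η i z w
      - contribution P S η i T w (k w)
      = ∑ z ∈ Ico (t - 4 * S.A) t,
        (if k w ≤ S.done w z then P.weight w * η else 0) • stochGrad P S η i z w := by
    rw [sub_eq_iff_eq_add, contribution, smul_sum]
    have : ∑ z ∈ Ico (t - 4 * S.A) t,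
        (if k w ≤ S.done w z then P.weight w * η else 0) • stochGrad P S η i z w
        = ∑ z ∈ range t with k w ≤ S.done w z, (P.weight w * η) • stochGrad P S η i z w := by
      simp only [ite_smul, zero_smul]
      rw [← sum_filter]
      refine sum_congr ?_ fun _ _ => rfl
      ext z
      simp only [mem_filter, mem_Ico, mem_range]
      constructor
      · rintro ⟨⟨h1, h2⟩, h3⟩
        exact ⟨h2, h3⟩
      · rintro ⟨h2, h3⟩
        refine ⟨⟨?_, h2⟩, h3⟩
        have h4 := (hlag w z (by omega)).2
        by_cases hw : v = w
        · subst hw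
          have := le_last_self_add hsync v ht
          rw [← hk] at this
          omega
        · have := le_last_add hsync hw ht
          rw [← hk] at this
          omega
    rw [this, add_comm]
    -- A gradient applied before the stamp, which is at most `t`, was also started before `t`; the
    -- horizon `T` in `contribution` adds nothing.
    have h6 : (range T).filter (fun z => S.done w z < k w)
        = (range t).filter (fun z => ¬ k w ≤ S.done w z) := by
      ext z
      simp only [mem_filter, mem_range, not_le]
      constructor
      · rintro ⟨h1, h2⟩
        have := (hlag w z h1).1
        exact ⟨by omega, h2⟩
      · rintro ⟨h1, h2⟩
        exact ⟨by omega, h2⟩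
    rw [h6, add_comm, sum_filter_add_sum_filter_not]
  have e3 : (if w = v then η • ∑ z ∈ range T with k v ≤ S.done v z ∧ S.done v z < t,
        stochGrad P S η i z v else 0)
      = ∑ z ∈ Ico (t - 4 * S.A) t,
        (if w = v ∧ k v ≤ S.done v z ∧ S.done v z < t then η else 0) • stochGrad P S η i z w := by
    by_cases hw : w = v
    · subst hw
      simp only [if_true, true_and, ite_smul, zero_smul]
      rw [← sum_filter, smul_sum]
      refine sum_congr ?_ fun _ _ => rfl
      ext z
      simp only [mem_filter, mem_Ico, mem_range]
      have h5 := le_last_self_add hsync w ht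
      rw [← hk] at h5
      constructor
      · rintro ⟨h1, h2, h3⟩
        have := hlag w z h1
        exact ⟨by omega, h2, h3⟩
      · rintro ⟨h1, h2, h3⟩
        exact ⟨by omega, h2, h3⟩
    · simp [hw]
  rw [e2, e3, ← sum_sub_distrib, smul_sum]
  refine sum_congr rfl fun z _ => ?_
  rw [← sub_smul, smul_smul]
  congr 1
  unfold devCoeff
  rw [← hk]
  split_ifs <;> ring

end Structure

/-! ### Gradients of the local and the global losses -/

section Gradients

theorem gradient_const_mul_sum {d : ℕ} {ι : Type*} (s : Finset ι) (c : ℝ) (f : ι → Model d → ℝ)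
    (hf : ∀ j ∈ s, Differentiable ℝ (f j)) (x : Model d) :
    gradient (fun y => c * ∑ j ∈ s, f j y) x = c • ∑ j ∈ s, gradient (f j) x := by
  unfold gradient
  rw [fderiv_const_mul (DifferentiableAt.fun_sum fun j hj => hf j hj x),
    fderiv_fun_sum fun j hj => hf j hj x]
  simp

namespace Problem

variable {V : Type u} {d : ℕ} (P : Problem V d)

theorem localLoss_differentiable (v : V) : Differentiable ℝ (P.localLoss v) :=
  (Differentiable.fun_sum fun i _ => P.loss_diff v i).const_mul _

theorem gradient_localLoss (v : V) (x : Model d) :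
    gradient (P.localLoss v) x = (1 / (P.D v : ℝ)) • ∑ i, gradient (P.loss v i) x :=
  gradient_const_mul_sum _ _ _ (fun i _ => P.loss_diff v i) x

variable [Fintype V]

theorem globalLoss_eq (x : Model d) : P.globalLoss x = ∑ v, P.weight v * P.localLoss v x := by
  unfold globalLoss localLoss weight
  rw [mul_sum]
  refine sum_congr rfl fun v _ => ?_
  have : (P.D v : ℝ) ≠ 0 := by exact_mod_cast (P.D_pos v).ne'
  field_simp

theorem globalLoss_differentiable : Differentiable ℝ P.globalLoss :=
  (Differentiable.fun_sum fun v _ =>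
    Differentiable.fun_sum fun i _ => P.loss_diff v i).const_mul _

theorem gradient_globalLoss (x : Model d) :
    gradient P.globalLoss x = ∑ v, P.weight v • gradient (P.localLoss v) x := by
  have e : P.globalLoss = fun y => 1 * ∑ v, P.weight v * P.localLoss v y := by
    ext y
    rw [P.globalLoss_eq, one_mul]
  rw [e, gradient_const_mul_sum _ _ _ fun v _ => (P.localLoss_differentiable v).const_mul _,
    one_smul]
  refine sum_congr rfl fun v _ => ?_
  simpa using gradient_const_mul_sum {v} (P.weight v) P.localLoss
    (fun v _ => P.localLoss_differentiable v) x

theorem weight_nonneg (v : V) : 0 ≤ P.weight v := by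
  unfold weight
  positivity

theorem sum_weight [Nonempty V] : ∑ v, P.weight v = 1 := by
  unfold weight
  have h : (P.total : ℝ) ≠ 0 := by
    have : 0 < P.total := sum_pos (fun v _ => P.D_pos v) univ_nonempty
    exact_mod_cast this.ne'
  rw [← sum_div, div_eq_one_iff_eq h]
  simp [total]

theorem weight_pos [Nonempty V] (v : V) : 0 < P.weight v := by
  have : 0 < P.total := sum_pos (fun v _ => P.D_pos v) univ_nonempty
  have := P.D_pos v
  unfold weight
  positivity

theorem one_div_card_le_rho [Nonempty V] : 1 / (Fintype.card V : ℝ) ≤ P.rho := by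
  have h := sq_sum_le_card_mul_sum_sq (s := (univ : Finset V)) (f := P.weight)
  rw [P.sum_weight, one_pow, card_univ] at h
  rw [div_le_iff₀' (by exact_mod_cast Fintype.card_pos)]
  exact h

theorem rho_pos [Nonempty V] : 0 < P.rho :=
  lt_of_lt_of_le (by have := Fintype.card_pos (α := V); positivity) P.one_div_card_le_rho

theorem rho_lt_one [Nontrivial V] : P.rho < 1 := by
  rw [← P.sum_weight]
  have hlt : ∀ v, P.weight v < 1 := by
    intro v
    obtain ⟨w, hw⟩ := exists_ne v
    rw [← P.sum_weight]
    exact single_lt_sum hw (mem_univ v) (mem_univ w) (P.weight_pos w)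
      fun k _ _ => P.weight_nonneg k
  refine sum_lt_sum_of_nonempty univ_nonempty fun v _ => ?_
  have := P.weight_pos v
  nlinarith [hlt v]

end Problem

end Gradients

/-! ### Expectations over the samples -/

section Expectation

variable {V : Type u} [Fintype V] [DecidableEq V] {d : ℕ} {P : Problem V d} {S : Protocol V}

theorem expectation_add (T : ℕ) (g h : (ℕ → ∀ v, Fin (P.D v)) → ℝ) :
    expectation P T (fun i => g i + h i) = expectation P T g + expectation P T h :=
  expect_add_distrib ..

theorem expectation_sub (T : ℕ) (g h : (ℕ → ∀ v, Fin (P.D v)) → ℝ) :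
    expectation P T (fun i => g i - h i) = expectation P T g - expectation P T h :=
  expect_sub_distrib ..

theorem expectation_const_mul (T : ℕ) (c : ℝ) (g : (ℕ → ∀ v, Fin (P.D v)) → ℝ) :
    expectation P T (fun i => c * g i) = c * expectation P T g :=
  (mul_expect ..).symm

theorem expectation_sum (T : ℕ) {ι : Type*} (s : Finset ι)
    (g : ι → (ℕ → ∀ v, Fin (P.D v)) → ℝ) :
    expectation P T (fun i => ∑ j ∈ s, g j i) = ∑ j ∈ s, expectation P T (g j) :=
  expect_sum_comm ..

theorem expectation_mono (T : ℕ) {g h : (ℕ → ∀ v, Fin (P.D v)) → ℝ} (hgh : ∀ i, g i ≤ h i) :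
    expectation P T g ≤ expectation P T h :=
  expect_le_expect fun _ _ => hgh _

theorem expectation_const (T : ℕ) (c : ℝ) : expectation P T (fun _ => c) = c := by
  have : Nonempty (Fin T → ∀ v, Fin (P.D v)) := ⟨fun _ v => ⟨0, P.D_pos v⟩⟩
  exact expect_const univ_nonempty c

theorem expectation_nonneg (T : ℕ) {g : (ℕ → ∀ v, Fin (P.D v)) → ℝ} (h : ∀ i, 0 ≤ g i) :
    0 ≤ expectation P T g := by
  rw [← expectation_const (P := P) T 0]
  exact expectation_mono T h

/-- The sample sequence `i` with the sample of `v` at slot `t` replaced by `j`. -/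
def resample (i : ℕ → ∀ v, Fin (P.D v)) (t : ℕ) (v : V) (j : Fin (P.D v)) :
    ℕ → ∀ v, Fin (P.D v) :=
  Function.update i t (Function.update (i t) v j)

omit [Fintype V] in
theorem resample_of_ne (i : ℕ → ∀ v, Fin (P.D v)) {t s : ℕ} (h : s ≠ t) (v : V)
    (j : Fin (P.D v)) : resample i t v j s = i s := by
  simp [resample, h]

/-- Exchanging the sample of `v` at slot `t` with an independent spare one is an involution on
pairs, so it preserves the uniform average. -/
theorem expectation_resample {T t : ℕ} (ht : t < T) (v : V)
    (g : (ℕ → ∀ v, Fin (P.D v)) → ℝ) :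
    expectation P T g
      = expectation P T fun i => (1 / (P.D v : ℝ)) * ∑ j, g (resample i t v j) := by
  have hD : (P.D v : ℝ) ≠ 0 := by exact_mod_cast (P.D_pos v).ne'
  let up : (Fin T → ∀ v, Fin (P.D v)) → Fin (P.D v) → (Fin T → ∀ v, Fin (P.D v)) :=
    fun ω j => Function.update ω ⟨t, ht⟩ (Function.update (ω ⟨t, ht⟩) v j)
  have hup : ∀ ω j, extend P T (up ω j) = resample (extend P T ω) t v j := by
    intro ω j
    funext s
    by_cases hs : s = t
    · subst hs
      simp [extend, up, resample, ht]
    · rw [resample_of_ne _ hs]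
      by_cases hsT : s < T
      · simp [extend, up, hs, hsT]
      · simp [extend, hsT]
  let e : (Fin T → ∀ v, Fin (P.D v)) × Fin (P.D v) ≃ (Fin T → ∀ v, Fin (P.D v)) × Fin (P.D v) :=
    { toFun := fun q => (up q.1 q.2, q.1 ⟨t, ht⟩ v)
      invFun := fun q => (up q.1 q.2, q.1 ⟨t, ht⟩ v)
      left_inv := fun q => by simp [up]
      right_inv := fun q => by simp [up] }
  have key : ∑ ω, ∑ j, g (extend P T (up ω j)) = P.D v * ∑ ω, g (extend P T ω) := by
    rw [← Fintype.sum_prod_type' (f := fun ω j => g (extend P T (up ω j)))]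
    rw [show (fun q : (Fin T → ∀ v, Fin (P.D v)) × Fin (P.D v) => g (extend P T (up q.1 q.2)))
      = fun q => g (extend P T (e q).1) from rfl, Equiv.sum_comp e fun q => g (extend P T q.1),
      Fintype.sum_prod_type]
    simp [mul_sum]
  rw [expectation_const_mul]
  unfold expectation
  simp only [← hup]
  rw [Fintype.expect_eq_sum_div_card, Fintype.expect_eq_sum_div_card, key]
  field_simp

/-! ### Dependence on the past -/

theorem run_congr (η : ℝ) {i i' : ℕ → ∀ v, Fin (P.D v)} {t : ℕ} (h : ∀ s < t, i s = i' s) :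
    run P S η i t = run P S η i' t := by
  induction t with
  | zero => rfl
  | succ t ih =>
    have e1 := ih fun s hs => h s (by omega)
    have e2 := h t (by omega)
    simp only [run, step, localStep, e1, e2]

theorem localModel_congr (η : ℝ) {i i' : ℕ → ∀ v, Fin (P.D v)} {t : ℕ}
    (h : ∀ s < t, i s = i' s) (v : V) : localModel P S η i t v = localModel P S η i' t v := by
  unfold localModel
  rw [run_congr η h]

theorem virtualModel_congr (η : ℝ) {i i' : ℕ → ∀ v, Fin (P.D v)} {t : ℕ}
    (h : ∀ s < t, i s = i' s) : virtualModel P S η i t = virtualModel P S η i' t := by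
  unfold virtualModel
  congr 1
  refine sum_congr rfl fun v _ => sum_congr rfl fun z hz => ?_
  have hz := mem_range.1 hz
  rw [h z hz, localModel_congr η fun s hs => h s (by omega)]

variable (P S) in
/-- The gradient of the local loss at the local model of `v`. -/
noncomputable def meanGrad (η : ℝ) (i : ℕ → ∀ v, Fin (P.D v)) (t : ℕ) (v : V) : Model d :=
  gradient (P.localLoss v) (localModel P S η i t v)

variable (P S) in
/-- The noise of the stochastic gradient that `v` starts at slot `t`. -/
noncomputable def noise (η : ℝ) (i : ℕ → ∀ v, Fin (P.D v)) (t : ℕ) (v : V) : Model d :=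
  stochGrad P S η i t v - meanGrad P S η i t v

theorem stochGrad_eq (η : ℝ) (i : ℕ → ∀ v, Fin (P.D v)) (t : ℕ) (v : V) :
    stochGrad P S η i t v = noise P S η i t v + meanGrad P S η i t v := by
  simp [noise]

theorem meanGrad_congr (η : ℝ) {i i' : ℕ → ∀ v, Fin (P.D v)} {t : ℕ}
    (h : ∀ s < t, i s = i' s) (v : V) : meanGrad P S η i t v = meanGrad P S η i' t v := by
  unfold meanGrad
  rw [localModel_congr η h]

theorem noise_congr (η : ℝ) {i i' : ℕ → ∀ v, Fin (P.D v)} {t : ℕ}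
    (h : ∀ s < t, i s = i' s) (v : V) (hv : i t v = i' t v) :
    noise P S η i t v = noise P S η i' t v := by
  unfold noise stochGrad
  rw [localModel_congr η h, meanGrad_congr η h, hv]

theorem noise_resample (η : ℝ) (i : ℕ → ∀ v, Fin (P.D v)) (t : ℕ) (v : V) (j : Fin (P.D v)) :
    noise P S η (resample i t v j) t v
      = gradient (P.loss v j) (localModel P S η i t v) - meanGrad P S η i t v := by
  have h : ∀ s < t, resample i t v j s = i s := fun s hs => resample_of_ne i hs.ne v j
  unfold noise stochGrad
  rw [localModel_congr η h, meanGrad_congr η h]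
  simp [resample]

theorem noise_resample_of_ne (η : ℝ) (i : ℕ → ∀ v, Fin (P.D v)) {t s : ℕ} {v w : V}
    (j : Fin (P.D v)) (hs : s ≤ t) (hne : ¬ (s = t ∧ w = v)) :
    noise P S η (resample i t v j) s w = noise P S η i s w := by
  refine noise_congr η (fun r hr => resample_of_ne i (by omega) v j) w ?_
  by_cases h : s = t
  · subst h
    simp [resample, show w ≠ v from fun e => hne ⟨rfl, e⟩]
  · rw [resample_of_ne i h]

/-- Resampling `i t v` changes neither `Y` nor the local model at slot `t`, while the sample
gradients average to `meanGrad`. -/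
theorem expectation_inner_noise {T t : ℕ} (ht : t < T) (v : V) (η : ℝ)
    (Y : (ℕ → ∀ v, Fin (P.D v)) → Model d) (hY : ∀ i j, Y (resample i t v j) = Y i) :
    expectation P T (fun i => inner ℝ (noise P S η i t v) (Y i)) = 0 := by
  rw [expectation_resample ht v, ← expectation_const (P := P) T 0]
  congr 1
  funext i
  have hD : (P.D v : ℝ) ≠ 0 := by exact_mod_cast (P.D_pos v).ne'
  simp only [hY, noise_resample]
  rw [← sum_inner, sum_sub_distrib, meanGrad, P.gradient_localLoss]
  simp [smul_smul, ← Nat.cast_smul_eq_nsmul ℝ, hD]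

theorem expectation_norm_noise_sq_le {T t : ℕ} {η L σ ζ : ℝ} (hP : Admissible P S T η L σ ζ)
    (ht : t < T) (v : V) : expectation P T (fun i => ‖noise P S η i t v‖ ^ 2) ≤ σ ^ 2 := by
  rw [expectation_resample ht v, ← expectation_const (P := P) T (σ ^ 2)]
  refine expectation_mono T fun i => ?_
  simp only [noise_resample]
  exact hP.variance i t ht v

/-- The sample of the later noise is resampled, which leaves the other noise unchanged. Within one
slot either order works, as the nodes draw different samples. -/
theorem expectation_inner_noise_noise {T s t : ℕ} (hs : s < T) (ht : t < T) {v w : V} (η : ℝ)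
    (hne : ¬ (s = t ∧ w = v)) :
    expectation P T (fun i => inner ℝ (noise P S η i t v) (noise P S η i s w)) = 0 := by
  rcases le_total s t with h | h
  · exact expectation_inner_noise ht v η _ fun i j => noise_resample_of_ne η i j h hne
  · simp only [real_inner_comm]
    exact expectation_inner_noise hs w η _ fun i j =>
      noise_resample_of_ne η i j h fun q => hne ⟨q.1.symm, q.2.symm⟩

/-- Pythagoras for orthogonal noises; the coefficients must not depend on the samples. -/
theorem expectation_norm_sum_noise_sq_le {T : ℕ} {η L σ ζ : ℝ}
    (hP : Admissible P S T η L σ ζ) (s : Finset (V × ℕ)) (hs : ∀ q ∈ s, q.2 < T)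
    (c : V × ℕ → ℝ) :
    expectation P T (fun i => ‖∑ q ∈ s, c q • noise P S η i q.2 q.1‖ ^ 2)
      ≤ σ ^ 2 * ∑ q ∈ s, c q ^ 2 := by
  have e : ∀ i, ‖∑ q ∈ s, c q • noise P S η i q.2 q.1‖ ^ 2
      = ∑ q ∈ s, ∑ r ∈ s,
        c q * c r * inner ℝ (noise P S η i q.2 q.1) (noise P S η i r.2 r.1) := by
    intro i
    rw [← real_inner_self_eq_norm_sq, sum_inner]
    refine sum_congr rfl fun q _ => ?_
    rw [inner_sum]
    refine sum_congr rfl fun r _ => ?_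
    rw [real_inner_smul_left, real_inner_smul_right, mul_assoc]
  simp only [e]
  rw [expectation_sum, mul_sum]
  refine sum_le_sum fun q hq => ?_
  rw [expectation_sum, sum_eq_single_of_mem q hq]
  · rw [expectation_const_mul]
    simp only [real_inner_self_eq_norm_sq]
    have := expectation_norm_noise_sq_le hP (hs q hq) q.1
    nlinarith [sq_nonneg (c q)]
  · intro r hr hne
    rw [expectation_const_mul, expectation_inner_noise_noise (hs r hr) (hs q hq), mul_zero]
    exact fun h => hne (Prod.ext h.2 h.1)

end Expectation

/-! ### Smooth functions -/

section Smooth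

variable {d : ℕ} {f : Model d → ℝ} {L : ℝ}

/-- The descent lemma. -/
theorem le_quadratic_of_lipschitz_gradient (hf : Differentiable ℝ f)
    (hL : ∀ x y, ‖gradient f y - gradient f x‖ ≤ L * ‖y - x‖) (x y : Model d) :
    f y ≤ f x + inner ℝ (gradient f x) (y - x) + L / 2 * ‖y - x‖ ^ 2 := by
  -- Along the segment, `φ` is `f` minus the linear and quadratic parts of the bound; the Lipschitz
  -- condition makes its derivative nonpositive.
  let φ : ℝ → ℝ := fun s => f (x + s • (y - x)) - s * inner ℝ (gradient f x) (y - x)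
    - L / 2 * ‖y - x‖ ^ 2 * s ^ 2
  have hφ : ∀ s, HasDerivAt φ (inner ℝ (gradient f (x + s • (y - x))) (y - x)
      - inner ℝ (gradient f x) (y - x) - L * ‖y - x‖ ^ 2 * s) s := by
    intro s
    have h1 : HasDerivAt (fun s : ℝ => x + s • (y - x)) (y - x) s := by
      simpa using ((hasDerivAt_id s).smul_const (y - x)).const_add x
    have h2 := (hf (x + s • (y - x))).hasFDerivAt.comp_hasDerivAt s h1
    rw [← inner_gradient_left] at h2
    have h3 := (h2.sub ((hasDerivAt_id s).mul_const (inner ℝ (gradient f x) (y - x)))).sub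
      ((hasDerivAt_pow 2 s).const_mul (L / 2 * ‖y - x‖ ^ 2))
    refine h3.congr_deriv ?_
    simp
    ring
  have hanti : AntitoneOn φ (Set.Icc 0 1) := by
    refine antitoneOn_of_deriv_nonpos (convex_Icc 0 1)
      (fun s _ => (hφ s).continuousAt.continuousWithinAt)
      (fun s _ => (hφ s).differentiableAt.differentiableWithinAt) fun s hs => ?_
    rw [interior_Icc] at hs
    rw [(hφ s).deriv, ← inner_sub_left]
    have h1 := real_inner_le_norm (gradient f (x + s • (y - x)) - gradient f x) (y - x)
    have h2 := hL x (x + s • (y - x))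
    rw [add_sub_cancel_left, norm_smul, Real.norm_of_nonneg hs.1.le] at h2
    nlinarith [mul_le_mul_of_nonneg_right h2 (norm_nonneg (y - x))]
  have := hanti (Set.left_mem_Icc.2 zero_le_one) (Set.right_mem_Icc.2 zero_le_one) zero_le_one
  simp only [φ] at this
  simp at this
  rw [inner_gradient_left, map_sub]
  linarith

/-- A gradient step of length `1 / L` lowers `f` by at least `‖∇f‖² / (2L)`, but not below `m`. -/
theorem norm_gradient_sq_le (hL0 : 0 < L) (hf : Differentiable ℝ f)
    (hL : ∀ x y, ‖gradient f y - gradient f x‖ ≤ L * ‖y - x‖) {m : ℝ} (hm : ∀ x, m ≤ f x)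
    (x : Model d) : ‖gradient f x‖ ^ 2 ≤ 2 * L * (f x - m) := by
  have h := le_quadratic_of_lipschitz_gradient hf hL x (x - (1 / L) • gradient f x)
  have h2 := hm (x - (1 / L) • gradient f x)
  rw [sub_sub_cancel_left, norm_neg, inner_neg_right, real_inner_smul_right,
    real_inner_self_eq_norm_sq, norm_smul, mul_pow, Real.norm_of_nonneg (by positivity)] at h
  have h3 : L / 2 * ((1 / L) ^ 2 * ‖gradient f x‖ ^ 2) = 1 / L * ‖gradient f x‖ ^ 2 / 2 := by
    field_simp
  have h4 : 1 / L * ‖gradient f x‖ ^ 2 / 2 ≤ f x - m := by linarith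
  have h5 : ‖gradient f x‖ ^ 2 = 2 * L * (1 / L * ‖gradient f x‖ ^ 2 / 2) := by field_simp
  rw [h5]
  exact mul_le_mul_of_nonneg_left h4 (by positivity)

theorem gradient_eq_zero_of_forall_le {x : Model d} (h : ∀ y, f x ≤ f y) : gradient f x = 0 := by
  have : fderiv ℝ f x = 0 := IsLocalMin.fderiv_eq_zero (Filter.Eventually.of_forall h)
  simp [gradient, this]

theorem StronglyConvex.mono {μ : ℝ} (hμ : 0 ≤ μ) (h : StronglyConvex μ f) :
    StronglyConvex 0 f := fun x y => by
  have := h x y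
  have h2 : 0 ≤ μ / 2 * ‖y - x‖ ^ 2 := by positivity
  linarith

/-- Jensen's inequality, from the first order form of convexity. -/
theorem StronglyConvex.map_average_le (h : StronglyConvex 0 f) {ι : Type*} (s : Finset ι)
    (w : ι → ℝ) (hw : ∀ j ∈ s, 0 ≤ w j) (hpos : 0 < ∑ j ∈ s, w j) (x : ι → Model d) :
    f ((1 / ∑ j ∈ s, w j) • ∑ j ∈ s, w j • x j) ≤ (1 / ∑ j ∈ s, w j) * ∑ j ∈ s, w j * f (x j) := by
  set W := ∑ j ∈ s, w j with hW
  set y := (1 / W) • ∑ j ∈ s, w j • x j with hy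
  -- The tangent inequalities at the average are added up; their linear parts cancel.
  have h1 : ∑ j ∈ s, w j * (f y + inner ℝ (gradient f y) (x j - y)) ≤ ∑ j ∈ s, w j * f (x j) := by
    refine sum_le_sum fun j hj => mul_le_mul_of_nonneg_left ?_ (hw j hj)
    have := h y (x j)
    linarith
  have h2 : ∑ j ∈ s, w j • (x j - y) = 0 := by
    simp only [smul_sub, sum_sub_distrib, ← sum_smul]
    rw [← hW, hy, smul_smul, mul_one_div_cancel hpos.ne', one_smul, sub_self]
  have h3 : ∑ j ∈ s, w j * (f y + inner ℝ (gradient f y) (x j - y)) = W * f y := by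
    simp only [mul_add, sum_add_distrib, ← sum_mul, ← real_inner_smul_right]
    rw [← inner_sum, h2, inner_zero_right, add_zero]
  rw [h3] at h1
  rw [one_div, ← div_eq_inv_mul, le_div_iff₀ hpos]
  linarith

theorem norm_sum_smul_sq_le {E : Type*} [SeminormedAddCommGroup E] [NormedSpace ℝ E]
    {ι : Type*} (s : Finset ι) (a c : ι → ℝ) (h : ∀ j ∈ s, |a j| ≤ c j) (y : ι → E) :
    ‖∑ j ∈ s, a j • y j‖ ^ 2 ≤ (∑ j ∈ s, c j) * ∑ j ∈ s, c j * ‖y j‖ ^ 2 := by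
  have hc : ∀ j ∈ s, 0 ≤ c j := fun j hj => (abs_nonneg _).trans (h j hj)
  have h1 : ‖∑ j ∈ s, a j • y j‖ ≤ ∑ j ∈ s, c j * ‖y j‖ :=
    norm_sum_le_of_le s fun j hj => by
      rw [norm_smul, Real.norm_eq_abs]
      exact mul_le_mul_of_nonneg_right (h j hj) (norm_nonneg _)
  refine (pow_le_pow_left₀ (norm_nonneg _) h1 2).trans ?_
  exact sum_sq_le_sum_mul_sum_of_sq_le_mul s hc
    (fun j hj => mul_nonneg (hc j hj) (sq_nonneg _)) fun j _ => le_of_eq (by ring)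

theorem norm_add_sq_le_two {E : Type*} [SeminormedAddCommGroup E] (x y : E) :
    ‖x + y‖ ^ 2 ≤ 2 * ‖x‖ ^ 2 + 2 * ‖y‖ ^ 2 := by
  have := pow_le_pow_left₀ (norm_nonneg _) (norm_add_le x y) 2
  nlinarith [sq_nonneg (‖x‖ - ‖y‖)]

end Smooth

/-! ### The deviation of the local models from the virtual sequence -/

section Deviation

variable {V : Type u} [Fintype V] [DecidableEq V] {d : ℕ} {P : Problem V d} {S : Protocol V}

variable (P S) in
/-- The weighted squared deviation of the local models from the virtual sequence. -/
noncomputable def deviation (η : ℝ) (i : ℕ → ∀ v, Fin (P.D v)) (t : ℕ) : ℝ :=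
  ∑ v, P.weight v * ‖localModel P S η i t v - virtualModel P S η i t‖ ^ 2

theorem deviation_nonneg (η : ℝ) (i : ℕ → ∀ v, Fin (P.D v)) (t : ℕ) : 0 ≤ deviation P S η i t :=
  sum_nonneg fun v _ => mul_nonneg (P.weight_nonneg v) (sq_nonneg _)

section

variable [Nonempty V]

omit [DecidableEq V] in
theorem norm_average_sq_le (y : V → Model d) :
    ‖∑ v, P.weight v • y v‖ ^ 2 ≤ ∑ v, P.weight v * ‖y v‖ ^ 2 := by
  have := norm_sum_smul_sq_le univ P.weight P.weight
    (fun v _ => (abs_of_nonneg (P.weight_nonneg v)).le) y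
  rwa [P.sum_weight, one_mul] at this

theorem norm_averageModel_sub_sq_le (η : ℝ) (i : ℕ → ∀ v, Fin (P.D v)) (t : ℕ) :
    ‖averageModel P S η i t - virtualModel P S η i t‖ ^ 2 ≤ deviation P S η i t := by
  have e : averageModel P S η i t - virtualModel P S η i t
      = ∑ v, P.weight v • (localModel P S η i t v - virtualModel P S η i t) := by
    simp only [smul_sub, sum_sub_distrib, ← sum_smul, P.sum_weight, one_smul, averageModel]
  rw [e]
  exact norm_average_sq_le _

variable {T : ℕ} {η L σ ζ : ℝ}

theorem Admissible.globalLoss_smooth (hP : Admissible P S T η L σ ζ) (x y : Model d) :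
    ‖gradient P.globalLoss y - gradient P.globalLoss x‖ ≤ L * ‖y - x‖ := by
  rw [P.gradient_globalLoss, P.gradient_globalLoss, ← sum_sub_distrib]
  calc ‖∑ v, (P.weight v • gradient (P.localLoss v) y - P.weight v • gradient (P.localLoss v) x)‖
      ≤ ∑ v, P.weight v * (L * ‖y - x‖) := norm_sum_le_of_le _ fun v _ => by
        rw [← smul_sub, norm_smul, Real.norm_of_nonneg (P.weight_nonneg v)]
        exact mul_le_mul_of_nonneg_left (hP.smooth v x y) (P.weight_nonneg v)
    _ = L * ‖y - x‖ := by rw [← sum_mul, P.sum_weight, one_mul]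

theorem Admissible.norm_sum_meanGrad_sub_sq_le (hP : Admissible P S T η L σ ζ)
    (i : ℕ → ∀ v, Fin (P.D v)) (t : ℕ) :
    ‖∑ v, P.weight v • meanGrad P S η i t v - gradient P.globalLoss (virtualModel P S η i t)‖ ^ 2
      ≤ L ^ 2 * deviation P S η i t := by
  rw [P.gradient_globalLoss, ← sum_sub_distrib]
  simp only [← smul_sub]
  refine (norm_average_sq_le _).trans ?_
  rw [deviation, mul_sum]
  refine sum_le_sum fun v _ => ?_
  rw [mul_left_comm, ← mul_pow]
  exact mul_le_mul_of_nonneg_left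
    (pow_le_pow_left₀ (norm_nonneg _) (hP.smooth v _ _) 2) (P.weight_nonneg v)

theorem Admissible.norm_meanGrad_sq_le (hP : Admissible P S T η L σ ζ)
    (i : ℕ → ∀ v, Fin (P.D v)) {t : ℕ} (ht : t < T) (v : V) :
    ‖meanGrad P S η i t v‖ ^ 2 ≤ 2 * ζ ^ 2
      + 4 * ‖gradient P.globalLoss (virtualModel P S η i t)‖ ^ 2
      + 4 * L ^ 2 * ‖localModel P S η i t v - virtualModel P S η i t‖ ^ 2 := by
  set x := localModel P S η i t v
  set y := virtualModel P S η i t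
  have h1 := norm_add_sq_le_two (meanGrad P S η i t v - gradient P.globalLoss x)
    (gradient P.globalLoss x)
  have h2 := norm_add_sq_le_two (gradient P.globalLoss x - gradient P.globalLoss y)
    (gradient P.globalLoss y)
  rw [sub_add_cancel] at h1 h2
  have h3 : ‖meanGrad P S η i t v - gradient P.globalLoss x‖ ^ 2 ≤ ζ ^ 2 :=
    hP.diversity i t ht v
  have h4 := pow_le_pow_left₀ (norm_nonneg _) (hP.globalLoss_smooth y x) 2
  rw [mul_pow] at h4
  linarith

end

variable [Nontrivial V] {T : ℕ} {η L σ ζ : ℝ}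

theorem sum_weight_add_ite (v : V) : ∑ w, (P.weight w + if w = v then (1 : ℝ) else 0) = 2 := by
  rw [sum_add_distrib, P.sum_weight]
  simp
  norm_num

omit [Nontrivial V] in
theorem weight_add_ite_nonneg (v w : V) : 0 ≤ P.weight w + if w = v then (1 : ℝ) else 0 :=
  add_nonneg (P.weight_nonneg w) (by split_ifs <;> norm_num)

theorem card_window_le (t A : ℕ) : ((Ico (t - 4 * A) t).card : ℝ) ≤ 4 * A := by
  rw [Nat.card_Ico]
  have : t - (t - 4 * A) ≤ 4 * A := by omega
  exact_mod_cast this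

/-- Orthogonality makes this linear in `A`: there are at most `4 * A` slots, each with squared
coefficients summing to at most the squared mass `2²`. -/
theorem expectation_norm_noisePart_sq_le (hP : Admissible P S T η L σ ζ) {t : ℕ} (ht : t ≤ T)
    (v : V) :
    expectation P T (fun i => ‖∑ q ∈ univ ×ˢ Ico (t - 4 * S.A) t,
      devCoeff P S t v q.1 q.2 • noise P S η i q.2 q.1‖ ^ 2) ≤ 16 * S.A * σ ^ 2 := by
  refine (expectation_norm_sum_noise_sq_le hP _ (fun q hq => ?_) fun q =>
    devCoeff P S t v q.1 q.2).trans ?_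
  · have := mem_Ico.1 (mem_product.1 hq).2
    omega
  · have h : ∑ q ∈ univ ×ˢ Ico (t - 4 * S.A) t, devCoeff P S t v q.1 q.2 ^ 2 ≤ 16 * S.A := by
      rw [sum_product_right]
      calc ∑ z ∈ Ico (t - 4 * S.A) t, ∑ w, devCoeff P S t v w z ^ 2
          ≤ ∑ z ∈ Ico (t - 4 * S.A) t, (4 : ℝ) := sum_le_sum fun z _ => by
            calc ∑ w, devCoeff P S t v w z ^ 2
                ≤ ∑ w, (P.weight w + if w = v then (1 : ℝ) else 0) ^ 2 :=
                  sum_le_sum fun w _ => by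
                    rw [← sq_abs]
                    exact pow_le_pow_left₀ (abs_nonneg _) (abs_devCoeff_le t v w z) 2
              _ ≤ (∑ w, (P.weight w + if w = v then (1 : ℝ) else 0)) ^ 2 :=
                  sum_sq_le_sq_sum_of_nonneg fun w _ => weight_add_ite_nonneg v w
              _ = 4 := by rw [sum_weight_add_ite]; norm_num
        _ ≤ 16 * S.A := by
            rw [sum_const, nsmul_eq_mul]
            linarith [card_window_le t S.A]
    nlinarith [mul_le_mul_of_nonneg_left h (sq_nonneg σ)]

/-- The means need not cancel, so Cauchy–Schwarz costs the total mass `8 * A` of the window.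
Averaging over `v` turns the coefficient bound into twice the weight of `w`. -/
theorem sum_weight_norm_meanPart_sq_le (η : ℝ) (i : ℕ → ∀ v, Fin (P.D v)) (t : ℕ) :
    ∑ v, P.weight v * ‖∑ q ∈ univ ×ˢ Ico (t - 4 * S.A) t,
      devCoeff P S t v q.1 q.2 • meanGrad P S η i q.2 q.1‖ ^ 2
      ≤ 16 * S.A * ∑ z ∈ Ico (t - 4 * S.A) t, ∑ w, P.weight w * ‖meanGrad P S η i z w‖ ^ 2 := by
  set I := Ico (t - 4 * S.A) t
  have h1 : ∀ v, ‖∑ q ∈ univ ×ˢ I, devCoeff P S t v q.1 q.2 • meanGrad P S η i q.2 q.1‖ ^ 2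
      ≤ 8 * S.A * ∑ z ∈ I, ∑ w, (P.weight w + if w = v then (1 : ℝ) else 0)
        * ‖meanGrad P S η i z w‖ ^ 2 := by
    intro v
    refine (norm_sum_smul_sq_le _ _ (fun q => P.weight q.1 + if q.1 = v then (1 : ℝ) else 0)
      (fun q _ => abs_devCoeff_le t v q.1 q.2) _).trans ?_
    rw [sum_product_right, sum_product_right]
    refine mul_le_mul_of_nonneg_right ?_ (sum_nonneg fun z _ => sum_nonneg fun w _ =>
      mul_nonneg (weight_add_ite_nonneg v w) (sq_nonneg _))
    simp only [sum_weight_add_ite, sum_const, nsmul_eq_mul]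
    linarith [card_window_le t S.A]
  refine (sum_le_sum fun v _ => mul_le_mul_of_nonneg_left (h1 v) (P.weight_nonneg v)).trans ?_
  have h2 : ∀ z, ∑ v, P.weight v * ∑ w, (P.weight w + if w = v then (1 : ℝ) else 0)
        * ‖meanGrad P S η i z w‖ ^ 2
      = 2 * ∑ w, P.weight w * ‖meanGrad P S η i z w‖ ^ 2 := by
    intro z
    simp only [add_mul, sum_add_distrib, mul_add, ite_mul, one_mul, zero_mul, sum_ite_eq',
      mem_univ, if_true, ← sum_mul, P.sum_weight]
    ring
  apply le_of_eq
  calc ∑ v, P.weight v * (8 * S.A * ∑ z ∈ I, ∑ w, (P.weight w + if w = v then (1 : ℝ) else 0)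
        * ‖meanGrad P S η i z w‖ ^ 2)
      = 8 * S.A * ∑ z ∈ I, ∑ v, P.weight v * ∑ w, (P.weight w + if w = v then (1 : ℝ) else 0)
        * ‖meanGrad P S η i z w‖ ^ 2 := by
        rw [sum_comm, mul_sum]
        refine sum_congr rfl fun v _ => ?_
        rw [← mul_sum]
        ring
    _ = _ := by
        simp only [h2, ← mul_sum]
        ring

theorem expectation_deviation_le (hP : Admissible P S T η L σ ζ) {t : ℕ} (ht : t < T) :
    expectation P T (fun i => deviation P S η i t)
      ≤ 32 * η ^ 2 * S.A * σ ^ 2 + 256 * η ^ 2 * S.A ^ 2 * ζ ^ 2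
        + 128 * η ^ 2 * S.A * ∑ z ∈ Ico (t - 4 * S.A) t,
          (expectation P T (fun i => ‖gradient P.globalLoss (virtualModel P S η i z)‖ ^ 2)
            + L ^ 2 * expectation P T (fun i => deviation P S η i z)) := by
  set I := Ico (t - 4 * S.A) t with hI
  have hIT : ∀ z ∈ I, z < T := fun z hz => by
    have := mem_Ico.1 hz
    omega
  have h1 : ∀ i, deviation P S η i t ≤ 2 * η ^ 2 * ∑ v, P.weight v *
        ‖∑ q ∈ univ ×ˢ I, devCoeff P S t v q.1 q.2 • noise P S η i q.2 q.1‖ ^ 2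
      + 32 * η ^ 2 * S.A * ∑ z ∈ I, (2 * ζ ^ 2
        + 4 * ‖gradient P.globalLoss (virtualModel P S η i z)‖ ^ 2
        + 4 * L ^ 2 * deviation P S η i z) := by
    intro i
    have h2 : ∀ v, ‖localModel P S η i t v - virtualModel P S η i t‖ ^ 2
        ≤ 2 * η ^ 2 * ‖∑ q ∈ univ ×ˢ I, devCoeff P S t v q.1 q.2 • noise P S η i q.2 q.1‖ ^ 2
        + 2 * η ^ 2
          * ‖∑ q ∈ univ ×ˢ I, devCoeff P S t v q.1 q.2 • meanGrad P S η i q.2 q.1‖ ^ 2 := by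
      intro v
      rw [localModel_sub_virtualModel hP.lag hP.visits hP.sync η i ht.le v, ← sum_product',
        norm_smul, mul_pow, Real.norm_eq_abs, sq_abs]
      simp only [stochGrad_eq, smul_add, sum_add_distrib]
      nlinarith [mul_le_mul_of_nonneg_left (norm_add_sq_le_two
        (∑ q ∈ univ ×ˢ I, devCoeff P S t v q.1 q.2 • noise P S η i q.2 q.1)
        (∑ q ∈ univ ×ˢ I, devCoeff P S t v q.1 q.2 • meanGrad P S η i q.2 q.1)) (sq_nonneg η)]
    have h3 := sum_weight_norm_meanPart_sq_le (P := P) (S := S) η i t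
    have h4 : ∑ z ∈ I, ∑ w, P.weight w * ‖meanGrad P S η i z w‖ ^ 2
        ≤ ∑ z ∈ I, (2 * ζ ^ 2 + 4 * ‖gradient P.globalLoss (virtualModel P S η i z)‖ ^ 2
          + 4 * L ^ 2 * deviation P S η i z) := by
      refine sum_le_sum fun z hz => ?_
      calc ∑ w, P.weight w * ‖meanGrad P S η i z w‖ ^ 2
          ≤ ∑ w, P.weight w * (2 * ζ ^ 2
            + 4 * ‖gradient P.globalLoss (virtualModel P S η i z)‖ ^ 2
            + 4 * L ^ 2 * ‖localModel P S η i z w - virtualModel P S η i z‖ ^ 2) :=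
            sum_le_sum fun w _ => mul_le_mul_of_nonneg_left
              (hP.norm_meanGrad_sq_le i (hIT z hz) w) (P.weight_nonneg w)
        _ = _ := by
            simp only [mul_add, sum_add_distrib, ← sum_mul, P.sum_weight, one_mul, deviation,
              mul_sum]
            congr 1
            exact sum_congr rfl fun w _ => by ring
    calc deviation P S η i t
        ≤ ∑ v, P.weight v * (2 * η ^ 2 *
            ‖∑ q ∈ univ ×ˢ I, devCoeff P S t v q.1 q.2 • noise P S η i q.2 q.1‖ ^ 2
          + 2 * η ^ 2
            * ‖∑ q ∈ univ ×ˢ I, devCoeff P S t v q.1 q.2 • meanGrad P S η i q.2 q.1‖ ^ 2) :=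
          sum_le_sum fun v _ => mul_le_mul_of_nonneg_left (h2 v) (P.weight_nonneg v)
      _ = 2 * η ^ 2 * ∑ v, P.weight v *
            ‖∑ q ∈ univ ×ˢ I, devCoeff P S t v q.1 q.2 • noise P S η i q.2 q.1‖ ^ 2
          + 2 * η ^ 2 * ∑ v, P.weight v *
            ‖∑ q ∈ univ ×ˢ I, devCoeff P S t v q.1 q.2 • meanGrad P S η i q.2 q.1‖ ^ 2 := by
          rw [mul_sum, mul_sum, ← sum_add_distrib]
          exact sum_congr rfl fun v _ => by ring
      _ ≤ _ := by
          have h5 := h3.trans (mul_le_mul_of_nonneg_left h4 (by positivity))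
          have h6 := mul_le_mul_of_nonneg_left h5 (show 0 ≤ 2 * η ^ 2 by positivity)
          linarith
  refine (expectation_mono T h1).trans ?_
  rw [expectation_add, expectation_const_mul, expectation_const_mul, expectation_sum,
    expectation_sum]
  simp only [expectation_add, expectation_const_mul, expectation_const]
  have h7 : ∑ v, P.weight v * expectation P T (fun i =>
      ‖∑ q ∈ univ ×ˢ I, devCoeff P S t v q.1 q.2 • noise P S η i q.2 q.1‖ ^ 2)
      ≤ 16 * S.A * σ ^ 2 := by
    calc _ ≤ ∑ v, P.weight v * (16 * S.A * σ ^ 2) := sum_le_sum fun v _ =>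
          mul_le_mul_of_nonneg_left (expectation_norm_noisePart_sq_le hP ht.le v)
            (P.weight_nonneg v)
      _ = _ := by rw [← sum_mul, P.sum_weight, one_mul]
  have h8 : ∑ z ∈ I, (2 * ζ ^ 2
        + 4 * expectation P T (fun i => ‖gradient P.globalLoss (virtualModel P S η i z)‖ ^ 2)
        + 4 * L ^ 2 * expectation P T (fun i => deviation P S η i z))
      ≤ 8 * S.A * ζ ^ 2 + 4 * ∑ z ∈ I,
          (expectation P T (fun i => ‖gradient P.globalLoss (virtualModel P S η i z)‖ ^ 2)
            + L ^ 2 * expectation P T (fun i => deviation P S η i z)) := by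
    rw [mul_sum]
    have h9 : ∑ z ∈ I, 2 * ζ ^ 2 ≤ 8 * S.A * ζ ^ 2 := by
      rw [sum_const, nsmul_eq_mul]
      nlinarith [mul_le_mul_of_nonneg_right (card_window_le t S.A) (sq_nonneg ζ)]
    rw [← sub_le_iff_le_add, ← sum_sub_distrib]
    refine le_trans (le_of_eq (sum_congr rfl fun z _ => ?_)) h9
    ring
  have h10 := mul_le_mul_of_nonneg_left h7 (show 0 ≤ 2 * η ^ 2 by positivity)
  have h11 := mul_le_mul_of_nonneg_left h8 (show 0 ≤ 32 * η ^ 2 * S.A by positivity)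
  linarith

/-- After exchanging the sums, each `z` lies in at most `B` windows, and its weight there at most
doubles. -/
theorem sum_mul_window_le {T B : ℕ} {ω y : ℕ → ℝ} (hω : ∀ t, 0 ≤ ω t) (hy : ∀ t, 0 ≤ y t)
    (h : ∀ z t, z < t → t ≤ z + B → ω t ≤ 2 * ω z) :
    ∑ t ∈ range T, ω t * ∑ z ∈ Ico (t - B) t, y z ≤ 2 * B * ∑ z ∈ range T, ω z * y z := by
  calc ∑ t ∈ range T, ω t * ∑ z ∈ Ico (t - B) t, y z
      ≤ ∑ t ∈ range T, ∑ z ∈ Ico (t - B) t, 2 * ω z * y z := sum_le_sum fun t _ => by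
        rw [mul_sum]
        refine sum_le_sum fun z hz => mul_le_mul_of_nonneg_right ?_ (hy z)
        have := mem_Ico.1 hz
        exact h z t (by omega) (by omega)
    _ ≤ ∑ z ∈ range T, ∑ t ∈ Ioc z (z + B), 2 * ω z * y z := by
        rw [sum_comm' (t' := range T) (s' := fun z => (Ioc z (z + B)).filter (· < T))]
        · refine sum_le_sum fun z _ => sum_le_sum_of_subset_of_nonneg (filter_subset _ _)
            fun t _ _ => ?_
          have := hω z
          have := hy z
          positivity
        · intro t z
          simp only [mem_range, mem_Ico, mem_filter, mem_Ioc]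
          omega
    _ = 2 * B * ∑ z ∈ range T, ω z * y z := by
        rw [mul_sum]
        refine sum_congr rfl fun z _ => ?_
        rw [sum_const, Nat.card_Ioc, nsmul_eq_mul, Nat.add_sub_cancel_left]
        ring

/-- The accumulated deviation, for weights that vary slowly. -/
theorem sum_expectation_deviation_le (hP : Admissible P S T η L σ ζ) (hL : 0 < L) (hη : 0 < η)
    (hLη : 64 * L * (η * S.A) ≤ 1) {ω : ℕ → ℝ} (hω : ∀ t, 0 ≤ ω t)
    (h : ∀ z t, z < t → t ≤ z + 4 * S.A → ω t ≤ 2 * ω z) :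
    ∑ t ∈ range T, ω t * expectation P T (fun i => deviation P S η i t)
      ≤ 512 * η ^ 2 * (S.A * σ ^ 2 + S.A ^ 2 * ζ ^ 2) * ∑ t ∈ range T, ω t
        + 2048 * (η * S.A) ^ 2 * ∑ t ∈ range T, ω t *
          expectation P T (fun i => ‖gradient P.globalLoss (virtualModel P S η i t)‖ ^ 2) := by
  set Ψ := fun t => expectation P T (fun i => deviation P S η i t)
  set G := fun t =>
    expectation P T (fun i => ‖gradient P.globalLoss (virtualModel P S η i t)‖ ^ 2)
  have hΨ : ∀ t, 0 ≤ Ψ t := fun t => expectation_nonneg T fun i => deviation_nonneg η i t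
  have hG : ∀ t, 0 ≤ G t := fun t => expectation_nonneg T fun i => sq_nonneg _
  set a : ℝ := 32 * η ^ 2 * S.A * σ ^ 2 + 256 * η ^ 2 * S.A ^ 2 * ζ ^ 2 with ha
  have h1 : ∑ t ∈ range T, ω t * Ψ t ≤ ∑ t ∈ range T, (ω t * a + 128 * η ^ 2 * S.A *
      (ω t * ∑ z ∈ Ico (t - 4 * S.A) t, (G z + L ^ 2 * Ψ z))) := by
    refine sum_le_sum fun t ht => ?_
    have := mul_le_mul_of_nonneg_left (expectation_deviation_le hP (mem_range.1 ht)) (hω t)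
    exact this.trans (le_of_eq (by ring))
  have h2 := sum_mul_window_le (T := T) (y := fun z => G z + L ^ 2 * Ψ z) hω
    (fun z => add_nonneg (hG z) (mul_nonneg (sq_nonneg L) (hΨ z))) h
  rw [sum_add_distrib, ← sum_mul, ← mul_sum] at h1
  have h3 : ∑ z ∈ range T, ω z * (G z + L ^ 2 * Ψ z)
      = ∑ z ∈ range T, ω z * G z + L ^ 2 * ∑ z ∈ range T, ω z * Ψ z := by
    rw [mul_sum, ← sum_add_distrib]
    exact sum_congr rfl fun z _ => by ring
  rw [h3] at h2
  have h4 := mul_le_mul_of_nonneg_left h2 (show 0 ≤ 128 * η ^ 2 * S.A by positivity)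
  push_cast at h4
  have hX : 0 ≤ ∑ z ∈ range T, ω z * Ψ z := sum_nonneg fun z _ => mul_nonneg (hω z) (hΨ z)
  have hY : 0 ≤ ∑ z ∈ range T, ω z * G z := sum_nonneg fun z _ => mul_nonneg (hω z) (hG z)
  have hW : 0 ≤ ∑ z ∈ range T, ω z := sum_nonneg fun z _ => hω z
  -- The deviation reappears on the right with coefficient `1024 * L² * (η * A)²`, which is at most
  -- `1 / 4` and can be absorbed.
  have h5 : 4096 * (L ^ 2 * (η * S.A) ^ 2) ≤ 1 := by
    have := pow_le_pow_left₀ (by positivity) hLη 2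
    nlinarith
  have h6 := mul_le_mul_of_nonneg_right h5 hX
  have h7 : 0 ≤ η ^ 2 * S.A * σ ^ 2 * ∑ z ∈ range T, ω z := by positivity
  have h8 : 0 ≤ η ^ 2 * S.A ^ 2 * ζ ^ 2 * ∑ z ∈ range T, ω z := by positivity
  have h9 : 0 ≤ (η * S.A) ^ 2 * ∑ z ∈ range T, ω z * G z := by positivity
  rw [ha] at h1
  linarith

end Deviation

section Convergence

variable {V : Type u} [Fintype V] [DecidableEq V] {d : ℕ} {P : Problem V d} {S : Protocol V}
  {T : ℕ} {η L σ ζ : ℝ}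

/-! ### One step of the virtual sequence -/

theorem virtualModel_zero (η : ℝ) (i : ℕ → ∀ v, Fin (P.D v)) : virtualModel P S η i 0 = P.x0 := by
  simp [virtualModel]

theorem virtualModel_succ (η : ℝ) (i : ℕ → ∀ v, Fin (P.D v)) (t : ℕ) :
    virtualModel P S η i (t + 1) = virtualModel P S η i t
      - η • (∑ v, P.weight v • noise P S η i t v + ∑ v, P.weight v • meanGrad P S η i t v) := by
  have e : η • (∑ v, P.weight v • noise P S η i t v + ∑ v, P.weight v • meanGrad P S η i t v)
      = ∑ v, (P.weight v * η) • gradient (P.loss v (i t v)) (localModel P S η i t v) := by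
    rw [← sum_add_distrib, smul_sum]
    refine sum_congr rfl fun v _ => ?_
    rw [← smul_add, ← stochGrad_eq, smul_smul, mul_comm]
    rfl
  rw [e, virtualModel, virtualModel]
  simp only [sum_range_succ, sum_add_distrib]
  abel

theorem expectation_inner_sum_noise {t : ℕ} (ht : t < T) (η : ℝ)
    (Y : (ℕ → ∀ v, Fin (P.D v)) → Model d) (hY : ∀ i i', (∀ s < t, i s = i' s) → Y i = Y i') :
    expectation P T (fun i => inner ℝ (∑ v, P.weight v • noise P S η i t v) (Y i)) = 0 := by
  simp only [sum_inner, real_inner_smul_left]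
  rw [expectation_sum]
  refine sum_eq_zero fun v _ => ?_
  rw [expectation_const_mul, expectation_inner_noise ht v η Y fun i j =>
    hY _ _ fun s hs => resample_of_ne i hs.ne v j, mul_zero]

/-- The source of `ρ`: the noises of one slot are orthogonal and enter with the weights of their
nodes. -/
theorem expectation_norm_sum_weight_noise_sq_le (hP : Admissible P S T η L σ ζ) {t : ℕ}
    (ht : t < T) :
    expectation P T (fun i => ‖∑ v, P.weight v • noise P S η i t v‖ ^ 2) ≤ σ ^ 2 * P.rho := by
  have := expectation_norm_sum_noise_sq_le hP (univ ×ˢ {t})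
    (fun q hq => by
      have := mem_singleton.1 (mem_product.1 hq).2
      omega) fun q => P.weight q.1
  simpa [sum_product, Problem.rho] using this

theorem sum_meanGrad_congr (η : ℝ) {i i' : ℕ → ∀ v, Fin (P.D v)} {t : ℕ}
    (h : ∀ s < t, i s = i' s) :
    ∑ v, P.weight v • meanGrad P S η i t v = ∑ v, P.weight v • meanGrad P S η i' t v :=
  sum_congr rfl fun v _ => by rw [meanGrad_congr η h]

variable [Nontrivial V]

/-! ### Convex losses -/

/-- One step towards a minimizer, when the mean update correlates with the direction to it. -/
theorem expectation_dist_sq_succ_le (hP : Admissible P S T η L σ ζ) (hL : 0 < L) (hη : 0 < η)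
    (hLη : 8 * L * (2 * η) ≤ 1) {μ Q : ℝ} {xstar : Model d}
    (hmin : ∀ x, P.globalLoss xstar ≤ P.globalLoss x)
    (hcorr : ∀ i, ∀ t < T, P.globalLoss (virtualModel P S η i t) - P.globalLoss xstar
      + μ * ‖virtualModel P S η i t - xstar‖ ^ 2 - Q * deviation P S η i t
      ≤ 2 * inner ℝ (∑ v, P.weight v • meanGrad P S η i t v) (virtualModel P S η i t - xstar))
    {t : ℕ} (ht : t < T) :
    expectation P T (fun i => ‖virtualModel P S η i (t + 1) - xstar‖ ^ 2)
      ≤ (1 - μ * η) * expectation P T (fun i => ‖virtualModel P S η i t - xstar‖ ^ 2)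
        - 3 / 4 * η * expectation P T
          (fun i => P.globalLoss (virtualModel P S η i t) - P.globalLoss xstar)
        + η * (Q + L) * expectation P T (fun i => deviation P S η i t)
        + η ^ 2 * (σ ^ 2 * P.rho) := by
  let M := fun i => ∑ v, P.weight v • meanGrad P S η i t v
  let Z := fun i => ∑ v, P.weight v • noise P S η i t v
  let y := fun i => virtualModel P S η i t - xstar
  have h1 : ∀ i, ‖virtualModel P S η i (t + 1) - xstar‖ ^ 2
      ≤ (1 - μ * η) * ‖virtualModel P S η i t - xstar‖ ^ 2
        - 3 / 4 * η * (P.globalLoss (virtualModel P S η i t) - P.globalLoss xstar)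
        + η * (Q + L) * deviation P S η i t + η ^ 2 * ‖Z i‖ ^ 2
        + (-(2 * η)) * inner ℝ (Z i) (y i - η • M i) := by
    intro i
    have e : virtualModel P S η i (t + 1) - xstar = (y i - η • M i) - η • Z i := by
      rw [virtualModel_succ, smul_add]
      simp only [y, M, Z]
      abel
    rw [e, norm_sub_sq_real, norm_sub_sq_real (y i) (η • M i), norm_smul, norm_smul,
      real_inner_smul_right, real_inner_smul_right, Real.norm_of_nonneg hη.le,
      real_inner_comm (M i) (y i), real_inner_comm (Z i)]
    have hc := hcorr i t ht
    have hd := hP.norm_sum_meanGrad_sub_sq_le i t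
    have hg := norm_gradient_sq_le hL P.globalLoss_differentiable
      (fun x y => hP.globalLoss_smooth x y) hmin (virtualModel P S η i t)
    have hM := norm_add_sq_le_two (M i - gradient P.globalLoss (virtualModel P S η i t))
      (gradient P.globalLoss (virtualModel P S η i t))
    rw [sub_add_cancel] at hM
    have hΨ := deviation_nonneg (P := P) (S := S) η i t
    have hΔ : 0 ≤ P.globalLoss (virtualModel P S η i t) - P.globalLoss xstar :=
      sub_nonneg.2 (hmin _)
    change ‖M i - _‖ ^ 2 ≤ _ at hd
    change _ ≤ 2 * inner ℝ (M i) (y i) at hc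
    change ‖y i‖ ^ 2 - 2 * (η * inner ℝ (M i) (y i)) + (η * ‖M i‖) ^ 2 - _ + (η * ‖Z i‖) ^ 2
      ≤ (1 - μ * η) * ‖y i‖ ^ 2 - _ + _ + _ + _
    set Δ := P.globalLoss (virtualModel P S η i t) - P.globalLoss xstar
    set Ψ := deviation P S η i t
    -- As `16 * L * η ≤ 1`, the term `η² ‖M‖²` costs at most a quarter of `η Δ` and one `η L Ψ`;
    -- hence the factors `3 / 4` and `Q + L`.
    have hM2 : ‖M i‖ ^ 2 ≤ 4 * L * Δ + 2 * L ^ 2 * Ψ := by linarith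
    have h2 := mul_le_mul_of_nonneg_left hM2 (sq_nonneg η)
    have h3 := mul_le_mul_of_nonneg_left hc hη.le
    have h4 := mul_le_mul_of_nonneg_right hLη (mul_nonneg hη.le hΔ)
    have h5 := mul_le_mul_of_nonneg_right hLη (mul_nonneg (mul_nonneg hη.le hL.le) hΨ)
    have h6 := mul_nonneg (mul_nonneg hη.le hL.le) hΨ
    change _ ≤ (1 - μ * η) * ‖y i‖ ^ 2 - 3 / 4 * η * Δ + η * (Q + L) * Ψ + η ^ 2 * ‖Z i‖ ^ 2
      + _
    rw [mul_pow, mul_pow]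
    have h7 : η * (Δ + μ * ‖y i‖ ^ 2 - Q * Ψ) ≤ η * (2 * inner ℝ (M i) (y i)) := h3
    linarith
  refine (expectation_mono T h1).trans ?_
  simp only [expectation_add, expectation_sub, expectation_const_mul]
  have h2 : expectation P T (fun i => inner ℝ (Z i) (y i - η • M i)) = 0 := by
    refine expectation_inner_sum_noise ht η _ fun i i' h => ?_
    simp only [y, M]
    rw [virtualModel_congr η h, sum_meanGrad_congr η h]
  rw [h2, mul_zero, add_zero]
  have h3 := mul_le_mul_of_nonneg_left (expectation_norm_sum_weight_noise_sq_le hP ht)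
    (sq_nonneg η)
  gcongr

/-- Divided by `q ^ (t + 1)`, the recursion telescopes. -/
theorem sum_weighted_gap_le {q η c s : ℝ} (hq : 0 < q) {T : ℕ} {D e ψ : ℕ → ℝ}
    (hD : 0 ≤ D T)
    (h : ∀ t < T, D (t + 1) ≤ q * D t - 3 / 4 * η * e t + c * ψ t + s) :
    3 / 4 * η * ∑ t ∈ range T, (q ^ (t + 1))⁻¹ * e t
      ≤ D 0 + c * ∑ t ∈ range T, (q ^ (t + 1))⁻¹ * ψ t
        + s * ∑ t ∈ range T, (q ^ (t + 1))⁻¹ := by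
  have key : ∀ n ≤ T, (q ^ n)⁻¹ * D n + 3 / 4 * η * ∑ t ∈ range n, (q ^ (t + 1))⁻¹ * e t
      ≤ D 0 + c * ∑ t ∈ range n, (q ^ (t + 1))⁻¹ * ψ t
        + s * ∑ t ∈ range n, (q ^ (t + 1))⁻¹ := by
    intro n hn
    induction n with
    | zero => simp
    | succ n ih =>
      have h1 := ih (by omega)
      have h2 := mul_le_mul_of_nonneg_left (h n (by omega))
        (show 0 ≤ (q ^ (n + 1))⁻¹ by positivity)
      have h3 : (q ^ (n + 1))⁻¹ * (q * D n) = (q ^ n)⁻¹ * D n := by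
        rw [pow_succ]
        field_simp
      simp only [sum_range_succ]
      linarith
  have h1 := key T le_rfl
  have h2 : 0 ≤ (q ^ T)⁻¹ * D T := mul_nonneg (by positivity) hD
  linarith

/-- By Bernoulli, `q ^ B ≥ 1 - B * (1 - q) ≥ 1 / 2`. This is the slow variation that
`sum_expectation_deviation_le` asks of the weights. -/
theorem inv_pow_le_two_mul {q : ℝ} (hq : 0 < q) {B : ℕ} (hB : B * (1 - q) ≤ 1 / 2) (hq1 : q ≤ 1)
    {z t : ℕ} (hzt : z < t) (ht : t ≤ z + B) : (q ^ (t + 1))⁻¹ ≤ 2 * (q ^ (z + 1))⁻¹ := by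
  have h1 : 1 / 2 ≤ q ^ (t - z) := by
    have h2 := one_add_mul_le_pow (show (-2 : ℝ) ≤ q - 1 by linarith) B
    rw [add_sub_cancel] at h2
    have h3 := pow_le_pow_of_le_one hq.le hq1 (show t - z ≤ B by omega)
    linarith
  have h2 : q ^ (t + 1) = q ^ (t - z) * q ^ (z + 1) := by
    rw [← pow_add]
    congr 1
    omega
  rw [h2, mul_inv]
  gcongr
  rw [inv_le_comm₀ (by positivity) (by norm_num)]
  linarith

/-- The output averages local models, while the recursion controls the virtual ones. Young's
inequality splits the linear term of the descent lemma, and the squared gradient is bounded by the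
gap. -/
theorem globalLoss_averageModel_le (hP : Admissible P S T η L σ ζ) (hL : 0 < L)
    {xstar : Model d} (hmin : ∀ x, P.globalLoss xstar ≤ P.globalLoss x)
    (i : ℕ → ∀ v, Fin (P.D v)) (t : ℕ) :
    P.globalLoss (averageModel P S η i t) - P.globalLoss xstar
      ≤ 2 * (P.globalLoss (virtualModel P S η i t) - P.globalLoss xstar)
        + L * deviation P S η i t := by
  set x := virtualModel P S η i t
  set y := averageModel P S η i t
  have h1 := le_quadratic_of_lipschitz_gradient P.globalLoss_differentiable
    (fun x y => hP.globalLoss_smooth x y) x y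
  have h2 := norm_gradient_sq_le hL P.globalLoss_differentiable
    (fun x y => hP.globalLoss_smooth x y) hmin x
  have h3 := norm_averageModel_sub_sq_le (P := P) (S := S) η i t
  have h4 := real_inner_le_norm (gradient P.globalLoss x) (y - x)
  have h5 : 2 * L * (‖gradient P.globalLoss x‖ * ‖y - x‖)
      ≤ ‖gradient P.globalLoss x‖ ^ 2 + L ^ 2 * ‖y - x‖ ^ 2 := by
    nlinarith [sq_nonneg (‖gradient P.globalLoss x‖ - L * ‖y - x‖)]
  have h6 : ‖gradient P.globalLoss x‖ * ‖y - x‖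
      ≤ (P.globalLoss x - P.globalLoss xstar) + L / 2 * ‖y - x‖ ^ 2 := by
    refine le_of_mul_le_mul_left ?_ (show 0 < 2 * L by positivity)
    linarith
  have h7 := mul_le_mul_of_nonneg_left h3 hL.le
  linarith

/-- Convergence of DIGEST when the mean update correlates with the direction to a minimizer. -/
theorem expectation_weightedOutput_le (hP : Admissible P S T η L σ ζ) (hL : 0 < L) (hη : 0 < η)
    {μ Q R : ℝ} (hμ : 0 ≤ μ) (hQ : 0 ≤ Q) (hηA : (128 * (L + Q) + 8 * μ) * (η * S.A) ≤ 1)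
    {xstar : Model d} (hconv : StronglyConvex 0 P.globalLoss)
    (hmin : ∀ x, P.globalLoss xstar ≤ P.globalLoss x) (hR : ‖P.x0 - xstar‖ ^ 2 ≤ R)
    (hcorr : ∀ i, ∀ t < T, P.globalLoss (virtualModel P S η i t) - P.globalLoss xstar
      + μ * ‖virtualModel P S η i t - xstar‖ ^ 2 - Q * deviation P S η i t
      ≤ 2 * inner ℝ (∑ v, P.weight v • meanGrad P S η i t v) (virtualModel P S η i t - xstar)) :
    expectation P T (fun i => P.globalLoss (weightedOutput P S μ η T i)) - P.globalLoss xstar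
      ≤ 6 * R / (η * ∑ t ∈ range T, ((1 - μ * η) ^ (t + 1))⁻¹)
        + (3072 * (Q + L) + 512 * L) * (η ^ 2 * (S.A * σ ^ 2 + S.A ^ 2 * ζ ^ 2))
        + 6 * σ ^ 2 * (η * P.rho) := by
  have hA1 : (1 : ℝ) ≤ S.A := by exact_mod_cast Protocol.one_le_A hP.sync
  have hηle : η ≤ η * S.A := by nlinarith
  have hLA : 128 * (L + Q) * (η * S.A) ≤ 1 := by
    have : 0 ≤ 8 * μ * (η * S.A) := by positivity
    linarith
  have hμA : 8 * μ * (η * S.A) ≤ 1 := by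
    have : 0 ≤ 128 * (L + Q) * (η * S.A) := by positivity
    linarith
  have hLA' : 128 * L * (η * S.A) ≤ 1 := by
    have : 0 ≤ 128 * Q * (η * S.A) := by positivity
    linarith
  have hLη : 8 * L * (2 * η) ≤ 1 := by
    have := mul_le_mul_of_nonneg_left hηle (show 0 ≤ 16 * L by positivity)
    have : 0 ≤ L * (η * S.A) := by positivity
    linarith
  have hμη : μ * η ≤ 1 / 8 := by
    have := mul_le_mul_of_nonneg_left hηle hμ
    linarith
  have hμη0 : 0 ≤ μ * η := by positivity
  set q := 1 - μ * η with hq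
  have hq0 : 0 < q := by linarith
  set ω : ℕ → ℝ := fun t => (q ^ (t + 1))⁻¹ with hω
  have hω0 : ∀ t, 0 ≤ ω t := fun t => by positivity
  set W := ∑ t ∈ range T, ω t with hW
  have hW0 : 0 < W := sum_pos (fun t _ => by positivity)
    (nonempty_range_iff.2 (by have := hP.one_le; omega))
  set N : ℝ := S.A * σ ^ 2 + S.A ^ 2 * ζ ^ 2 with hN
  set Ψ := fun t => expectation P T (fun i => deviation P S η i t) with hΨ
  set e := fun t => expectation P T
    (fun i => P.globalLoss (virtualModel P S η i t) - P.globalLoss xstar) with he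
  set G := fun t =>
    expectation P T (fun i => ‖gradient P.globalLoss (virtualModel P S η i t)‖ ^ 2) with hG
  -- The summand `8 * μ` in `hηA` is what keeps the weights within a factor 2 over `4 * A` slots.
  have hdev : ∑ t ∈ range T, ω t * Ψ t
      ≤ 512 * η ^ 2 * N * W + 2048 * (η * S.A) ^ 2 * ∑ t ∈ range T, ω t * G t := by
    refine sum_expectation_deviation_le hP hL hη (by
      have : 0 ≤ L * (η * S.A) := by positivity
      linarith) hω0 fun z t hzt ht =>
        inv_pow_le_two_mul hq0 (B := 4 * S.A) ?_ (by linarith) hzt ht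
    push_cast
    rw [hq]
    linarith
  have he0 : ∀ t, 0 ≤ e t := fun t => expectation_nonneg T fun i => sub_nonneg.2 (hmin _)
  have hGe : ∀ t, G t ≤ 2 * L * e t := fun t => by
    simp only [hG, he]
    rw [← expectation_const_mul]
    exact expectation_mono T fun i => norm_gradient_sq_le hL P.globalLoss_differentiable
      (fun x y => hP.globalLoss_smooth x y) hmin _
  have hsumG : ∑ t ∈ range T, ω t * G t ≤ 2 * L * ∑ t ∈ range T, ω t * e t := by
    rw [mul_sum]
    refine sum_le_sum fun t _ => ?_
    have := mul_le_mul_of_nonneg_left (hGe t) (hω0 t)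
    linarith
  set E := ∑ t ∈ range T, ω t * e t with hE
  have hE0 : 0 ≤ E := sum_nonneg fun t _ => mul_nonneg (hω0 t) (he0 t)
  have hdev2 : ∑ t ∈ range T, ω t * Ψ t
      ≤ 512 * η ^ 2 * N * W + 4096 * L * (η * S.A) ^ 2 * E := by
    have := mul_le_mul_of_nonneg_left hsumG (show 0 ≤ 2048 * (η * S.A) ^ 2 by positivity)
    linarith
  -- Through the gradients the deviation feeds back into `E`; this bound limits the feedback to a
  -- quarter of `η * E`, leaving half of it on the left.
  have hsmall : 4096 * (L + Q) * L * (η * S.A) ^ 2 ≤ 1 / 4 := by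
    have h1 := mul_le_mul hLA hLA' (by positivity) zero_le_one
    linarith
  have hsmall' : 4096 * L * L * (η * S.A) ^ 2 ≤ 1 / 4 := by
    have h1 := mul_le_mul hLA' hLA' (by positivity) zero_le_one
    linarith
  have hstep : 3 / 4 * η * E ≤ R + η * (Q + L) * ∑ t ∈ range T, ω t * Ψ t
      + η ^ 2 * (σ ^ 2 * P.rho) * W := by
    have := sum_weighted_gap_le (q := q) (η := η) (c := η * (Q + L))
      (s := η ^ 2 * (σ ^ 2 * P.rho)) (T := T) (e := e) (ψ := Ψ) hq0
      (D := fun t => expectation P T (fun i => ‖virtualModel P S η i t - xstar‖ ^ 2))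
      (expectation_nonneg T fun i => sq_nonneg _)
      fun t ht => expectation_dist_sq_succ_le hP hL hη hLη hmin hcorr ht
    simp only [virtualModel_zero, expectation_const] at this
    linarith
  have hgap : E ≤ 2 * R / η + 1024 * (Q + L) * (η ^ 2 * N) * W
      + 2 * σ ^ 2 * (η * P.rho) * W := by
    have h1 := mul_le_mul_of_nonneg_left hdev2 (show 0 ≤ η * (Q + L) by positivity)
    have h2 := mul_le_mul_of_nonneg_right hsmall (mul_nonneg hη.le hE0)
    have h3 : η * E ≤ η * (2 * R / η + 1024 * (Q + L) * (η ^ 2 * N) * W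
        + 2 * σ ^ 2 * (η * P.rho) * W) := by
      have : η * (2 * R / η) = 2 * R := by field_simp
      rw [mul_add, mul_add, this]
      linarith
    exact le_of_mul_le_mul_left h3 hη
  have hout : expectation P T (fun i => P.globalLoss (weightedOutput P S μ η T i))
      - P.globalLoss xstar ≤ (1 / W) * (2 * E + L * ∑ t ∈ range T, ω t * Ψ t) := by
    have h1 : ∀ i, P.globalLoss (weightedOutput P S μ η T i) - P.globalLoss xstar
        ≤ (1 / W) * ∑ t ∈ range T, ω t *
          (2 * (P.globalLoss (virtualModel P S η i t) - P.globalLoss xstar)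
            + L * deviation P S η i t) := by
      intro i
      have h2 := hconv.map_average_le (range T) ω (fun t _ => hω0 t) hW0
        fun t => averageModel P S η i t
      have h3 : (1 / W) * ∑ t ∈ range T, ω t * P.globalLoss (averageModel P S η i t)
          - P.globalLoss xstar = (1 / W) * ∑ t ∈ range T, ω t *
            (P.globalLoss (averageModel P S η i t) - P.globalLoss xstar) := by
        simp only [mul_sub, sum_sub_distrib, ← sum_mul]
        rw [← hW]
        field_simp
      refine (sub_le_sub_right h2 _).trans ?_
      rw [← hW, h3]
      refine mul_le_mul_of_nonneg_left (sum_le_sum fun t _ => ?_) (by positivity)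
      exact mul_le_mul_of_nonneg_left (globalLoss_averageModel_le hP hL hmin i t) (hω0 t)
    have h4 := expectation_mono (P := P) T h1
    rw [expectation_sub, expectation_const, expectation_const_mul, expectation_sum] at h4
    simp only [expectation_const_mul, expectation_add] at h4
    refine h4.trans (le_of_eq ?_)
    congr 1
    rw [hE, mul_sum, mul_sum, ← sum_add_distrib]
    exact sum_congr rfl fun t _ => by simp only [he, hΨ]; ring
  refine hout.trans ?_
  have h1 : 2 * E + L * ∑ t ∈ range T, ω t * Ψ t
      ≤ W * (6 * R / (η * W) + (3072 * (Q + L) + 512 * L) * (η ^ 2 * N)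
        + 6 * σ ^ 2 * (η * P.rho)) := by
    have h2 : W * (6 * R / (η * W)) = 3 * (2 * R / η) := by field_simp; ring
    have h3 := mul_le_mul_of_nonneg_left hdev2 hL.le
    have h4 := mul_le_mul_of_nonneg_right hsmall' hE0
    rw [mul_add, mul_add, h2]
    linarith
  calc (1 / W) * (2 * E + L * ∑ t ∈ range T, ω t * Ψ t)
      ≤ (1 / W) * (W * (6 * R / (η * W) + (3072 * (Q + L) + 512 * L) * (η ^ 2 * N)
        + 6 * σ ^ 2 * (η * P.rho))) := mul_le_mul_of_nonneg_left h1 (by positivity)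
    _ = _ := by rw [← mul_assoc, one_div_mul_cancel hW0.ne', one_mul]

/-! ### How the mean update correlates with the direction to a minimizer -/

/-- Strong convexity at the virtual model, doubled, gives twice the gap plus `μ ‖x - x*‖²`. Young's
inequality for the deviation gives up half of the quadratic term, and quadratic growth at the
minimizer restores it from one of the two gaps. The mean update is compared with the gradient of the
global loss, so only that loss has to be convex. -/
theorem StronglyConvex.correlation (hP : Admissible P S T η L σ ζ) {μ : ℝ} (hμ : 0 < μ)
    (hf : StronglyConvex μ P.globalLoss) {xstar : Model d}
    (hmin : ∀ x, P.globalLoss xstar ≤ P.globalLoss x) (i : ℕ → ∀ v, Fin (P.D v)) (t : ℕ) :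
    P.globalLoss (virtualModel P S η i t) - P.globalLoss xstar
      + μ * ‖virtualModel P S η i t - xstar‖ ^ 2 - 2 * L ^ 2 / μ * deviation P S η i t
      ≤ 2 * inner ℝ (∑ v, P.weight v • meanGrad P S η i t v)
        (virtualModel P S η i t - xstar) := by
  set x := virtualModel P S η i t
  set M := ∑ v, P.weight v • meanGrad P S η i t v
  have h1 := hf x xstar
  have h2 := hf xstar x
  rw [gradient_eq_zero_of_forall_le hmin, inner_zero_left, add_zero] at h2
  rw [← neg_sub x xstar, inner_neg_right, norm_neg] at h1
  have h3 : ‖M - gradient P.globalLoss x‖ ^ 2 ≤ L ^ 2 * deviation P S η i t :=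
    hP.norm_sum_meanGrad_sub_sq_le i t
  have h4 := neg_le_of_abs_le (abs_real_inner_le_norm (M - gradient P.globalLoss x) (x - xstar))
  rw [inner_sub_left] at h4
  have h5 : 2 * (‖M - gradient P.globalLoss x‖ * ‖x - xstar‖)
      ≤ 2 / μ * ‖M - gradient P.globalLoss x‖ ^ 2 + μ / 2 * ‖x - xstar‖ ^ 2 := by
    have h6 : 0 ≤ 2 / μ * (‖M - gradient P.globalLoss x‖ - μ / 2 * ‖x - xstar‖) ^ 2 := by
      positivity
    have h7 : 2 / μ * (‖M - gradient P.globalLoss x‖ - μ / 2 * ‖x - xstar‖) ^ 2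
        = 2 / μ * ‖M - gradient P.globalLoss x‖ ^ 2
          - 2 * (‖M - gradient P.globalLoss x‖ * ‖x - xstar‖) + μ / 2 * ‖x - xstar‖ ^ 2 := by
      field_simp
      ring
    linarith
  have h8 := mul_le_mul_of_nonneg_left h3 (show 0 ≤ 2 / μ by positivity)
  have h9 : 2 * L ^ 2 / μ * deviation P S η i t
      = 2 / μ * (L ^ 2 * deviation P S η i t) := by ring
  rw [h9]
  linarith

omit [Nontrivial V] [Fintype V] [DecidableEq V] in
-- The descent lemma from `x` to `y` is combined with convexity from `x` to `z`. Moving the gradient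
-- to another point then costs only a quadratic error, which needs no strong convexity to pay for
-- it.
theorem StronglyConvex.sub_le_inner {f : Model d → ℝ} (hf : StronglyConvex 0 f)
    (hdiff : Differentiable ℝ f) (hL : ∀ x y, ‖gradient f y - gradient f x‖ ≤ L * ‖y - x‖)
    (x y z : Model d) :
    f y - f z - L / 2 * ‖x - y‖ ^ 2 ≤ inner ℝ (gradient f x) (y - z) := by
  have h1 := le_quadratic_of_lipschitz_gradient hdiff hL x y
  have h2 := hf x z
  rw [norm_sub_rev y x] at h1
  rw [← sub_sub_sub_cancel_right y z x, inner_sub_right]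
  linarith

omit [Nontrivial V] in
theorem correlation_of_forall_le (η : ℝ) (i : ℕ → ∀ v, Fin (P.D v)) (t : ℕ) (xstar : Model d)
    (F : V → Model d → ℝ) (hF : ∀ x, ∑ v, P.weight v * F v x = P.globalLoss x)
    (hmin : P.globalLoss xstar ≤ P.globalLoss (virtualModel P S η i t))
    (h : ∀ v, F v (virtualModel P S η i t) - F v xstar
      - L / 2 * ‖localModel P S η i t v - virtualModel P S η i t‖ ^ 2
      ≤ inner ℝ (meanGrad P S η i t v) (virtualModel P S η i t - xstar)) :
    P.globalLoss (virtualModel P S η i t) - P.globalLoss xstar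
      + 0 * ‖virtualModel P S η i t - xstar‖ ^ 2 - L * deviation P S η i t
      ≤ 2 * inner ℝ (∑ v, P.weight v • meanGrad P S η i t v)
        (virtualModel P S η i t - xstar) := by
  have h1 := sum_le_sum fun v (_ : v ∈ univ) =>
    mul_le_mul_of_nonneg_left (h v) (P.weight_nonneg v)
  have h2 : ∑ v, P.weight v * (F v (virtualModel P S η i t) - F v xstar
      - L / 2 * ‖localModel P S η i t v - virtualModel P S η i t‖ ^ 2)
      = P.globalLoss (virtualModel P S η i t) - P.globalLoss xstar
        - L / 2 * deviation P S η i t := by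
    rw [← hF, ← hF, deviation, mul_sum, ← sum_sub_distrib, ← sum_sub_distrib]
    exact sum_congr rfl fun v _ => by ring
  rw [h2] at h1
  simp only [← real_inner_smul_left, ← sum_inner] at h1
  linarith

omit [Nontrivial V] in
theorem correlation_of_localLoss_convex (hP : Admissible P S T η L σ ζ)
    (hf : ∀ v, StronglyConvex 0 (P.localLoss v)) {xstar : Model d}
    (hmin : ∀ x, P.globalLoss xstar ≤ P.globalLoss x) (i : ℕ → ∀ v, Fin (P.D v)) (t : ℕ) :
    P.globalLoss (virtualModel P S η i t) - P.globalLoss xstar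
      + 0 * ‖virtualModel P S η i t - xstar‖ ^ 2 - L * deviation P S η i t
      ≤ 2 * inner ℝ (∑ v, P.weight v • meanGrad P S η i t v)
        (virtualModel P S η i t - xstar) :=
  correlation_of_forall_le η i t xstar P.localLoss (fun x => (P.globalLoss_eq x).symm) (hmin _)
    fun v => (hf v).sub_le_inner (P.localLoss_differentiable v) (hP.smooth v) _ _ _

/-- With `ζ = 0` local and global gradients agree at the local models that occur, so the global loss
can replace each local one and its convexity suffices. -/
theorem correlation_of_iid (hP : Admissible P S T η L σ 0) (hf : StronglyConvex 0 P.globalLoss)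
    {xstar : Model d} (hmin : ∀ x, P.globalLoss xstar ≤ P.globalLoss x)
    (i : ℕ → ∀ v, Fin (P.D v)) {t : ℕ} (ht : t < T) :
    P.globalLoss (virtualModel P S η i t) - P.globalLoss xstar
      + 0 * ‖virtualModel P S η i t - xstar‖ ^ 2 - L * deviation P S η i t
      ≤ 2 * inner ℝ (∑ v, P.weight v • meanGrad P S η i t v)
        (virtualModel P S η i t - xstar) := by
  refine correlation_of_forall_le η i t xstar (fun _ => P.globalLoss)
    (fun x => by rw [← sum_mul, P.sum_weight, one_mul]) (hmin _) fun v => ?_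
  have h := hP.diversity i t ht v
  have e : meanGrad P S η i t v = gradient P.globalLoss (localModel P S η i t v) := by
    rw [← sub_eq_zero, ← norm_eq_zero]
    have : ‖meanGrad P S η i t v - gradient P.globalLoss (localModel P S η i t v)‖ ^ 2 ≤ 0 :=
      h.trans_eq (zero_pow two_ne_zero)
    exact pow_eq_zero_iff (two_ne_zero) |>.1 (le_antisymm this (sq_nonneg _))
  rw [e]
  exact hf.sub_le_inner P.globalLoss_differentiable (fun x y => hP.globalLoss_smooth x y) _ _ _

omit [Nontrivial V] in
theorem weightedOutput_zero (η : ℝ) (T : ℕ) (i : ℕ → ∀ v, Fin (P.D v)) :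
    weightedOutput P S 0 η T i = uniformOutput P S η T i := by
  simp [weightedOutput, uniformOutput]

/-- Convergence of DIGEST without strong convexity. -/
theorem expectation_uniformOutput_le (hP : Admissible P S T η L σ ζ) (hL : 0 < L) (hη : 0 < η)
    {R : ℝ} (hηA : 256 * L * (η * S.A) ≤ 1)
    {xstar : Model d} (hconv : StronglyConvex 0 P.globalLoss)
    (hmin : ∀ x, P.globalLoss xstar ≤ P.globalLoss x) (hR : ‖P.x0 - xstar‖ ^ 2 ≤ R)
    (hcorr : ∀ i, ∀ t < T, P.globalLoss (virtualModel P S η i t) - P.globalLoss xstar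
      + 0 * ‖virtualModel P S η i t - xstar‖ ^ 2 - L * deviation P S η i t
      ≤ 2 * inner ℝ (∑ v, P.weight v • meanGrad P S η i t v) (virtualModel P S η i t - xstar)) :
    expectation P T (fun i => P.globalLoss (uniformOutput P S η T i)) - P.globalLoss xstar
      ≤ 6 * (R / (η * T)) + 6656 * L * (η ^ 2 * (S.A * σ ^ 2 + S.A ^ 2 * ζ ^ 2))
        + 6 * σ ^ 2 * (η * P.rho) := by
  -- With `Q = L` and `μ = 0` the condition on `η` becomes `256 * L * (η * A) ≤ 1`.
  have := expectation_weightedOutput_le hP hL hη le_rfl hL.le (by linarith) hconv hmin hR hcorr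
  simp only [weightedOutput_zero] at this
  refine this.trans (le_of_eq ?_)
  simp
  ring

/-! ### Non-convex losses -/

/-- Polarization writes `-⟨g, M⟩` through `‖M - g‖²`, `-‖g‖²` and `-‖M‖²`; the last one pays for the
second-order term of the descent lemma when `L * η ≤ 1`. -/
theorem expectation_globalLoss_succ_le (hP : Admissible P S T η L σ ζ) (hη : 0 < η)
    (hLη : L * η ≤ 1) (hL : 0 < L) {t : ℕ} (ht : t < T) :
    expectation P T (fun i => P.globalLoss (virtualModel P S η i (t + 1)))
      ≤ expectation P T (fun i => P.globalLoss (virtualModel P S η i t))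
        - η / 2 * expectation P T
          (fun i => ‖gradient P.globalLoss (virtualModel P S η i t)‖ ^ 2)
        + η / 2 * L ^ 2 * expectation P T (fun i => deviation P S η i t)
        + L * η ^ 2 / 2 * (σ ^ 2 * P.rho) := by
  let M := fun i => ∑ v, P.weight v • meanGrad P S η i t v
  let Z := fun i => ∑ v, P.weight v • noise P S η i t v
  let g := fun i => gradient P.globalLoss (virtualModel P S η i t)
  have h1 : ∀ i, P.globalLoss (virtualModel P S η i (t + 1))
      ≤ P.globalLoss (virtualModel P S η i t) - η / 2 * ‖g i‖ ^ 2
        + η / 2 * L ^ 2 * deviation P S η i t + L * η ^ 2 / 2 * ‖Z i‖ ^ 2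
        + inner ℝ (Z i) ((L * η ^ 2) • M i - η • g i) := by
    intro i
    have h2 := le_quadratic_of_lipschitz_gradient P.globalLoss_differentiable
      (fun x y => hP.globalLoss_smooth x y) (virtualModel P S η i t)
      (virtualModel P S η i (t + 1))
    have e : virtualModel P S η i (t + 1) - virtualModel P S η i t = -(η • (Z i + M i)) := by
      rw [virtualModel_succ]
      simp only [M, Z]
      abel
    rw [e, norm_neg, inner_neg_right, norm_smul, mul_pow, Real.norm_of_nonneg hη.le,
      norm_add_sq_real, real_inner_smul_right, inner_add_right] at h2
    have h3 : ‖M i - g i‖ ^ 2 ≤ L ^ 2 * deviation P S η i t :=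
      hP.norm_sum_meanGrad_sub_sq_le i t
    rw [norm_sub_sq_real] at h3
    rw [inner_sub_right, real_inner_smul_right, real_inner_smul_right]
    have h4 := mul_le_mul_of_nonneg_left h3 (show 0 ≤ η / 2 by positivity)
    have h5 := mul_le_mul_of_nonneg_right hLη (show 0 ≤ η / 2 * ‖M i‖ ^ 2 by positivity)
    rw [real_inner_comm (g i) (Z i)]
    rw [real_inner_comm (g i) (M i)] at h4
    change _ ≤ _ + -(η * (inner ℝ (g i) (Z i) + inner ℝ (g i) (M i))) + _ at h2
    linarith
  refine (expectation_mono T h1).trans ?_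
  simp only [expectation_add, expectation_sub, expectation_const_mul]
  have h2 : expectation P T (fun i => inner ℝ (Z i) ((L * η ^ 2) • M i - η • g i)) = 0 := by
    refine expectation_inner_sum_noise ht η _ fun i i' h => ?_
    simp only [g, M]
    rw [virtualModel_congr η h, sum_meanGrad_congr η h]
  rw [h2, add_zero]
  have h3 := mul_le_mul_of_nonneg_left (expectation_norm_sum_weight_noise_sq_le hP ht)
    (show 0 ≤ L * η ^ 2 / 2 by positivity)
  gcongr

/-- Convergence of DIGEST to stationary points. -/
theorem meanSqGrad_le (hP : Admissible P S T η L σ ζ) (hL : 0 < L) (hη : 0 < η) {F : ℝ}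
    (hηA : 256 * L * (η * S.A) ≤ 1) (hbdd : BddBelow (Set.range P.globalLoss))
    (hF : P.globalLoss P.x0 - (⨅ x, P.globalLoss x) ≤ F) :
    meanSqGrad P T (virtualModel P S η)
        ≤ 12 * (F / (η * T)) + 4096 * L ^ 2 * (η ^ 2 * (S.A * σ ^ 2 + S.A ^ 2 * ζ ^ 2))
          + 6 * L * σ ^ 2 * (η * P.rho) ∧
      meanSqGrad P T (averageModel P S η)
        ≤ 12 * (F / (η * T)) + 4096 * L ^ 2 * (η ^ 2 * (S.A * σ ^ 2 + S.A ^ 2 * ζ ^ 2))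
          + 6 * L * σ ^ 2 * (η * P.rho) := by
  have hA1 : (1 : ℝ) ≤ S.A := by exact_mod_cast Protocol.one_le_A hP.sync
  have hLA0 : 0 ≤ L * (η * S.A) := by positivity
  have hLη : L * η ≤ 1 := by
    have : η ≤ η * S.A := by nlinarith
    have := mul_le_mul_of_nonneg_left this hL.le
    linarith
  have hT : (0 : ℝ) < T := by exact_mod_cast hP.one_le
  set N : ℝ := S.A * σ ^ 2 + S.A ^ 2 * ζ ^ 2 with hN
  have hN0 : 0 ≤ N := by positivity
  have hρ := P.rho_pos
  set Ψ := fun t => expectation P T (fun i => deviation P S η i t) with hΨ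
  set G := fun t =>
    expectation P T (fun i => ‖gradient P.globalLoss (virtualModel P S η i t)‖ ^ 2) with hG
  have hG0 : 0 ≤ ∑ t ∈ range T, G t :=
    sum_nonneg fun t _ => expectation_nonneg T fun i => sq_nonneg _
  have hdev : ∑ t ∈ range T, Ψ t
      ≤ 512 * η ^ 2 * N * T + 2048 * (η * S.A) ^ 2 * ∑ t ∈ range T, G t := by
    have := sum_expectation_deviation_le hP hL hη (by linarith) (ω := fun _ => 1)
      (fun _ => zero_le_one) fun _ _ _ _ => by norm_num
    simpa using this
  have hsmall : L ^ 2 * (2048 * (η * S.A) ^ 2) ≤ 1 / 4 := by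
    have := mul_le_mul hηA hηA (by positivity) zero_le_one
    nlinarith
  have hdev2 : L ^ 2 * ∑ t ∈ range T, Ψ t
      ≤ 512 * L ^ 2 * (η ^ 2 * N) * T + 1 / 4 * ∑ t ∈ range T, G t := by
    have h1 := mul_le_mul_of_nonneg_left hdev (sq_nonneg L)
    have h2 := mul_le_mul_of_nonneg_right hsmall hG0
    linarith
  have hdescent : expectation P T (fun i => P.globalLoss (virtualModel P S η i T))
      ≤ P.globalLoss P.x0 - η / 2 * ∑ t ∈ range T, G t
        + η / 2 * (L ^ 2 * ∑ t ∈ range T, Ψ t) + L * η ^ 2 / 2 * (σ ^ 2 * P.rho) * T := by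
    have key : ∀ n ≤ T, expectation P T (fun i => P.globalLoss (virtualModel P S η i n))
        ≤ P.globalLoss P.x0 - η / 2 * ∑ t ∈ range n, G t
          + η / 2 * (L ^ 2 * ∑ t ∈ range n, Ψ t) + L * η ^ 2 / 2 * (σ ^ 2 * P.rho) * n := by
      intro n hn
      induction n with
      | zero => simp [virtualModel_zero, expectation_const]
      | succ n ih =>
        have h1 := ih (by omega)
        have h2 := expectation_globalLoss_succ_le hP hη hLη hL (show n < T by omega)
        change _ ≤ _ - η / 2 * G n + η / 2 * L ^ 2 * Ψ n + _ at h2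
        simp only [sum_range_succ]
        push_cast
        linarith
    exact key T le_rfl
  have hinf : (⨅ x, P.globalLoss x)
      ≤ expectation P T (fun i => P.globalLoss (virtualModel P S η i T)) := by
    rw [← expectation_const (P := P) T (⨅ x, P.globalLoss x)]
    exact expectation_mono T fun i => ciInf_le hbdd _
  have hsum : ∑ t ∈ range T, G t ≤ 4 * (F / η) + 1024 * L ^ 2 * (η ^ 2 * N) * T
      + 2 * L * σ ^ 2 * (η * P.rho) * T := by
    have h1 : η * ∑ t ∈ range T, G t ≤ η * (4 * (F / η) + 1024 * L ^ 2 * (η ^ 2 * N) * T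
        + 2 * L * σ ^ 2 * (η * P.rho) * T) := by
      have h2 := mul_le_mul_of_nonneg_left hdev2 (show 0 ≤ η / 2 by positivity)
      have h3 : η * (4 * (F / η)) = 4 * F := by field_simp
      have h4 : 0 ≤ η * (L ^ 2 * (η ^ 2 * N) * T) := by positivity
      have h5 : 0 ≤ η * (L * σ ^ 2 * (η * P.rho) * T) := by
        have := hρ.le
        positivity
      have h6 : 0 ≤ η * ∑ t ∈ range T, G t := mul_nonneg hη.le hG0
      rw [mul_add, mul_add, h3]
      nlinarith
    exact le_of_mul_le_mul_left h1 hη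
  have hF0 : 0 ≤ F := by
    have := ciInf_le hbdd P.x0
    linarith
  -- Three sums of `G` serve both claims: for the averaged models the squared gradient is at most `2
  -- * L² * Ψ + 2 * G`, and the deviation returns at most half a sum of `G`.
  have hbound : (1 / (T : ℝ)) * (3 * ∑ t ∈ range T, G t + 1024 * L ^ 2 * (η ^ 2 * N) * T)
      ≤ 12 * (F / (η * T)) + 4096 * L ^ 2 * (η ^ 2 * N) + 6 * L * σ ^ 2 * (η * P.rho) := by
    have h1 : (1 / (T : ℝ)) * (12 * (F / η) + 4096 * L ^ 2 * (η ^ 2 * N) * T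
        + 6 * L * σ ^ 2 * (η * P.rho) * T)
        = 12 * (F / (η * T)) + 4096 * L ^ 2 * (η ^ 2 * N) + 6 * L * σ ^ 2 * (η * P.rho) := by
      field_simp
    rw [← h1]
    refine mul_le_mul_of_nonneg_left ?_ (by positivity)
    linarith
  constructor
  · refine le_trans ?_ hbound
    refine mul_le_mul_of_nonneg_left ?_ (by positivity)
    have : 0 ≤ 1024 * L ^ 2 * (η ^ 2 * N) * T := by positivity
    change ∑ t ∈ range T, G t ≤ _
    linarith
  · refine le_trans ?_ hbound
    refine mul_le_mul_of_nonneg_left ?_ (by positivity)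
    have h1 : ∀ t, expectation P T
        (fun i => ‖gradient P.globalLoss (averageModel P S η i t)‖ ^ 2)
        ≤ 2 * (L ^ 2 * Ψ t) + 2 * G t := by
      intro t
      simp only [hΨ, hG]
      rw [← expectation_const_mul, ← expectation_const_mul, ← expectation_const_mul,
        ← expectation_add]
      refine expectation_mono T fun i => ?_
      have h2 := norm_add_sq_le_two (gradient P.globalLoss (averageModel P S η i t)
        - gradient P.globalLoss (virtualModel P S η i t))
        (gradient P.globalLoss (virtualModel P S η i t))
      rw [sub_add_cancel] at h2
      have h3 := pow_le_pow_left₀ (norm_nonneg _) (hP.globalLoss_smooth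
        (virtualModel P S η i t) (averageModel P S η i t)) 2
      rw [mul_pow] at h3
      have h4 := mul_le_mul_of_nonneg_left
        (norm_averageModel_sub_sq_le (P := P) (S := S) η i t) (sq_nonneg L)
      linarith
    refine (sum_le_sum fun t _ => h1 t).trans ?_
    rw [sum_add_distrib, ← mul_sum, ← mul_sum, ← mul_sum]
    linarith

end Convergence

/-! ### Rates -/

section Rates

theorem rpow_three_halves {ρ : ℝ} (hρ : 0 ≤ ρ) : ρ ^ (3 / 2 : ℝ) = √ρ ^ 3 := by
  rw [Real.sqrt_eq_rpow, ← Real.rpow_natCast, ← Real.rpow_mul hρ]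
  norm_num

theorem rpow_quarters_sq {ρ T : ℝ} (hρ : 0 ≤ ρ) (hT : 0 ≤ T) :
    (ρ ^ (3 / 4 : ℝ) * T ^ (1 / 4 : ℝ)) ^ 2 = √ρ ^ 3 * √T := by
  rw [← rpow_three_halves hρ, Real.sqrt_eq_rpow, mul_pow, ← Real.rpow_natCast,
    ← Real.rpow_natCast, ← Real.rpow_mul hρ, ← Real.rpow_mul hT]
  norm_num

/-- The learning rate without strong convexity. -/
noncomputable def sqrtRate (Q : ℝ) (T A : ℕ) (ρ : ℝ) : ℝ := min (1 / (Q * A)) (1 / √(ρ * T))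

theorem sqrtRate_isLearningRate {L Q : ℝ} (hL : 0 < L) (hQ : 30 * L ≤ Q) :
    IsLearningRate L (sqrtRate Q) := by
  intro T A ρ hT hA hρ
  have hT' : (0 : ℝ) < T := by exact_mod_cast hT
  have hA' : (0 : ℝ) < A := by exact_mod_cast hA
  have hQ0 : 0 < Q := by linarith
  refine ⟨lt_min (by positivity) (by positivity), (min_le_left _ _).trans ?_⟩
  gcongr

theorem rate_mul_le {Q η : ℝ} {A : ℕ} (hQ : 0 < Q) (hA : 1 ≤ A) (h : η ≤ 1 / (Q * A)) :
    Q * (η * A) ≤ 1 := by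
  have hA' : (0 : ℝ) < A := by exact_mod_cast hA
  rw [le_div_iff₀ (by positivity)] at h
  linarith

/-- The rate `1 / √(ρT)` balances the initial error against the noise term, and the drift `η² N` is
at most `N / (ρT)`; this is where the threshold `ρ^(3/2) T^(1/2)` comes from. -/
theorem sqrtRate_bound {Q κ K R N c₁ c₂ c₃ ρ : ℝ} {T A : ℕ} (hQ : 0 < Q) (hT : 1 ≤ T)
    (hA : 1 ≤ A) (hρ : 0 < ρ) (hρ1 : ρ ≤ 1) (hR : 0 ≤ R) (hκ : 0 ≤ κ) (hc₁ : 0 ≤ c₁)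
    (hc₂ : 0 ≤ c₂) (hc₃ : 0 ≤ c₃) (h1 : A ≤ κ * (√ρ ^ 3 * √T)) (hN : N ≤ K * (√ρ ^ 3 * √T))
    (hN0 : 0 ≤ N) :
    c₁ * (R / (sqrtRate Q T A ρ * T)) + c₂ * (sqrtRate Q T A ρ ^ 2 * N)
      + c₃ * (sqrtRate Q T A ρ * ρ) ≤ (c₁ * (R * (Q * κ + 1)) + c₂ * K + c₃) * √(ρ / T) := by
  have hT' : (0 : ℝ) < T := by exact_mod_cast hT
  have hA' : (0 : ℝ) < A := by exact_mod_cast hA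
  set η := sqrtRate Q T A ρ with hη
  have hη0 : 0 < η := lt_min (by positivity) (by positivity)
  have hle : η ≤ 1 / √(ρ * T) := min_le_right _ _
  rw [Real.sqrt_mul hρ.le] at hle
  rw [Real.sqrt_div hρ.le]
  have hρs : ρ = √ρ ^ 2 := (Real.sq_sqrt hρ.le).symm
  have hTs : (T : ℝ) = √T ^ 2 := (Real.sq_sqrt hT'.le).symm
  have hr0 : 0 < √ρ := Real.sqrt_pos.2 hρ
  have hs0 : 0 < √(T : ℝ) := Real.sqrt_pos.2 hT'
  have hr1 : √ρ ≤ 1 := Real.sqrt_le_one.2 hρ1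
  have e1 : R / (η * T) ≤ R * (Q * κ + 1) * (√ρ / √T) := by
    have hinv : 1 / η ≤ Q * A + √ρ * √T := by
      have hη' : η = min (1 / (Q * A)) (1 / √(ρ * T)) := rfl
      rcases min_choice (1 / (Q * (A : ℝ))) (1 / √(ρ * T)) with h | h
      · rw [hη', h, one_div_one_div]
        have : 0 ≤ √ρ * √T := by positivity
        linarith
      · rw [hη', h, one_div_one_div, Real.sqrt_mul hρ.le]
        have : 0 ≤ Q * A := by positivity
        linarith
    -- As `ρ ≤ 1`, the hypothesis gives `A ≤ κ √(ρT)`, so the cap `1 / (Q * A)` costs only a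
    -- constant factor.
    have h3 : √ρ ^ 3 ≤ √ρ := by
      have := pow_le_pow_of_le_one hr0.le hr1 (show 1 ≤ 3 by norm_num)
      simpa using this
    have h4 : Q * A + √ρ * √T ≤ (Q * κ + 1) * (√ρ * √T) := by
      have h5 : (A : ℝ) ≤ κ * (√ρ * √T) := h1.trans (by gcongr)
      have := mul_le_mul_of_nonneg_left h5 hQ.le
      linarith
    calc R / (η * T) = R / T * (1 / η) := by field_simp
      _ ≤ R / T * ((Q * κ + 1) * (√ρ * √T)) := by
        gcongr
        exact hinv.trans h4
      _ = R * (Q * κ + 1) * (√ρ * √T / T) := by ring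
      _ = _ := by
        congr 1
        rw [div_eq_div_iff hT'.ne' hs0.ne']
        nth_rewrite 3 [hTs]
        ring
  have e2 : η ^ 2 * N ≤ K * (√ρ / √T) := by
    calc η ^ 2 * N ≤ (1 / (√ρ * √T)) ^ 2 * (K * (√ρ ^ 3 * √T)) := by gcongr
      _ = _ := by field_simp
  have e3 : η * ρ ≤ √ρ / √T := by
    calc η * ρ ≤ 1 / (√ρ * √T) * ρ := by gcongr
      _ = 1 / (√ρ * √T) * √ρ ^ 2 := by rw [← hρs]
      _ = _ := by field_simp
  have := mul_le_mul_of_nonneg_left e1 hc₁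
  have := mul_le_mul_of_nonneg_left e2 hc₂
  have := mul_le_mul_of_nonneg_left e3 hc₃
  linarith

theorem one_le_one_add_log {T : ℕ} : 1 ≤ 1 + Real.log T := by
  have := Real.log_natCast_nonneg T
  linarith

/-- The learning rate under strong convexity. -/
noncomputable def logRate (μ Q : ℝ) (T A : ℕ) (_ρ : ℝ) : ℝ :=
  min (3 * (1 + Real.log T) / (μ * T)) (1 / (Q * A))

theorem logRate_isLearningRate {L μ Q : ℝ} (hL : 0 < L) (hμ : 0 < μ) (hQ : 30 * L ≤ Q) :
    IsLearningRate L (logRate μ Q) := by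
  intro T A ρ hT hA hρ
  have hT' : (0 : ℝ) < T := by exact_mod_cast hT
  have hA' : (0 : ℝ) < A := by exact_mod_cast hA
  have hQ0 : 0 < Q := by linarith
  have hl := one_le_one_add_log (T := T)
  refine ⟨lt_min (by positivity) (by positivity), (min_le_right _ _).trans ?_⟩
  gcongr

/-- The last summand alone is this large. -/
theorem exp_le_sum_inv_pow {q : ℝ} (hq : 0 < q) {T : ℕ} (hT : 1 ≤ T) :
    Real.exp ((1 - q) * T) ≤ ∑ t ∈ range T, (q ^ (t + 1))⁻¹ := by
  have h1 : Real.exp ((1 - q) * T) ≤ (q ^ T)⁻¹ := by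
    rw [le_inv_comm₀ (Real.exp_pos _) (by positivity), ← Real.exp_neg, ← neg_mul, mul_comm,
      Real.exp_nat_mul]
    gcongr
    have := Real.add_one_le_exp (-(1 - q))
    linarith
  refine h1.trans ?_
  have := single_le_sum (f := fun t => (q ^ (t + 1))⁻¹) (fun t _ => by positivity)
    (mem_range.2 (show T - 1 < T by omega))
  rwa [Nat.sub_add_cancel hT] at this

theorem le_sum_inv_pow {q : ℝ} (hq : 0 < q) (hq1 : q ≤ 1) (T : ℕ) :
    (T : ℝ) ≤ ∑ t ∈ range T, (q ^ (t + 1))⁻¹ := by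
  have := card_nsmul_le_sum (range T) (fun t => (q ^ (t + 1))⁻¹) 1
    fun t _ => (one_le_inv₀ (by positivity)).2 (pow_le_one₀ hq.le hq1)
  simpa using this

/-- Two regimes for the initial error. Uncapped, the weights sum to at least `T³`. Capped at `1 / (Q
* A)`, only `W ≥ T` is used, but then `T` is at most of order `A ℓ`, and together with the bound on
`A²` this forces `A` to be of order `ρ` up to logarithms. -/
theorem logRate_bound {μ Q K K' R N c₁ c₂ c₃ ρ : ℝ} {T A p : ℕ} (hμ : 0 < μ) (hQ : 8 * μ ≤ Q)
    (hT : 1 ≤ T) (hA : 1 ≤ A) (hρ : 0 < ρ) (hR : 0 ≤ R) (hK : 0 ≤ K) (hc₁ : 0 ≤ c₁)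
    (hc₂ : 0 ≤ c₂) (hc₃ : 0 ≤ c₃) (hN0 : 0 ≤ N)
    (hcase : 3 * (1 + Real.log T) / (μ * T) ≤ 1 / (Q * A) ∨
      (A : ℝ) ^ 2 ≤ K * (ρ * T) * (1 + Real.log T) ^ p)
    (h1 : 1 ≤ K * (ρ * T) * (1 + Real.log T) ^ p)
    (hN : N ≤ K' * (ρ * T) * (1 + Real.log T) ^ p) :
    c₁ * (R / (logRate μ Q T A ρ * ∑ t ∈ range T, ((1 - μ * logRate μ Q T A ρ) ^ (t + 1))⁻¹))
      + c₂ * (logRate μ Q T A ρ ^ 2 * N) + c₃ * (logRate μ Q T A ρ * ρ)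
      ≤ (c₁ * (R * (μ * K + 3 * K * Q ^ 2 / μ)) + c₂ * (9 * K' / μ ^ 2) + c₃ * (3 / μ))
        * (1 + Real.log T) ^ (p + 2) * (ρ / T) := by
  have hT' : (0 : ℝ) < T := by exact_mod_cast hT
  have hA' : (1 : ℝ) ≤ A := by exact_mod_cast hA
  have hA0 : (0 : ℝ) < A := by linarith
  have hQ0 : 0 < Q := by linarith
  set l := 1 + Real.log T with hl
  have hl1 : 1 ≤ l := one_le_one_add_log
  have hl0 : 0 < l := by linarith
  set η := logRate μ Q T A ρ with hη
  have hηdef : η = min (3 * l / (μ * T)) (1 / (Q * A)) := rfl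
  have hη0 : 0 < η := lt_min (by positivity) (by positivity)
  have hle1 : η ≤ 3 * l / (μ * T) := min_le_left _ _
  have hle2 : η ≤ 1 / (Q * A) := min_le_right _ _
  have hμη : μ * η ≤ 1 / 8 := by
    have h2 := rate_mul_le hQ0 hA hle2
    have h3 : η ≤ η * A := by nlinarith
    have h4 := mul_le_mul_of_nonneg_right hQ (mul_nonneg hη0.le hA0.le)
    have h5 := mul_le_mul_of_nonneg_left h3 hμ.le
    linarith
  have hq0 : 0 < 1 - μ * η := by linarith
  have hq1 : 1 - μ * η ≤ 1 := by
    have : 0 ≤ μ * η := by positivity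
    linarith
  set W := ∑ t ∈ range T, ((1 - μ * η) ^ (t + 1))⁻¹
  have hWT : (T : ℝ) ≤ W := le_sum_inv_pow hq0 hq1 T
  have hW0 : 0 < W := by linarith
  have hp : l ^ p ≤ l ^ (p + 2) := pow_le_pow_right₀ hl1 (by omega)
  have hp1 : l ^ (p + 1) ≤ l ^ (p + 2) := pow_le_pow_right₀ hl1 (by omega)
  have hp' : l ≤ l ^ (p + 2) := by
    simpa using pow_le_pow_right₀ hl1 (show 1 ≤ p + 2 by omega)
  have e1 : R / (η * W) ≤ R * (μ * K + 3 * K * Q ^ 2 / μ) * l ^ (p + 2) * (ρ / T) := by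
    by_cases hmin : 3 * l / (μ * T) ≤ 1 / (Q * A)
    · have hηe : η = 3 * l / (μ * T) := min_eq_left hmin
      -- Here `μ η T = 3ℓ ≥ 3 log T`. The initial error is then at most `R μ / T²`, and `h1` trades
      -- one factor `1 / T` for `ρ`.
      have hW3 : (T : ℝ) ^ 3 ≤ W := by
        refine le_trans ?_ (exp_le_sum_inv_pow hq0 hT)
        have h2 : (1 - (1 - μ * η)) * T = 3 * l := by
          rw [hηe]
          field_simp
          ring
        rw [h2, hl]
        calc (T : ℝ) ^ 3 = Real.exp (3 * Real.log T) := by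
              rw [show (3 : ℝ) = (3 : ℕ) by norm_num, Real.exp_nat_mul, Real.exp_log hT']
          _ ≤ _ := Real.exp_le_exp.2 (by linarith)
      have hη3 : 1 / (μ * T) ≤ η := by
        rw [hηe]
        gcongr
        linarith
      calc R / (η * W) ≤ R / (1 / (μ * T) * (T : ℝ) ^ 3) := by gcongr
        _ = R * μ / T ^ 2 * 1 := by field_simp
        _ ≤ R * μ / T ^ 2 * (K * (ρ * T) * l ^ p) := by gcongr
        _ = R * (μ * K) * l ^ p * (ρ / T) := by field_simp
        _ ≤ R * (μ * K + 3 * K * Q ^ 2 / μ) * l ^ (p + 2) * (ρ / T) := by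
          gcongr
          have : 0 ≤ 3 * K * Q ^ 2 / μ := by positivity
          linarith
    · have hA2 := hcase.resolve_left hmin
      have hηe : η = 1 / (Q * A) := min_eq_right (not_le.1 hmin).le
      have hTA : (T : ℝ) ≤ 3 * Q / μ * A * l := by
        have h2 := (not_le.1 hmin).le
        rw [div_le_div_iff₀ (by positivity) (by positivity)] at h2
        have : (T : ℝ) = μ * T / μ := by field_simp
        rw [this, div_le_iff₀ hμ]
        have e : 3 * Q / μ * A * l * μ = 3 * l * (Q * A) := by field_simp
        rw [e]
        linarith
      have hA3 : (A : ℝ) ≤ 3 * K * Q / μ * l ^ (p + 1) * ρ := by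
        refine le_of_mul_le_mul_left ?_ hA0
        calc (A : ℝ) * A = A ^ 2 := by ring
          _ ≤ K * (ρ * T) * l ^ p := hA2
          _ ≤ K * (ρ * (3 * Q / μ * A * l)) * l ^ p := by gcongr
          _ = _ := by ring
      calc R / (η * W) ≤ R / (η * T) := by gcongr
        _ = R * Q * A / T := by rw [hηe]; field_simp
        _ ≤ R * Q * (3 * K * Q / μ * l ^ (p + 1) * ρ) / T := by gcongr
        _ = R * (3 * K * Q ^ 2 / μ) * l ^ (p + 1) * (ρ / T) := by ring
        _ ≤ R * (μ * K + 3 * K * Q ^ 2 / μ) * l ^ (p + 2) * (ρ / T) := by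
          gcongr
          have : 0 ≤ μ * K := by positivity
          linarith
  have e2 : η ^ 2 * N ≤ 9 * K' / μ ^ 2 * l ^ (p + 2) * (ρ / T) := by
    calc η ^ 2 * N ≤ (3 * l / (μ * T)) ^ 2 * (K' * (ρ * T) * l ^ p) := by gcongr
      _ = _ := by field_simp; ring
  have e3 : η * ρ ≤ 3 / μ * l ^ (p + 2) * (ρ / T) := by
    calc η * ρ ≤ 3 * l / (μ * T) * ρ := by gcongr
      _ = 3 / μ * l * (ρ / T) := by field_simp
      _ ≤ _ := by gcongr
  have := mul_le_mul_of_nonneg_left e1 hc₁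
  have := mul_le_mul_of_nonneg_left e2 hc₂
  have := mul_le_mul_of_nonneg_left e3 hc₃
  linarith

/-- From `log T ≤ T^ε / ε` with `ε = 1 / (2k)`, so that the `k`-th power of `T^ε` is `√T`. -/
theorem one_add_log_pow_le {T k : ℕ} (hT : 1 ≤ T) (hk : 1 ≤ k) :
    (1 + Real.log T) ^ k ≤ (1 + 2 * k) ^ k * √T := by
  have hT' : (1 : ℝ) ≤ T := by exact_mod_cast hT
  have hk' : (0 : ℝ) < k := by exact_mod_cast hk
  set ε : ℝ := 1 / (2 * k) with hε
  have hε0 : 0 < ε := by positivity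
  have h1 := Real.log_le_rpow_div (show (0 : ℝ) ≤ T by linarith) hε0
  have h2 : (T : ℝ) ^ ε / ε = 2 * k * (T : ℝ) ^ ε := by
    rw [hε]
    field_simp
  have h3 : 1 ≤ (T : ℝ) ^ ε := Real.one_le_rpow hT' hε0.le
  have h4 : 1 + Real.log T ≤ (1 + 2 * k) * (T : ℝ) ^ ε := by linarith
  have h5 := Real.log_nonneg hT'
  refine (pow_le_pow_left₀ (by linarith) h4 k).trans (le_of_eq ?_)
  rw [mul_pow, ← Real.rpow_mul_natCast (by linarith), Real.sqrt_eq_rpow]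
  congr 2
  rw [hε]
  field_simp

theorem log_bound_le_sqrt {C ρ : ℝ} {T k : ℕ} (hC : 0 ≤ C) (hT : 1 ≤ T) (hk : 1 ≤ k) (hρ : 0 ≤ ρ)
    (hρ1 : ρ ≤ 1) :
    C * (1 + Real.log T) ^ k * (ρ / T) ≤ C * (1 + 2 * k) ^ k * √(ρ / T) := by
  have hT' : (0 : ℝ) < T := by exact_mod_cast hT
  have h1 := one_add_log_pow_le hT hk
  have h2 : √(T : ℝ) * (ρ / T) ≤ √(ρ / T) := by
    have h3 : ρ / T = √(ρ / T) * √(ρ / T) := (Real.mul_self_sqrt (by positivity)).symm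
    have h4 : √(T : ℝ) * √(ρ / T) = √ρ := by
      rw [← Real.sqrt_mul hT'.le, mul_div_cancel₀ _ hT'.ne']
    rw [h3, ← mul_assoc, h4, ← h3]
    have := mul_le_mul_of_nonneg_right (Real.sqrt_le_one.2 hρ1) (Real.sqrt_nonneg (ρ / T))
    linarith
  calc C * (1 + Real.log T) ^ k * (ρ / T) ≤ C * ((1 + 2 * k) ^ k * √T) * (ρ / T) := by gcongr
    _ = C * (1 + 2 * k) ^ k * (√T * (ρ / T)) := by ring
    _ ≤ _ := by gcongr

end Rates

theorem Problem.globalLoss_convex {V : Type u} [Fintype V] {d : ℕ} (P : Problem V d)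
    (h : ∀ v, StronglyConvex 0 (P.localLoss v)) : StronglyConvex 0 P.globalLoss := by
  intro x y
  have h1 := sum_le_sum fun v (_ : v ∈ univ) =>
    mul_le_mul_of_nonneg_left (h v x y) (P.weight_nonneg v)
  rw [P.globalLoss_eq, P.globalLoss_eq, P.gradient_globalLoss, sum_inner]
  simp only [real_inner_smul_left]
  simpa [mul_add, sum_add_distrib] using h1

/-! ### Error bounds combined with the learning rates -/

section Cases

variable {V : Type u} [Fintype V] [DecidableEq V] [Nontrivial V] {d T : ℕ} {P : Problem V d}
  {S : Protocol V} {L σ ζ κ R : ℝ}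

theorem Admissible.mul_rate_le {Q η : ℝ} (hP : Admissible P S T η L σ ζ) (hQ : 0 < Q)
    (h : η ≤ 1 / (Q * S.A)) : Q * (η * S.A) ≤ 1 :=
  rate_mul_le hQ (Protocol.one_le_A hP.sync) h

theorem strongly_convex_bound {μ : ℝ} (hL : 0 < L) (hμ : 0 < μ) (hR0 : 0 ≤ R)
    {Q K K' : ℝ} (hQ : Q = 128 * (L + 2 * L ^ 2 / μ) + 8 * μ) {p : ℕ} {xstar : Model d}
    (hP : Admissible P S T (logRate μ Q T S.A P.rho) L σ ζ)
    (hf : StronglyConvex μ P.globalLoss) (hmin : ∀ x, P.globalLoss xstar ≤ P.globalLoss x)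
    (hR : ‖P.x0 - xstar‖ ^ 2 ≤ R) (hK : 0 ≤ K)
    (hcase : 3 * (1 + Real.log T) / (μ * T) ≤ 1 / (Q * S.A) ∨
      (S.A : ℝ) ^ 2 ≤ K * (P.rho * T) * (1 + Real.log T) ^ p)
    (h1 : 1 ≤ K * (P.rho * T) * (1 + Real.log T) ^ p)
    (hN : S.A * σ ^ 2 + S.A ^ 2 * ζ ^ 2 ≤ K' * (P.rho * T) * (1 + Real.log T) ^ p) :
    expectation P T (fun i =>
        P.globalLoss (weightedOutput P S μ (logRate μ Q T S.A P.rho) T i)) - P.globalLoss xstar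
      ≤ (6 * (R * (μ * K + 3 * K * Q ^ 2 / μ))
          + (3072 * (2 * L ^ 2 / μ + L) + 512 * L) * (9 * K' / μ ^ 2) + 6 * σ ^ 2 * (3 / μ))
        * (1 + Real.log T) ^ (p + 2) * (P.rho / T) := by
  have hA := Protocol.one_le_A hP.sync
  have hQ1 : 0 < 2 * L ^ 2 / μ := by positivity
  have hQ0 : 0 < Q := by rw [hQ]; positivity
  have hQL : 30 * L ≤ Q := by linarith
  have hQμ : 8 * μ ≤ Q := by linarith
  have hρ := P.rho_pos
  have hη := logRate_isLearningRate hL hμ hQL T S.A P.rho hP.one_le hA hρ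
  have hηA := hP.mul_rate_le hQ0 (min_le_right _ _)
  have hmain := expectation_weightedOutput_le hP hL hη.1 hμ.le hQ1.le (hQ ▸ hηA)
    (hf.mono hμ.le) hmin hR fun i t _ => hf.correlation hP hμ hmin i t
  have hrate := logRate_bound (c₁ := 6) (c₂ := 3072 * (2 * L ^ 2 / μ + L) + 512 * L)
    (c₃ := 6 * σ ^ 2) hμ hQμ hP.one_le hA hρ hR0 hK (by norm_num) (by positivity) (by positivity)
    (by positivity) hcase h1 hN
  rw [mul_div_assoc] at hmain
  exact hmain.trans hrate

theorem convex_bound (hL : 0 < L) (hR0 : 0 ≤ R) (hκ : 0 ≤ κ) {K : ℝ} {xstar : Model d}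
    (hP : Admissible P S T (sqrtRate (256 * L) T S.A P.rho) L σ ζ)
    (hf : StronglyConvex 0 P.globalLoss) (hmin : ∀ x, P.globalLoss xstar ≤ P.globalLoss x)
    (hR : ‖P.x0 - xstar‖ ^ 2 ≤ R)
    (hcorr : ∀ i, ∀ t < T,
      P.globalLoss (virtualModel P S (sqrtRate (256 * L) T S.A P.rho) i t) - P.globalLoss xstar
      + 0 * ‖virtualModel P S (sqrtRate (256 * L) T S.A P.rho) i t - xstar‖ ^ 2
      - L * deviation P S (sqrtRate (256 * L) T S.A P.rho) i t
      ≤ 2 * inner ℝ (∑ v, P.weight v • meanGrad P S (sqrtRate (256 * L) T S.A P.rho) i t v)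
        (virtualModel P S (sqrtRate (256 * L) T S.A P.rho) i t - xstar))
    (h1 : S.A ≤ κ * (√P.rho ^ 3 * √T))
    (hN : S.A * σ ^ 2 + S.A ^ 2 * ζ ^ 2 ≤ K * (√P.rho ^ 3 * √T)) :
    expectation P T (fun i =>
        P.globalLoss (uniformOutput P S (sqrtRate (256 * L) T S.A P.rho) T i))
        - P.globalLoss xstar
      ≤ (6 * (R * (256 * L * κ + 1)) + 6656 * L * K + 6 * σ ^ 2) * √(P.rho / T) := by
  have hA := Protocol.one_le_A hP.sync
  have hρ := P.rho_pos
  have hQ0 : 0 < 256 * L := by positivity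
  have hη := sqrtRate_isLearningRate hL (show 30 * L ≤ 256 * L by linarith) T S.A P.rho
    hP.one_le hA hρ
  have hηA := hP.mul_rate_le hQ0 (min_le_left _ _)
  exact (expectation_uniformOutput_le hP hL hη.1 hηA hf hmin hR hcorr).trans
    (sqrtRate_bound hQ0 hP.one_le hA hρ P.rho_lt_one.le hR0 hκ (by norm_num) (by positivity)
      (by positivity) h1 hN (by positivity))

theorem nonconvex_bound {F : ℝ} (hL : 0 < L) (hF0 : 0 ≤ F) (hκ : 0 ≤ κ) {K : ℝ}
    (hP : Admissible P S T (sqrtRate (256 * L) T S.A P.rho) L σ ζ)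
    (hbdd : BddBelow (Set.range P.globalLoss))
    (hF : P.globalLoss P.x0 - (⨅ x, P.globalLoss x) ≤ F)
    (h1 : S.A ≤ κ * (√P.rho ^ 3 * √T))
    (hN : S.A * σ ^ 2 + S.A ^ 2 * ζ ^ 2 ≤ K * (√P.rho ^ 3 * √T)) :
    meanSqGrad P T (virtualModel P S (sqrtRate (256 * L) T S.A P.rho))
        ≤ (12 * (F * (256 * L * κ + 1)) + 4096 * L ^ 2 * K + 6 * L * σ ^ 2) * √(P.rho / T) ∧
      meanSqGrad P T (averageModel P S (sqrtRate (256 * L) T S.A P.rho))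
        ≤ (12 * (F * (256 * L * κ + 1)) + 4096 * L ^ 2 * K + 6 * L * σ ^ 2) * √(P.rho / T) := by
  have hA := Protocol.one_le_A hP.sync
  have hρ := P.rho_pos
  have hQ0 : 0 < 256 * L := by positivity
  have hη := sqrtRate_isLearningRate hL (show 30 * L ≤ 256 * L by linarith) T S.A P.rho
    hP.one_le hA hρ
  have hηA := hP.mul_rate_le hQ0 (min_le_left _ _)
  have hrate := sqrtRate_bound (c₁ := 12) (c₂ := 4096 * L ^ 2) (c₃ := 6 * L * σ ^ 2) hQ0
    hP.one_le hA hρ P.rho_lt_one.le hF0 hκ (by norm_num) (by positivity) (by positivity) h1 hN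
    (by positivity)
  obtain ⟨h2, h3⟩ := meanSqGrad_le hP hL hη.1 hηA hbdd hF
  exact ⟨h2.trans hrate, h3.trans hrate⟩

/-- Without diversity the drift is linear in `A`, so a bound on `A` itself suffices; otherwise one
on `A²` is needed. -/
theorem iid_drift_le {a b σ κ : ℝ} (h : a ≤ κ * b) :
    a * σ ^ 2 + a ^ 2 * 0 ^ 2 ≤ σ ^ 2 * κ * b := by
  nlinarith [mul_le_mul_of_nonneg_right h (sq_nonneg σ)]

theorem drift_le {a b σ ζ κ : ℝ} (ha : 1 ≤ a) (h : a ^ 2 ≤ κ * b) :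
    a * σ ^ 2 + a ^ 2 * ζ ^ 2 ≤ (σ ^ 2 + ζ ^ 2) * κ * b := by
  have h1 : a ≤ a ^ 2 := by nlinarith
  nlinarith [mul_le_mul_of_nonneg_right h (sq_nonneg ζ),
    mul_le_mul_of_nonneg_right (h1.trans h) (sq_nonneg σ)]

theorem sq_le_of_le_quarters {a ρ κ : ℝ} {T : ℕ} (ha : 1 ≤ a) (hρ : 0 ≤ ρ)
    (h : a ≤ κ * (ρ ^ (3 / 4 : ℝ) * (T : ℝ) ^ (1 / 4 : ℝ))) :
    a ^ 2 ≤ κ ^ 2 * (√ρ ^ 3 * √T) := by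
  rw [← rpow_quarters_sq hρ T.cast_nonneg, ← mul_pow]
  exact pow_le_pow_left₀ (by linarith) h 2

theorem le_of_le_halves {a ρ κ : ℝ} {T : ℕ} (hρ : 0 ≤ ρ)
    (h : a ≤ κ * (ρ ^ (3 / 2 : ℝ) * (T : ℝ) ^ (1 / 2 : ℝ))) : a ≤ κ * (√ρ ^ 3 * √T) := by
  rwa [rpow_three_halves hρ, ← Real.sqrt_eq_rpow] at h

end Cases

end Digest

open Digest in
theorem corollary1 :
    -- the range of `ρ`
    (∀ (V : Type u) [Fintype V] [DecidableEq V] [Nontrivial V] (d : ℕ) (P : Problem V d),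
      1 / (Fintype.card V : ℝ) ≤ P.rho ∧ P.rho < 1) ∧
    -- strongly convex, iid
    (∀ L μ : ℝ, 0 < L → 0 < μ → ∃ c : ℝ, 0 < c ∧
      ∀ (σ R κ : ℝ) (j : ℕ), 0 ≤ σ → 0 ≤ R → 0 < κ →
      ∃ (C : ℝ) (k : ℕ) (η : ℕ → ℕ → ℝ → ℝ), IsLearningRate L η ∧
      ∀ (V : Type u) [Fintype V] [DecidableEq V] [Nontrivial V] (d T : ℕ)
        (P : Problem V d) (S : Protocol V) (xstar : Model d),
        Admissible P S T (η T S.A P.rho) L σ 0 →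
        StronglyConvex μ P.globalLoss →
        (∀ x, P.globalLoss xstar ≤ P.globalLoss x) → ‖P.x0 - xstar‖ ^ 2 ≤ R →
        (S.A : ℝ) ≤ κ * (P.rho * T) * (1 + Real.log T) ^ j →
        (S.A : ℝ) * (1 + Real.log T) ≤ c * T →
        expectation P T (fun i =>
            P.globalLoss (weightedOutput P S μ (η T S.A P.rho) T i)) - P.globalLoss xstar
          ≤ C * (1 + Real.log T) ^ k * (P.rho / T)) ∧
    -- strongly convex, non-iid
    (∀ (L μ σ ζ R κ : ℝ) (j : ℕ), 0 < L → 0 < μ → 0 ≤ σ → 0 ≤ ζ → 0 ≤ R → 0 < κ →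
      ∃ (C : ℝ) (k : ℕ) (η : ℕ → ℕ → ℝ → ℝ), IsLearningRate L η ∧
      ∀ (V : Type u) [Fintype V] [DecidableEq V] [Nontrivial V] (d T : ℕ)
        (P : Problem V d) (S : Protocol V) (xstar : Model d),
        Admissible P S T (η T S.A P.rho) L σ ζ →
        StronglyConvex μ P.globalLoss →
        (∀ x, P.globalLoss xstar ≤ P.globalLoss x) → ‖P.x0 - xstar‖ ^ 2 ≤ R →
        (S.A : ℝ) ≤ κ * √(P.rho * T) * (1 + Real.log T) ^ j →
        expectation P T (fun i =>
            P.globalLoss (weightedOutput P S μ (η T S.A P.rho) T i)) - P.globalLoss xstar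
          ≤ C * (1 + Real.log T) ^ k * (P.rho / T) ∧
        expectation P T (fun i =>
            P.globalLoss (weightedOutput P S μ (η T S.A P.rho) T i)) - P.globalLoss xstar
          ≤ C * √(P.rho / T)) ∧
    -- convex, iid
    (∀ L σ R κ : ℝ, 0 < L → 0 ≤ σ → 0 ≤ R → 0 < κ →
      ∃ (C : ℝ) (η : ℕ → ℕ → ℝ → ℝ), IsLearningRate L η ∧
      ∀ (V : Type u) [Fintype V] [DecidableEq V] [Nontrivial V] (d T : ℕ)
        (P : Problem V d) (S : Protocol V) (xstar : Model d),
        Admissible P S T (η T S.A P.rho) L σ 0 →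
        StronglyConvex 0 P.globalLoss →
        (∀ x, P.globalLoss xstar ≤ P.globalLoss x) → ‖P.x0 - xstar‖ ^ 2 ≤ R →
        (S.A : ℝ) ≤ κ * (P.rho ^ (3 / 2 : ℝ) * (T : ℝ) ^ (1 / 2 : ℝ)) →
        expectation P T (fun i =>
            P.globalLoss (uniformOutput P S (η T S.A P.rho) T i)) - P.globalLoss xstar
          ≤ C * √(P.rho / T)) ∧
    -- convex, non-iid
    (∀ L σ ζ R κ : ℝ, 0 < L → 0 ≤ σ → 0 ≤ ζ → 0 ≤ R → 0 < κ →
      ∃ (C : ℝ) (η : ℕ → ℕ → ℝ → ℝ), IsLearningRate L η ∧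
      ∀ (V : Type u) [Fintype V] [DecidableEq V] [Nontrivial V] (d T : ℕ)
        (P : Problem V d) (S : Protocol V) (xstar : Model d),
        Admissible P S T (η T S.A P.rho) L σ ζ →
        (∀ v, StronglyConvex 0 (P.localLoss v)) →
        (∀ x, P.globalLoss xstar ≤ P.globalLoss x) → ‖P.x0 - xstar‖ ^ 2 ≤ R →
        (S.A : ℝ) ≤ κ * (P.rho ^ (3 / 4 : ℝ) * (T : ℝ) ^ (1 / 4 : ℝ)) →
        expectation P T (fun i =>
            P.globalLoss (uniformOutput P S (η T S.A P.rho) T i)) - P.globalLoss xstar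
          ≤ C * √(P.rho / T)) ∧
    -- non-convex, iid
    (∀ L σ F κ : ℝ, 0 < L → 0 ≤ σ → 0 ≤ F → 0 < κ →
      ∃ (C : ℝ) (η : ℕ → ℕ → ℝ → ℝ), IsLearningRate L η ∧
      ∀ (V : Type u) [Fintype V] [DecidableEq V] [Nontrivial V] (d T : ℕ)
        (P : Problem V d) (S : Protocol V),
        Admissible P S T (η T S.A P.rho) L σ 0 →
        BddBelow (Set.range P.globalLoss) → P.globalLoss P.x0 - (⨅ x, P.globalLoss x) ≤ F →
        (S.A : ℝ) ≤ κ * (P.rho ^ (3 / 2 : ℝ) * (T : ℝ) ^ (1 / 2 : ℝ)) →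
        meanSqGrad P T (virtualModel P S (η T S.A P.rho)) ≤ C * √(P.rho / T) ∧
        meanSqGrad P T (averageModel P S (η T S.A P.rho)) ≤ C * √(P.rho / T)) ∧
    -- non-convex, non-iid
    (∀ L σ ζ F κ : ℝ, 0 < L → 0 ≤ σ → 0 ≤ ζ → 0 ≤ F → 0 < κ →
      ∃ (C : ℝ) (η : ℕ → ℕ → ℝ → ℝ), IsLearningRate L η ∧
      ∀ (V : Type u) [Fintype V] [DecidableEq V] [Nontrivial V] (d T : ℕ)
        (P : Problem V d) (S : Protocol V),
        Admissible P S T (η T S.A P.rho) L σ ζ →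
        BddBelow (Set.range P.globalLoss) → P.globalLoss P.x0 - (⨅ x, P.globalLoss x) ≤ F →
        (S.A : ℝ) ≤ κ * (P.rho ^ (3 / 4 : ℝ) * (T : ℝ) ^ (1 / 4 : ℝ)) →
        meanSqGrad P T (virtualModel P S (η T S.A P.rho)) ≤ C * √(P.rho / T) ∧
        meanSqGrad P T (averageModel P S (η T S.A P.rho)) ≤ C * √(P.rho / T)) := by
  refine ⟨fun V _ _ _ d P => ⟨P.one_div_card_le_rho, P.rho_lt_one⟩, ?_, ?_, ?_, ?_, ?_, ?_⟩
  · intro L μ hL hμ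
    set Q := 128 * (L + 2 * L ^ 2 / μ) + 8 * μ with hQ
    have hQ1 : 0 < 2 * L ^ 2 / μ := by positivity
    have hQ0 : 0 < Q := by positivity
    -- This `c` turns `A ℓ ≤ c T` into `3ℓ / (μT) ≤ 1 / (Q * A)`: the rate is uncapped. `Q` involves
    -- only `L` and `μ`, as does `c`.
    refine ⟨μ / (3 * Q), by positivity, fun σ R κ j hσ hR0 hκ => ⟨6 * (R * (μ * κ + 3 * κ * Q ^ 2 / μ))
      + (3072 * (2 * L ^ 2 / μ + L) + 512 * L) * (9 * (σ ^ 2 * κ) / μ ^ 2)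
      + 6 * σ ^ 2 * (3 / μ), j + 2, logRate μ Q,
      logRate_isLearningRate hL hμ (by linarith), ?_⟩⟩
    intro V _ _ _ d T P S xstar hP hf hmin hR hA hAT
    have hA1 : (1 : ℝ) ≤ S.A := by exact_mod_cast Protocol.one_le_A hP.sync
    have hT : (0 : ℝ) < T := by exact_mod_cast hP.one_le
    -- Because `1 ≤ A`, the hypothesis on `A` also bounds `ρ T` from below up to logarithms.
    refine strongly_convex_bound hL hμ hR0 hQ hP hf hmin hR hκ.le (.inl ?_) (hA1.trans hA)
      (K' := σ ^ 2 * κ) ?_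
    · rw [div_le_div_iff₀ (by positivity) (by positivity)]
      have h1 := mul_le_mul_of_nonneg_left hAT (show 0 ≤ 3 * Q by positivity)
      have h2 : 3 * Q * (μ / (3 * Q) * T) = μ * T := by field_simp
      linarith
    · rw [mul_assoc] at hA ⊢
      exact iid_drift_le hA
  · intro L μ σ ζ R κ j hL hμ hσ hζ hR0 hκ
    set Q := 128 * (L + 2 * L ^ 2 / μ) + 8 * μ with hQ
    have hQ1 : 0 < 2 * L ^ 2 / μ := by positivity
    have hQ0 : 0 < Q := by positivity
    set C := 6 * (R * (μ * κ ^ 2 + 3 * κ ^ 2 * Q ^ 2 / μ))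
      + (3072 * (2 * L ^ 2 / μ + L) + 512 * L) * (9 * ((σ ^ 2 + ζ ^ 2) * κ ^ 2) / μ ^ 2)
      + 6 * σ ^ 2 * (3 / μ) with hC
    have hC0 : 0 ≤ C := by positivity
    -- The exponent `2 * j` and the constant `κ ^ 2` come from squaring the bound on `A`; the extra
    -- factor, from `log_bound_le_sqrt`, lets one constant serve both bounds.
    refine ⟨C * (1 + 2 * (2 * j + 2 : ℕ)) ^ (2 * j + 2), 2 * j + 2, logRate μ Q,
      logRate_isLearningRate hL hμ (by linarith), ?_⟩
    intro V _ _ _ d T P S xstar hP hf hmin hR hA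
    have hA1 : (1 : ℝ) ≤ S.A := by exact_mod_cast Protocol.one_le_A hP.sync
    have hρ := P.rho_pos
    have hl : 1 ≤ 1 + Real.log T := one_le_one_add_log
    have hA2 : (S.A : ℝ) ^ 2 ≤ κ ^ 2 * (P.rho * T) * (1 + Real.log T) ^ (2 * j) := by
      refine (pow_le_pow_left₀ (by linarith) hA 2).trans (le_of_eq ?_)
      rw [mul_pow, mul_pow, Real.sq_sqrt (by positivity), ← pow_mul, mul_comm j]
    have hmain := strongly_convex_bound (K' := (σ ^ 2 + ζ ^ 2) * κ ^ 2) hL hμ hR0 hQ hP hf hmin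
      hR (sq_nonneg κ) (.inr hA2) (by nlinarith) (by
        rw [mul_assoc] at hA2 ⊢
        exact drift_le hA1 hA2)
    refine ⟨hmain.trans ?_, hmain.trans (log_bound_le_sqrt hC0 hP.one_le (by omega) hρ.le
      P.rho_lt_one.le)⟩
    have h1 : (1 : ℝ) ≤ (1 + 2 * (2 * j + 2 : ℕ)) ^ (2 * j + 2) :=
      one_le_pow₀ (le_add_of_nonneg_right (by positivity))
    gcongr
    exact le_mul_of_one_le_right hC0 h1
  · intro L σ R κ hL hσ hR0 hκ
    refine ⟨6 * (R * (256 * L * κ + 1)) + 6656 * L * (σ ^ 2 * κ) + 6 * σ ^ 2,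
      sqrtRate (256 * L), sqrtRate_isLearningRate hL (by linarith), ?_⟩
    intro V _ _ _ d T P S xstar hP hf hmin hR hA
    have hA' := le_of_le_halves P.rho_pos.le hA
    exact convex_bound hL hR0 hκ.le hP hf hmin hR
      (fun i t ht => correlation_of_iid hP hf hmin i ht) hA' (iid_drift_le hA')
  · intro L σ ζ R κ hL hσ hζ hR0 hκ
    refine ⟨6 * (R * (256 * L * κ ^ 2 + 1)) + 6656 * L * ((σ ^ 2 + ζ ^ 2) * κ ^ 2) + 6 * σ ^ 2,
      sqrtRate (256 * L), sqrtRate_isLearningRate hL (by linarith), ?_⟩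
    intro V _ _ _ d T P S xstar hP hf hmin hR hA
    have hA1 : (1 : ℝ) ≤ S.A := by exact_mod_cast Protocol.one_le_A hP.sync
    -- As `1 ≤ A ≤ A²`, this bounds both `A` and the drift, with `κ ^ 2` in place of `κ`.
    have hA2 := sq_le_of_le_quarters hA1 P.rho_pos.le hA
    exact convex_bound hL hR0 (sq_nonneg κ) hP (P.globalLoss_convex hf) hmin hR
      (fun i t _ => correlation_of_localLoss_convex hP hf hmin i t)
      ((le_self_pow₀ hA1 two_ne_zero).trans hA2) (drift_le hA1 hA2)
  · intro L σ F κ hL hσ hF0 hκ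
    refine ⟨12 * (F * (256 * L * κ + 1)) + 4096 * L ^ 2 * (σ ^ 2 * κ) + 6 * L * σ ^ 2,
      sqrtRate (256 * L), sqrtRate_isLearningRate hL (by linarith), ?_⟩
    intro V _ _ _ d T P S hP hbdd hF hA
    have hA' := le_of_le_halves P.rho_pos.le hA
    exact nonconvex_bound hL hF0 hκ.le hP hbdd hF hA' (iid_drift_le hA')
  · intro L σ ζ F κ hL hσ hζ hF0 hκ
    refine ⟨12 * (F * (256 * L * κ ^ 2 + 1)) + 4096 * L ^ 2 * ((σ ^ 2 + ζ ^ 2) * κ ^ 2) + 6 * L * σ ^ 2,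
      sqrtRate (256 * L), sqrtRate_isLearningRate hL (by linarith), ?_⟩
    intro V _ _ _ d T P S hP hbdd hF hA
    have hA1 : (1 : ℝ) ≤ S.A := by exact_mod_cast Protocol.one_le_A hP.sync
    have hA2 := sq_le_of_le_quarters hA1 P.rho_pos.le hA
    exact nonconvex_bound hL hF0 (sq_nonneg κ) hP hbdd hF
      ((le_self_pow₀ hA1 two_ne_zero).trans hA2) (drift_le hA1 hA2)
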